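/- Let $p$ be an odd prime, let $\sigma$ be a generator of the cyclic group $C_p$, and let $\zeta=e^{2\pi i/p}$. A $C_p$-space is a topological space with an action of $C_p$. For $u\in(\mathbb Z/p)^\times$ put: * $S^{2,1}_{(u)}$: the sphere $\mathbb C\cup\{\infty\}$ on which $\sigma$ acts by $z\mapsto\zeta^u z$. The ribbon $R_{p,(u)}$ is $S^{2,1}_{(u)}$ with the interiors of $p$ disjoint conjugate closed disks $E,\sigma E,\dots,\sigma^{p-1}E$ removed. * $\operatorname{Poly}_{1,(u)}$: the $2p$-gon with opposite edges identified in the same direction (by translation), on which $\sigma$ acts by rotation by $\zeta^u$ about the centre. The twisted ribbon $TR_{p,(u)}$ is $\operatorname{Poly}_{1,(u)}$ with an open invariant disk about its centre removed. Ribbon surgery $X+[R_{p,(u)}]$ removes from a $C_p$-surface $X$ the interiors of $p$ disjoint conjugate closed disks $D,\sigma D,\dots,\sigma^{p-1}D$ and glues the boundary equivariantly to that of $R_{p,(u)}$. If $x$ is a fixed point of $X$ at which $\sigma$ acts as rotation by $\zeta^u$, twisted ribbon surgery $X+_x[TR_{p,(u)}]$ removes an open invariant disk about $x$ and glues the boundary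 equivariantly to that of $TR_{p,(u)}$. (All disks below are round disks, fixed once and for all.) For $i,j,k\in(\mathbb Z/p)^\times$ let $$\operatorname{Sph}_{2(p-1)}[6]=\bigl(S^{2,1}_{(i)}+[R_{p,(j)}]\bigr)+[R_{p,(k)}],$$ and for $u,v\in(\mathbb Z/p)^\times$ with $u+v\neq 0$ let $$\operatorname{Poly}_2=\bigl(\operatorname{Poly}_{1,(u)}+[R_{p,(v)}]\bigr)+_b[TR_{p,(v)}],$$ where $b$ is the pole of the ribbon $R_{p,(v)}$ at which $\sigma$ acts, with respect to the orientation of $\operatorname{Poly}_{1,(u)}+[R_{p,(v)}]$ for which it rotates by $\zeta^{u}$ at the centre of $\operatorname{Poly}_{1,(u)}$, as rotation by $\zeta^{-v}$. (For $u=v$ this is the tower of two equally rotating copies of $\operatorname{Poly}_{1,(u)}$; for $p=3$ the condition $u+v\ne0$ means $u=v$.) Then, for all such $i,j,k,u,v$, both $\operatorname{Sph}_{2(p-1)}[6]$ and $\operatorname{Poly}_2$ have exactly six fixed points, and they are not equivariantly isomorphic, even up to the action of $\operatorname{Aut}(C_p)$: there are no $a\in(\mathbb Z/p)^\times$ and homeomorphism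 $f\colon \operatorname{Sph}_{2(p-1)}[6]\to\operatorname{Poly}_2$ with $f(\sigma x)=\sigma^a f(x)$ for all $x$. -/

import Mathlib

noncomputable section

open Complex Metric

/-! ### Spaces with an action of the cyclic group of order `p` -/

/-- A topological space with an action of `C_p`, given by the action `act` of the chosen generator
of `C_p` (a continuous map whose `p`-th iterate is the identity, hence a homeomorphism). -/
structure CpSpace (p : ℕ) where
  carrier : Type
  [top : TopologicalSpace carrier]
  act : carrier → carrier
  continuous_act : Continuous act
  iterate_act : ∀ x, act^[p] x = x

attribute [instance] CpSpace.top

namespace CpSpace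

variable {p : ℕ}

/-- The fixed points of the action. -/
def fixedSet (X : CpSpace p) : Set X.carrier := {x | X.act x = x}

/-- `X` and `Y` are equivariantly isomorphic up to the action of `Aut(C_p) = (ZMod p)ˣ`: for some
automorphism `g ↦ g ^ a` of `C_p` there is a homeomorphism `f` with `f (g x) = g ^ a (f x)`.
The case `a = 1` is the ordinary notion of equivariant isomorphism. -/
def IsoUpToAut (X Y : CpSpace p) : Prop :=
  ∃ a : (ZMod p)ˣ, ∃ f : X.carrier ≃ₜ Y.carrier,
    ∀ x, f (X.act x) = Y.act^[(a : ZMod p).val] (f x)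

/-- An invariant subspace. -/
def restrict (X : CpSpace p) (A : Set X.carrier) (hA : ∀ x ∈ A, X.act x ∈ A) : CpSpace p where
  carrier := A
  act x := ⟨X.act x, hA x x.2⟩
  continuous_act := (X.continuous_act.comp continuous_subtype_val).subtype_mk _
  iterate_act x := by
    have h : ∀ n : ℕ, ∀ y : A, (((fun x : A => (⟨X.act x, hA x x.2⟩ : A))^[n] y : A) : X.carrier)
        = X.act^[n] y := by
      intro n
      induction n with
      | zero => intro y; rfl
      | succ n ih => intro y; simp only [Function.iterate_succ_apply]; rw [ih]
    exact Subtype.ext ((h p x).trans (X.iterate_act x))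

/-- The elementary identifications of `X ⊔ Y` given by a relation between `X` and `Y`. -/
inductive GlueRel {X Y : Type} (r : X → Y → Prop) : X ⊕ Y → X ⊕ Y → Prop
  | mk {x : X} {y : Y} (h : r x y) : GlueRel r (Sum.inl x) (Sum.inr y)

/-- The quotient `(X ⊔ Y) / ∼`, where `x ∼ y` whenever `r x y`, for an equivariant relation `r`
between `X` and `Y`, with the induced action. -/
def glue (X Y : CpSpace p) (r : X.carrier → Y.carrier → Prop)
    (hr : ∀ x y, r x y → r (X.act x) (Y.act y)) : CpSpace p where
  carrier := Quot (GlueRel r)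
  act := Quot.map (Sum.map X.act Y.act) (by
    rintro _ _ ⟨h⟩
    exact GlueRel.mk (hr _ _ h))
  continuous_act := by
    refine continuous_quot_lift _ ?_
    exact continuous_quot_mk.comp (X.continuous_act.sumMap Y.continuous_act)
  iterate_act := by
    have h : ∀ n : ℕ, ∀ z : X.carrier ⊕ Y.carrier,
        (Quot.map (Sum.map X.act Y.act) (by
          rintro _ _ ⟨h⟩
          exact GlueRel.mk (hr _ _ h)) : Quot (GlueRel r) → Quot (GlueRel r))^[n] (Quot.mk _ z)
        = Quot.mk _ (Sum.map (X.act^[n]) (Y.act^[n]) z) := by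
      intro n
      induction n with
      | zero => intro z; cases z <;> rfl
      | succ n ih =>
        intro z
        rw [Function.iterate_succ_apply]
        refine (ih _).trans ?_
        cases z <;> rfl
    rintro ⟨z⟩
    refine (h p z).trans ?_
    cases z with
    | inl x => exact congrArg (fun t => Quot.mk _ (Sum.inl t)) (X.iterate_act x)
    | inr y => exact congrArg (fun t => Quot.mk _ (Sum.inr t)) (Y.iterate_act y)

theorem act_injective [NeZero p] (X : CpSpace p) : Function.Injective X.act := by
  intro x y h
  obtain ⟨q, hq⟩ := Nat.exists_eq_succ_of_ne_zero (NeZero.ne p)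
  have e : ∀ z, X.act^[p] z = X.act^[q] (X.act z) := fun z => by
    rw [← Function.iterate_succ_apply, ← hq]
  rw [← X.iterate_act x, ← X.iterate_act y, e, e, h]

theorem glue_mk_eq_inl {X Y : Type} {r : X → Y → Prop} {x x' : X}
    (hx : ∀ y, ¬ r x y)
    (h : Quot.mk (GlueRel r) (Sum.inl x') = Quot.mk (GlueRel r) (Sum.inl x)) : x' = x := by
  let P : Quot (GlueRel r) → Prop := Quot.lift
    (fun z => match z with
      | Sum.inl t => t = x
      | Sum.inr _ => False) (by
      rintro _ _ ⟨h'⟩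
      simp only [eq_iff_iff, iff_false]
      rintro rfl
      exact hx _ h')
  have h1 : P (Quot.mk _ (Sum.inl x)) := rfl
  rw [← h] at h1
  exact h1

theorem glue_mk_eq_inr {X Y : Type} {r : X → Y → Prop} {y y' : Y}
    (hy : ∀ x, ¬ r x y)
    (h : Quot.mk (GlueRel r) (Sum.inr y') = Quot.mk (GlueRel r) (Sum.inr y)) : y' = y := by
  let P : Quot (GlueRel r) → Prop := Quot.lift
    (fun z => match z with
      | Sum.inl _ => False
      | Sum.inr t => t = y) (by
      rintro _ _ ⟨h'⟩
      simp only [eq_iff_iff, false_iff]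
      rintro rfl
      exact hy _ h')
  have h1 : P (Quot.mk _ (Sum.inr y)) := rfl
  rw [← h] at h1
  exact h1

end CpSpace

/-! ### Disks and surgeries -/

/-- The closed unit disk. -/
abbrev UnitDisk : Type := closedBall (0 : ℂ) 1

theorem UnitDisk.norm_le (w : UnitDisk) : ‖(w : ℂ)‖ ≤ 1 :=
  mem_closedBall_zero_iff.1 w.2

/-- Rotation of the closed unit disk by `c`. -/
def UnitDisk.rot (c : Circle) (w : UnitDisk) : UnitDisk :=
  ⟨(c : ℂ) * w, by
    rw [mem_closedBall_zero_iff, norm_mul, Circle.norm_coe, one_mul]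
    exact w.norm_le⟩

theorem UnitDisk.norm_rot (c : Circle) (w : UnitDisk) : ‖(w.rot c : ℂ)‖ = ‖(w : ℂ)‖ := by
  rw [UnitDisk.rot, norm_mul, Circle.norm_coe, one_mul]

variable {p : ℕ}

/-- An embedded closed disk `D` in `X` which is disjoint from its conjugates `σ D, …, σ^(p-1) D`.
(A continuous injection of the disk into a Hausdorff space is an embedding.) -/
structure ConjDisk (X : CpSpace p) where
  toFun : UnitDisk → X.carrier
  continuous_toFun : Continuous toFun
  inj_disjoint : ∀ k < p, ∀ v w, X.act^[k] (toFun v) = toFun w → k = 0 ∧ v = w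
  isOpen_interior : IsOpen (toFun '' {w | ‖(w : ℂ)‖ < 1})

/-- An embedded closed disk in `X`, invariant under the action, on which the generator acts by
rotation by `e^{2 π i u / p}` about the centre. -/
structure FixedDisk (X : CpSpace p) [NeZero p] (u : (ZMod p)ˣ) where
  toFun : UnitDisk → X.carrier
  continuous_toFun : Continuous toFun
  injective_toFun : Function.Injective toFun
  act_toFun : ∀ w, X.act (toFun w) = toFun (UnitDisk.rot (ZMod.toCircle (u : ZMod p)) w)
  isOpen_interior : IsOpen (toFun '' {w | ‖(w : ℂ)‖ < 1})

/-- `X` with the open disks `int D, σ (int D), …, σ^(p-1) (int D)` removed. -/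
def ConjDisk.compl [NeZero p] {X : CpSpace p} (D : ConjDisk X) : CpSpace p :=
  X.restrict {x | ∀ (k : ℕ) (w : UnitDisk), ‖(w : ℂ)‖ < 1 → X.act^[k] (D.toFun w) ≠ x} (by
    intro x hx k w hw h
    refine hx (k + (p - 1)) w hw (X.act_injective ?_)
    rw [← Function.iterate_succ_apply' (f := X.act),
      show (k + (p - 1)).succ = p + k by have := NeZero.pos p; omega,
      Function.iterate_add_apply, X.iterate_act, h])

/-- `X` with the interior of an invariant disk removed. -/
def FixedDisk.compl [NeZero p] {X : CpSpace p} {u : (ZMod p)ˣ} (D : FixedDisk X u) : CpSpace p :=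
  X.restrict {x | ∀ w : UnitDisk, ‖(w : ℂ)‖ < 1 → D.toFun w ≠ x} (by
    intro x hx w hw h
    refine hx (UnitDisk.rot (ZMod.toCircle (u : ZMod p))⁻¹ w) ?_ (X.act_injective ?_)
    · exact (UnitDisk.norm_rot _ w).trans_lt hw
    · rw [D.act_toFun, ← h]
      congr 1
      exact Subtype.ext (by simp [UnitDisk.rot]))

/-- Remove the conjugates of the open disks `D` and `E` from `X` and `Y` and glue the boundary
circles equivariantly, `σ^k (D w)` to `σ^k (E w)` for `‖w‖ = 1`. -/
def ConjDisk.glue [NeZero p] {X Y : CpSpace p} (D : ConjDisk X) (E : ConjDisk Y) : CpSpace p :=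
  CpSpace.glue D.compl E.compl
    (fun x y => ∃ (k : ℕ) (w : UnitDisk), ‖(w : ℂ)‖ = 1 ∧
      X.act^[k] (D.toFun w) = x.1 ∧ Y.act^[k] (E.toFun w) = y.1) (by
    rintro x y ⟨k, w, hw, hx, hy⟩
    refine ⟨k + 1, w, hw, ?_, ?_⟩
    · rw [Function.iterate_succ_apply', hx]; rfl
    · rw [Function.iterate_succ_apply', hy]; rfl)

/-- Remove the interiors of the invariant disks `D` and `E` from `X` and `Y` and glue the boundary
circles equivariantly, `D w` to `E w` for `‖w‖ = 1`. -/
def FixedDisk.glue [NeZero p] {X Y : CpSpace p} {u : (ZMod p)ˣ} (D : FixedDisk X u)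
    (E : FixedDisk Y u) : CpSpace p :=
  CpSpace.glue D.compl E.compl
    (fun x y => ∃ w : UnitDisk, ‖(w : ℂ)‖ = 1 ∧ D.toFun w = x.1 ∧ E.toFun w = y.1) (by
    rintro x y ⟨w, hw, hx, hy⟩
    refine ⟨UnitDisk.rot (ZMod.toCircle (u : ZMod p)) w, ?_, ?_, ?_⟩
    · exact (UnitDisk.norm_rot _ w).trans hw
    · rw [← D.act_toFun, hx]; rfl
    · rw [← E.act_toFun, hy]; rfl)

/-- The inclusion of `X` minus the removed disks into the glued space. -/
def ConjDisk.inl [NeZero p] {X Y : CpSpace p} (D : ConjDisk X) (E : ConjDisk Y) :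
    D.compl.carrier → (D.glue E).carrier :=
  fun x => Quot.mk _ (Sum.inl x)

/-- The inclusion of `Y` minus the removed disks into the glued space. -/
def ConjDisk.inr [NeZero p] {X Y : CpSpace p} (D : ConjDisk X) (E : ConjDisk Y) :
    E.compl.carrier → (D.glue E).carrier :=
  fun y => Quot.mk _ (Sum.inr y)

theorem ConjDisk.compl_iterate_act [NeZero p] {X : CpSpace p} (D : ConjDisk X) (n : ℕ)
    (x : D.compl.carrier) : (D.compl.act^[n] x).1 = X.act^[n] x.1 := by
  induction n generalizing x with
  | zero => rfl
  | succ n ih => rw [Function.iterate_succ_apply, ih]; rfl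

theorem ConjDisk.iterate_act_inl [NeZero p] {X Y : CpSpace p} (D : ConjDisk X) (E : ConjDisk Y)
    (n : ℕ) (x : D.compl.carrier) :
    (D.glue E).act^[n] (D.inl E x) = D.inl E (D.compl.act^[n] x) := by
  induction n generalizing x with
  | zero => rfl
  | succ n ih => exact ih (D.compl.act x)

/-- A disk of `X` which is disjoint from `D` and its conjugates, seen in the space obtained by
surgery on `X` along `D`. -/
def ConjDisk.survive [NeZero p] {X Y : CpSpace p} (D : ConjDisk X) (E : ConjDisk Y)
    (F : ConjDisk X) (hF : ∀ k v w, X.act^[k] (D.toFun v) ≠ F.toFun w) : ConjDisk (D.glue E) where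
  toFun w := D.inl E ⟨F.toFun w, fun k v _ => hF k v w⟩
  continuous_toFun := by
    refine continuous_quot_mk.comp (continuous_inl.comp ?_)
    exact F.continuous_toFun.subtype_mk _
  inj_disjoint k hk v w h := by
    replace h := (D.iterate_act_inl E _ _).symm.trans h
    have h' := CpSpace.glue_mk_eq_inl (by
      rintro y ⟨j, t, -, ht, -⟩
      exact hF _ _ _ ht) h
    have h'' := congrArg Subtype.val h'
    replace h'' := (D.compl_iterate_act _ _).symm.trans h''
    exact F.inj_disjoint k hk v w h''
  isOpen_interior := by
    refine isOpen_coinduced.2 ?_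
    rw [isOpen_sum_iff]
    constructor
    · refine isOpen_induced_iff.2 ⟨_, F.isOpen_interior, ?_⟩
      ext x
      constructor
      · rintro ⟨w, hw, hx⟩
        refine ⟨w, hw, ?_⟩
        exact congrArg (fun t => (Quot.mk _ (Sum.inl t) : (D.glue E).carrier)) (Subtype.ext hx)
      · rintro ⟨w, hw, hx⟩
        refine ⟨w, hw, ?_⟩
        have := CpSpace.glue_mk_eq_inl (by
          rintro y ⟨j, t, -, ht, -⟩
          exact hF _ _ _ ht) hx.symm
        exact (congrArg Subtype.val this).symm
    · convert isOpen_empty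
      ext y
      simp only [Set.mem_preimage, Set.mem_empty_iff_false, iff_false]
      rintro ⟨w, hw, hy⟩
      let r := fun (x : D.compl.carrier) (y : E.compl.carrier) =>
        ∃ (k : ℕ) (w : UnitDisk), ‖(w : ℂ)‖ = 1 ∧
          X.act^[k] (D.toFun w) = x.1 ∧ Y.act^[k] (E.toFun w) = y.1
      let x0 : D.compl.carrier := ⟨F.toFun w, fun k v _ => hF k v w⟩
      let P : Quot (CpSpace.GlueRel r) → Prop := Quot.lift
        (fun z => match z with
          | Sum.inl t => t = x0
          | Sum.inr _ => False) (by
          rintro _ _ ⟨h⟩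
          simp only [eq_iff_iff, iff_false]
          rintro rfl
          obtain ⟨j, t, -, ht, -⟩ := h
          exact hF _ _ _ ht)
      have h1 : P (Quot.mk _ (Sum.inl x0)) := rfl
      have h2 : (Quot.mk (CpSpace.GlueRel r) (Sum.inl x0)) = Quot.mk _ (Sum.inr y) := hy
      rw [h2] at h1
      exact h1

/-- An invariant disk of `Y` which is disjoint from `E` and its conjugates, seen in the space
obtained by gluing `Y` to `X` along `E`. -/
def FixedDisk.survive [NeZero p] {X Y : CpSpace p} {u : (ZMod p)ˣ} (D : ConjDisk X)
    (E : ConjDisk Y) (F : FixedDisk Y u) (hF : ∀ k v w, Y.act^[k] (E.toFun v) ≠ F.toFun w) :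
    FixedDisk (D.glue E) u where
  toFun w := D.inr E ⟨F.toFun w, fun k v _ => hF k v w⟩
  continuous_toFun := by
    refine continuous_quot_mk.comp (continuous_inr.comp ?_)
    exact F.continuous_toFun.subtype_mk _
  injective_toFun v w h := by
    have h' := CpSpace.glue_mk_eq_inr (by
      rintro y ⟨j, t, -, -, ht⟩
      exact hF _ _ _ ht) h
    exact F.injective_toFun (congrArg Subtype.val h')
  act_toFun w := by
    refine congrArg (fun t => (Quot.mk _ (Sum.inr t) : (D.glue E).carrier)) (Subtype.ext ?_)
    exact F.act_toFun w
  isOpen_interior := by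
    refine isOpen_coinduced.2 ?_
    rw [isOpen_sum_iff]
    constructor
    · convert isOpen_empty
      ext x
      simp only [Set.mem_preimage, Set.mem_empty_iff_false, iff_false]
      rintro ⟨w, hw, hx⟩
      let r := fun (x : D.compl.carrier) (y : E.compl.carrier) =>
        ∃ (k : ℕ) (w : UnitDisk), ‖(w : ℂ)‖ = 1 ∧
          X.act^[k] (D.toFun w) = x.1 ∧ Y.act^[k] (E.toFun w) = y.1
      let y0 : E.compl.carrier := ⟨F.toFun w, fun k v _ => hF k v w⟩
      let P : Quot (CpSpace.GlueRel r) → Prop := Quot.lift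
        (fun z => match z with
          | Sum.inl _ => False
          | Sum.inr t => t = y0) (by
          rintro _ _ ⟨h⟩
          simp only [eq_iff_iff, false_iff]
          rintro rfl
          obtain ⟨j, t, -, -, ht⟩ := h
          exact hF _ _ _ ht)
      have h1 : P (Quot.mk _ (Sum.inr y0)) := rfl
      have h2 : (Quot.mk (CpSpace.GlueRel r) (Sum.inr y0)) = Quot.mk _ (Sum.inl x) := hx
      rw [h2] at h1
      exact h1
    · refine isOpen_induced_iff.2 ⟨_, F.isOpen_interior, ?_⟩
      ext x
      constructor
      · rintro ⟨w, hw, hx⟩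
        refine ⟨w, hw, ?_⟩
        exact congrArg (fun t => (Quot.mk _ (Sum.inr t) : (D.glue E).carrier)) (Subtype.ext hx)
      · rintro ⟨w, hw, hx⟩
        refine ⟨w, hw, ?_⟩
        have := CpSpace.glue_mk_eq_inr (by
          rintro y ⟨j, t, -, -, ht⟩
          exact hF _ _ _ ht) hx.symm
        exact (congrArg Subtype.val this).symm

/-! ### Rotations by `p`-th roots of unity -/

theorem iterate_mul_toCircle [NeZero p] (u : ZMod p) (n : ℕ) (z : ℂ) :
    (fun z : ℂ => (ZMod.toCircle u : ℂ) * z)^[n] z = (ZMod.toCircle ((n : ZMod p) * u) : ℂ) * z := by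
  induction n generalizing z with
  | zero => simp
  | succ n ih =>
    rw [Function.iterate_succ_apply, ih]
    push_cast
    rw [add_mul, one_mul, AddChar.map_add_eq_mul, Circle.coe_mul, mul_assoc]

theorem four_div_le_norm_toCircle_sub_one [NeZero p] (m : ZMod p) (hm : m ≠ 0) :
    4 / (p : ℝ) ≤ ‖(ZMod.toCircle m : ℂ) - 1‖ := by
  have hp : (0 : ℝ) < p := by exact_mod_cast NeZero.pos p
  have h0 : 0 < m.val := Nat.pos_of_ne_zero (by simpa [ZMod.val_eq_zero] using hm)
  have h1 : m.val < p := ZMod.val_lt m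
  have hx1 : (1 : ℝ) ≤ m.val := by exact_mod_cast h0
  have hx2 : (m.val : ℝ) + 1 ≤ p := by exact_mod_cast h1
  have key : 2 / (p : ℝ) ≤ Real.sin (Real.pi * m.val / p) := by
    have hpi := Real.pi_pos
    rcases le_total (m.val : ℝ) (p / 2) with h | h
    · have := Real.mul_le_sin (x := Real.pi * m.val / p) (by positivity) (by
        rw [div_le_iff₀ hp]; nlinarith)
      refine le_trans ?_ this
      rw [show 2 / Real.pi * (Real.pi * m.val / p) = 2 * m.val / p by field_simp]
      gcongr; linarith
    · have := Real.mul_le_sin (x := Real.pi * (p - m.val) / p)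
        (by apply div_nonneg _ hp.le; nlinarith) (by
        rw [div_le_iff₀ hp]; nlinarith)
      rw [show Real.pi * m.val / p = Real.pi - Real.pi * (p - m.val) / p by field_simp; ring,
        Real.sin_pi_sub]
      refine le_trans ?_ this
      rw [show 2 / Real.pi * (Real.pi * (p - m.val) / p) = 2 * (p - m.val) / p by field_simp]
      gcongr; linarith
  rw [ZMod.toCircle_apply]
  have := Complex.norm_exp_I_mul_ofReal_sub_one (2 * Real.pi * m.val / p)
  rw [show (I * ((2 * Real.pi * m.val / p : ℝ) : ℂ)) = 2 * Real.pi * I * m.val / p by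
    push_cast; ring] at this
  rw [this, Real.norm_eq_abs, show 2 * Real.pi * (m.val : ℝ) / p / 2 = Real.pi * m.val / p by ring]
  refine le_trans ?_ (le_abs_self _)
  rw [show 4 / (p : ℝ) = 2 * (2 / p) by ring]
  linarith

theorem round_disk_aux [Fact p.Prime] (u : (ZMod p)ˣ) (c r : ℝ) (hr : 0 < r) (hc : p * r < 2 * c)
    (k : ℕ) (hk : k < p) (v w : UnitDisk)
    (h : (ZMod.toCircle ((k : ZMod p) * (u : ZMod p)) : ℂ) * (c + r * v) = c + r * w) : k = 0 ∧ v = w := by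
  have hp : (0 : ℝ) < p := by exact_mod_cast NeZero.pos p
  have hk0 : k = 0 := by
    by_contra hk0
    have hne : ((k : ZMod p) * (u : ZMod p)) ≠ 0 := by
      refine mul_ne_zero ?_ u.ne_zero
      intro h0
      rw [ZMod.natCast_eq_zero_iff] at h0
      exact hk0 (Nat.eq_zero_of_dvd_of_lt h0 hk)
    have h1 := four_div_le_norm_toCircle_sub_one _ hne
    set ω : ℂ := (ZMod.toCircle ((k : ZMod p) * (u : ZMod p)) : ℂ) with hω
    have hωn : ‖ω‖ = 1 := Circle.norm_coe _
    have hv : ‖(v : ℂ)‖ ≤ 1 := v.norm_le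
    have hw : ‖(w : ℂ)‖ ≤ 1 := w.norm_le
    have hcpos : 0 < c := by nlinarith [mul_pos hp hr]
    have h2 : (c : ℂ) * (ω - 1) = r * (w - ω * v) := by linear_combination h
    have h3 : c * ‖ω - 1‖ = r * ‖(w : ℂ) - ω * v‖ := by
      have := congrArg norm h2
      simpa [abs_of_pos hcpos, abs_of_pos hr] using this
    have h4 : ‖(w : ℂ) - ω * v‖ ≤ 2 := by
      refine (norm_sub_le _ _).trans ?_
      rw [norm_mul, hωn]; linarith
    have h5 : c * (4 / p) ≤ 2 * r := by nlinarith
    rw [mul_div_assoc', div_le_iff₀ hp] at h5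
    nlinarith
  refine ⟨hk0, ?_⟩
  subst hk0
  have hr' : (r : ℂ) ≠ 0 := by exact_mod_cast hr.ne'
  simp only [Nat.cast_zero, zero_mul, AddChar.map_zero_eq_one, Circle.coe_one, one_mul,
    add_right_inj] at h
  exact Subtype.ext (mul_left_cancel₀ hr' h)

theorem isOpen_round_disk (c r : ℝ) (hr : 0 < r) :
    IsOpen ((fun w : UnitDisk => (c : ℂ) + r * w) '' {w | ‖(w : ℂ)‖ < 1}) := by
  convert (isOpen_ball : IsOpen (ball (c : ℂ) r))
  have hr' : (r : ℂ) ≠ 0 := by exact_mod_cast hr.ne'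
  ext z
  constructor
  · rintro ⟨w, hw, rfl⟩
    simp only [mem_ball, dist_eq_norm, add_sub_cancel_left, norm_mul, norm_real, Real.norm_eq_abs,
      abs_of_pos hr]
    have hw' : ‖(w : ℂ)‖ < 1 := hw
    nlinarith
  · intro hz
    have hz' : ‖(z - c) / r‖ < 1 := by
      rw [norm_div, norm_real, Real.norm_eq_abs, abs_of_pos hr, div_lt_one hr]
      simpa [dist_eq_norm] using hz
    refine ⟨⟨(z - c) / r, by simpa using hz'.le⟩, hz', ?_⟩
    simp only
    field_simp
    ring

/-! ### The representation spheres -/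

open scoped OnePoint in
/-- The representation sphere `S^{2,1}_(u)`: the one-point compactification of `ℂ` with rotation
by `e^{2 π i u / p}`. -/
def repSphere (p : ℕ) [NeZero p] (u : (ZMod p)ˣ) : CpSpace p where
  carrier := OnePoint ℂ
  act := OnePoint.map (fun z : ℂ => (ZMod.toCircle (u : ZMod p) : ℂ) * z)
  continuous_act := by
    have hc : (ZMod.toCircle (u : ZMod p) : ℂ) ≠ 0 := Circle.coe_ne_zero _
    exact OnePoint.continuous_map (continuous_const.mul continuous_id)
      (Homeomorph.mulLeft₀ (ZMod.toCircle (u : ZMod p) : ℂ) hc).map_coclosedCompact.le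
  iterate_act x := by
    induction x using OnePoint.rec with
    | infty => exact Function.iterate_fixed rfl p
    | coe z =>
      have h : ∀ n : ℕ, ∀ z : ℂ,
          (OnePoint.map (fun z : ℂ => (ZMod.toCircle (u : ZMod p) : ℂ) * z))^[n] (z : OnePoint ℂ)
          = (((fun z : ℂ => (ZMod.toCircle (u : ZMod p) : ℂ) * z)^[n] z : ℂ) : OnePoint ℂ) := by
        intro n
        induction n with
        | zero => intro z; rfl
        | succ n ih => intro z; exact ih _
      rw [h, iterate_mul_toCircle]
      simp

theorem repSphere_iterate_act [NeZero p] (u : (ZMod p)ˣ) (n : ℕ) (z : ℂ) :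
    (repSphere p u).act^[n] ((z : OnePoint ℂ) : (repSphere p u).carrier)
      = (((ZMod.toCircle ((n : ZMod p) * (u : ZMod p)) : ℂ) * z : ℂ) : OnePoint ℂ) := by
  rw [← iterate_mul_toCircle]
  induction n generalizing z with
  | zero => rfl
  | succ n ih => exact ih _

/-- The round disk with centre `c > 0` on the real axis and radius `r`, in `S^{2,1}_(u)`. -/
def sphereDisk (p : ℕ) [Fact p.Prime] (u : (ZMod p)ˣ) (c r : ℝ) (hr : 0 < r)
    (hc : p * r < 2 * c) : ConjDisk (repSphere p u) where
  toFun w := (((c : ℂ) + r * w : ℂ) : OnePoint ℂ)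
  continuous_toFun := by
    refine OnePoint.continuous_coe.comp ?_
    fun_prop
  inj_disjoint k hk v w h := by
    rw [repSphere_iterate_act] at h
    exact round_disk_aux u c r hr hc k hk v w (OnePoint.coe_injective h)
  isOpen_interior := by
    have := OnePoint.isOpenEmbedding_coe.isOpenMap _ (isOpen_round_disk c r hr)
    rwa [Set.image_image] at this

/-- The disk of `S^{2,1}_(u)` with centre `1` (on the equator) and radius `1 / p`. -/
def equatorDisk (p : ℕ) [Fact p.Prime] (u : (ZMod p)ˣ) : ConjDisk (repSphere p u) :=
  sphereDisk p u 1 (1 / p) (by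
      have : (0 : ℝ) < p := by exact_mod_cast NeZero.pos p
      positivity) (by
      have : (0 : ℝ) < p := by exact_mod_cast NeZero.pos p
      rw [mul_one_div_cancel this.ne']; norm_num)

/-- The disk of `S^{2,1}_(u)` with centre `3` and radius `1 / p`. -/
def outerDisk (p : ℕ) [Fact p.Prime] (u : (ZMod p)ˣ) : ConjDisk (repSphere p u) :=
  sphereDisk p u 3 (1 / p) (by
      have : (0 : ℝ) < p := by exact_mod_cast NeZero.pos p
      positivity) (by
      have : (0 : ℝ) < p := by exact_mod_cast NeZero.pos p
      rw [mul_one_div_cancel this.ne']; norm_num)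

theorem equatorDisk_norm_aux [Fact p.Prime] (v : UnitDisk) :
    1 / 2 ≤ ‖((1 : ℝ) : ℂ) + ((1 / p : ℝ) : ℂ) * v‖ ∧
      ‖((1 : ℝ) : ℂ) + ((1 / p : ℝ) : ℂ) * v‖ ≤ 3 / 2 := by
  have hp : (2 : ℝ) ≤ p := by exact_mod_cast (Fact.out : p.Prime).two_le
  have hv : ‖(v : ℂ)‖ ≤ 1 := v.norm_le
  have h1 : ‖((1 / p : ℝ) : ℂ) * v‖ ≤ 1 / 2 := by
    rw [norm_mul, norm_real, Real.norm_eq_abs, abs_of_nonneg (by positivity)]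
    have : 1 / (p : ℝ) ≤ 1 / 2 := one_div_le_one_div_of_le (by norm_num) hp
    have h0 : 0 ≤ 1 / (p : ℝ) := by positivity
    nlinarith [norm_nonneg (v : ℂ)]
  constructor
  · have := norm_sub_le_norm_add ((1 : ℝ) : ℂ) (((1 / p : ℝ) : ℂ) * v)
    have h2 : ‖((1 : ℝ) : ℂ)‖ = 1 := by simp
    linarith
  · have := norm_add_le ((1 : ℝ) : ℂ) (((1 / p : ℝ) : ℂ) * v)
    have h2 : ‖((1 : ℝ) : ℂ)‖ = 1 := by simp
    linarith

theorem equatorDisk_ne_outerDisk [Fact p.Prime] (u : (ZMod p)ˣ) (k : ℕ) (v w : UnitDisk) :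
    (repSphere p u).act^[k] ((equatorDisk p u).toFun v) ≠ (outerDisk p u).toFun w := by
  intro h
  have h' := (repSphere_iterate_act u k _).symm.trans h
  have h2 := congrArg norm (OnePoint.coe_injective h')
  rw [norm_mul, Circle.norm_coe, one_mul] at h2
  have h3 := (equatorDisk_norm_aux (p := p) v).2
  have hp : (2 : ℝ) ≤ p := by exact_mod_cast (Fact.out : p.Prime).two_le
  have hw : ‖(w : ℂ)‖ ≤ 1 := w.norm_le
  have h1 : ‖((1 / p : ℝ) : ℂ) * w‖ ≤ 1 / 2 := by
    rw [norm_mul, norm_real, Real.norm_eq_abs, abs_of_nonneg (by positivity)]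
    have : 1 / (p : ℝ) ≤ 1 / 2 := one_div_le_one_div_of_le (by norm_num) hp
    have h0 : 0 ≤ 1 / (p : ℝ) := by positivity
    nlinarith [norm_nonneg (w : ℂ)]
  have h4 := norm_sub_le_norm_add ((3 : ℝ) : ℂ) (((1 / p : ℝ) : ℂ) * w)
  have h5 : ‖((3 : ℝ) : ℂ)‖ = 3 := by simp
  linarith

/-- The invariant disk of radius `1 / 4` about the pole `0` of `S^{2,1}_(u)`. -/
def poleDisk (p : ℕ) [NeZero p] (u : (ZMod p)ˣ) : FixedDisk (repSphere p u) u where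
  toFun w := ((((0 : ℝ) : ℂ) + ((1 / 4 : ℝ) : ℂ) * w : ℂ) : OnePoint ℂ)
  continuous_toFun := by
    refine OnePoint.continuous_coe.comp ?_
    fun_prop
  injective_toFun v w h := by
    have := OnePoint.coe_injective h
    refine Subtype.ext ?_
    simpa using this
  act_toFun w := by
    refine congrArg (fun z : ℂ => (z : OnePoint ℂ)) ?_
    simp only [UnitDisk.rot]
    push_cast
    ring
  isOpen_interior := by
    have := OnePoint.isOpenEmbedding_coe.isOpenMap _ (isOpen_round_disk 0 (1 / 4) (by norm_num))
    rwa [Set.image_image] at this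

theorem equatorDisk_ne_poleDisk [Fact p.Prime] (u : (ZMod p)ˣ) (k : ℕ) (v w : UnitDisk) :
    (repSphere p u).act^[k] ((equatorDisk p u).toFun v) ≠ (poleDisk p u).toFun w := by
  intro h
  have h' := (repSphere_iterate_act u k _).symm.trans h
  have h2 := congrArg norm (OnePoint.coe_injective h')
  rw [norm_mul, Circle.norm_coe, one_mul] at h2
  have h3 := (equatorDisk_norm_aux (p := p) v).1
  have hw : ‖(w : ℂ)‖ ≤ 1 := w.norm_le
  have h4 : ‖((0 : ℝ) : ℂ) + ((1 / 4 : ℝ) : ℂ) * w‖ ≤ 1 / 4 := by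
    rw [ofReal_zero, zero_add, norm_mul, norm_real, Real.norm_eq_abs,
      abs_of_nonneg (by norm_num)]
    linarith
  linarith

/-! ### The polygon -/

/-- The closed unit disk is regarded as a `2p`-gon, with vertices `e^{π i m / p}` and with the arcs
between consecutive vertices as edges. Opposite edges are identified in the same direction: the
point at parameter `s` of the edge from vertex `m` to vertex `m + 1` is identified with the point at
parameter `s` of the opposite edge, traversed from vertex `m + 1 + p` to vertex `m + p`. -/
def EdgeRel (p : ℕ) (z w : UnitDisk) : Prop :=
  ∃ (m : ℤ) (s : ℝ), 0 ≤ s ∧ s ≤ Real.pi / p ∧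
    (z : ℂ) = exp (((m * (Real.pi / p) + s : ℝ) : ℂ) * I) ∧
    (w : ℂ) = exp ((((m + 1) * (Real.pi / p) + Real.pi - s : ℝ) : ℂ) * I)

theorem EdgeRel.rot [NeZero p] (u : ZMod p) {z w : UnitDisk} (h : EdgeRel p z w) :
    EdgeRel p (UnitDisk.rot (ZMod.toCircle u) z) (UnitDisk.rot (ZMod.toCircle u) w) := by
  obtain ⟨m, s, h0, h1, hz, hw⟩ := h
  refine ⟨m + 2 * u.val, s, h0, h1, ?_, ?_⟩
  · simp only [UnitDisk.rot]
    rw [hz, ZMod.toCircle_apply, ← Complex.exp_add]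
    congr 1
    push_cast
    ring
  · simp only [UnitDisk.rot]
    rw [hw, ZMod.toCircle_apply, ← Complex.exp_add]
    congr 1
    push_cast
    ring

theorem EdgeRel.norm_eq {z w : UnitDisk} (h : EdgeRel p z w) : ‖(z : ℂ)‖ = 1 ∧ ‖(w : ℂ)‖ = 1 := by
  obtain ⟨m, s, h0, h1, hz, hw⟩ := h
  rw [hz, hw]
  exact ⟨norm_exp_ofReal_mul_I _, norm_exp_ofReal_mul_I _⟩

theorem iterate_rot [NeZero p] (u : ZMod p) (n : ℕ) (z : UnitDisk) :
    (((UnitDisk.rot (ZMod.toCircle u))^[n] z : UnitDisk) : ℂ)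
      = (ZMod.toCircle ((n : ZMod p) * u) : ℂ) * z := by
  rw [← iterate_mul_toCircle]
  induction n generalizing z with
  | zero => rfl
  | succ n ih => exact ih _

/-- `Poly_1` (more precisely `Poly_{1,(u)}`): the `2p`-gon with opposite edges identified, with
rotation by `e^{2 π i u / p}` about its centre. -/
def poly1 (p : ℕ) [NeZero p] (u : (ZMod p)ˣ) : CpSpace p where
  carrier := Quot (EdgeRel p)
  act := Quot.map (UnitDisk.rot (ZMod.toCircle (u : ZMod p))) (fun _ _ h => h.rot _)
  continuous_act := by
    refine continuous_quot_lift _ (continuous_quot_mk.comp ?_)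
    exact (continuous_const.mul continuous_subtype_val).subtype_mk _
  iterate_act := by
    have h : ∀ n : ℕ, ∀ z : UnitDisk,
        (Quot.map (UnitDisk.rot (ZMod.toCircle (u : ZMod p))) (fun _ _ h => h.rot _) :
          Quot (EdgeRel p) → Quot (EdgeRel p))^[n] (Quot.mk _ z)
        = Quot.mk _ ((UnitDisk.rot (ZMod.toCircle (u : ZMod p)))^[n] z) := by
      intro n
      induction n with
      | zero => intro z; rfl
      | succ n ih => intro z; exact ih _
    rintro ⟨z⟩
    refine (h p z).trans (congrArg _ (Subtype.ext ?_))
    rw [iterate_rot]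
    simp

theorem poly1_iterate_act [NeZero p] (u : (ZMod p)ˣ) (n : ℕ) (z : UnitDisk) :
    (poly1 p u).act^[n] (Quot.mk _ z)
      = (Quot.mk _ ((UnitDisk.rot (ZMod.toCircle (u : ZMod p)))^[n] z) : Quot (EdgeRel p)) := by
  induction n generalizing z with
  | zero => rfl
  | succ n ih => exact ih _

theorem edgeRel_mk_eq {z w : UnitDisk} (hw : ‖(w : ℂ)‖ < 1)
    (h : Quot.mk (EdgeRel p) z = Quot.mk (EdgeRel p) w) : z = w := by
  let P : Quot (EdgeRel p) → Prop := Quot.lift (fun t => t = w) (by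
    intro a b hab
    obtain ⟨h1, h2⟩ := hab.norm_eq
    simp only [eq_iff_iff]
    constructor
    · rintro rfl; exact absurd h1 hw.ne
    · rintro rfl; exact absurd h2 hw.ne)
  have h1 : P (Quot.mk _ w) := rfl
  rw [← h] at h1
  exact h1

theorem round_disk_norm (c r : ℝ) (hc : 0 ≤ c) (hr : 0 ≤ r) (h : c + r < 1) (w : UnitDisk) :
    ‖(c : ℂ) + r * w‖ < 1 := by
  have hw : ‖(w : ℂ)‖ ≤ 1 := w.norm_le
  have := norm_add_le (c : ℂ) (r * w)
  rw [norm_mul, norm_real, norm_real, Real.norm_eq_abs, Real.norm_eq_abs, abs_of_nonneg hc,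
    abs_of_nonneg hr] at this
  nlinarith

/-- The map from the unit disk onto the round disk with centre `c` and radius `r` in the interior of
the polygon. -/
def polyDiskMap (p : ℕ) (c r : ℝ) (hc : 0 ≤ c) (hr : 0 ≤ r) (h : c + r < 1) (w : UnitDisk) :
    Quot (EdgeRel p) :=
  Quot.mk _ ⟨(c : ℂ) + r * w, by simpa using (round_disk_norm c r hc hr h w).le⟩

theorem continuous_polyDiskMap (c r : ℝ) (hc : 0 ≤ c) (hr : 0 ≤ r) (h : c + r < 1) :
    Continuous (polyDiskMap p c r hc hr h) := by
  refine continuous_quot_mk.comp (Continuous.subtype_mk ?_ _)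
  fun_prop

theorem isOpen_polyDiskMap (c r : ℝ) (hc : 0 ≤ c) (hr : 0 < r) (h : c + r < 1) :
    IsOpen (polyDiskMap p c r hc hr.le h '' {w | ‖(w : ℂ)‖ < 1}) := by
  refine isOpen_coinduced.2 (isOpen_induced_iff.2 ⟨_, isOpen_round_disk c r hr, ?_⟩)
  ext z
  constructor
  · rintro ⟨w, hw, hz⟩
    exact ⟨w, hw, congrArg (Quot.mk _) (Subtype.ext hz)⟩
  · rintro ⟨w, hw, hz⟩
    have := edgeRel_mk_eq (p := p) (round_disk_norm c r hc hr.le h w) hz.symm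
    exact ⟨w, hw, (congrArg Subtype.val this).symm⟩

theorem polyDiskMap_inj_disjoint [Fact p.Prime] (u : (ZMod p)ˣ) (c r : ℝ) (hc : 0 ≤ c)
    (hr : 0 < r) (h : c + r < 1) (hcr : p * r < 2 * c) (k : ℕ) (hk : k < p) (v w : UnitDisk)
    (e : (poly1 p u).act^[k] (polyDiskMap p c r hc hr.le h v) = polyDiskMap p c r hc hr.le h w) :
    k = 0 ∧ v = w := by
  have e' := (poly1_iterate_act u k _).symm.trans e
  have e'' := edgeRel_mk_eq (round_disk_norm c r hc hr.le h w) e'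
  have e3 := congrArg Subtype.val e''
  rw [iterate_rot] at e3
  exact round_disk_aux u c r hr hcr k hk v w e3

/-- The disk of `Poly_{1,(u)}` with centre `1 / 2` and radius `1 / (2 p)`. -/
def polyConjDisk (p : ℕ) [Fact p.Prime] (u : (ZMod p)ˣ) : ConjDisk (poly1 p u) :=
  have hp : (2 : ℝ) ≤ p := by exact_mod_cast (Fact.out : p.Prime).two_le
  have hr : (0 : ℝ) < 1 / (2 * p) := by positivity
  have h : 1 / 2 + 1 / (2 * (p : ℝ)) < 1 := by
    have : 1 / (2 * (p : ℝ)) ≤ 1 / 4 := one_div_le_one_div_of_le (by norm_num) (by linarith)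
    linarith
  { toFun := polyDiskMap p (1 / 2) (1 / (2 * p)) (by norm_num) hr.le h
    continuous_toFun := continuous_polyDiskMap _ _ _ _ _
    inj_disjoint := polyDiskMap_inj_disjoint u _ _ _ hr h (by field_simp; norm_num)
    isOpen_interior := isOpen_polyDiskMap _ _ _ hr _ }

/-- The invariant disk of radius `1 / 2` about the centre of `Poly_{1,(u)}`. -/
def polyCenterDisk (p : ℕ) [NeZero p] (u : (ZMod p)ˣ) : FixedDisk (poly1 p u) u where
  toFun := polyDiskMap p 0 (1 / 2) le_rfl (by norm_num) (by norm_num)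
  continuous_toFun := continuous_polyDiskMap _ _ _ _ _
  injective_toFun v w h := by
    have h' := edgeRel_mk_eq (round_disk_norm 0 (1 / 2) le_rfl (by norm_num) (by norm_num) w) h
    have h'' := congrArg Subtype.val h'
    refine Subtype.ext ?_
    simpa using h''
  act_toFun w := by
    refine congrArg (Quot.mk _) (Subtype.ext ?_)
    simp only [UnitDisk.rot]
    push_cast
    ring
  isOpen_interior := isOpen_polyDiskMap 0 (1 / 2) le_rfl (by norm_num) (by norm_num)

/-! ### Ribbon surgery, twisted ribbon surgery and the two surfaces -/

/-- `C_p`-ribbon surgery `X + [R_{p,(i)}]` along the disk `D`. The ribbon `R_{p,(i)}` is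
`(equatorDisk p i).compl`, the sphere `S^{2,1}_(i)` with `p` conjugate open disks removed. -/
def ribbonSurgery [Fact p.Prime] {X : CpSpace p} (D : ConjDisk X) (i : (ZMod p)ˣ) : CpSpace p :=
  D.glue (equatorDisk p i)

/-- Twisted ribbon surgery `X +_x [TR_{p,(i)}]`, where `D` is an invariant disk about `x` on which
the generator rotates through the angle `2 π i / p`. The twisted ribbon `TR_{p,(i)}` is
`(polyCenterDisk p i).compl`, the `2p`-gon with opposite edges identified and with an open disk about
its centre removed. -/
def twistedRibbonSurgery [NeZero p] {X : CpSpace p} {i : (ZMod p)ˣ} (D : FixedDisk X i) :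
    CpSpace p :=
  D.glue (polyCenterDisk p i)

/-- `Sph_{2(p-1)}[6] = (S^{2,1}_(i) + [R_{p,(j)}]) + [R_{p,(k)}]`; the surgeries are performed along
the disks with centres `1` and `3` in `S^{2,1}_(i)`. -/
def sphSix (p : ℕ) [Fact p.Prime] (i j k : (ZMod p)ˣ) : CpSpace p :=
  ribbonSurgery
    (X := ribbonSurgery (equatorDisk p i) j)
    (ConjDisk.survive (equatorDisk p i) (equatorDisk p j) (outerDisk p i)
      (equatorDisk_ne_outerDisk i)) k

/-- `Poly_2`, constructed as `(Poly_{1,(u)} + [R_{p,(v)}]) +_b [TR_{p,(v)}]`, where `b` is the pole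
`0` of the ribbon `R_{p,(v)}`, and where `u + v ≠ 0` in `ZMod p`.

The ribbon surgery glues along `D w ∼ E w` for two disks `D`, `E` which both preserve the standard
orientations of `ℂ`. So the orientation of `Poly_{1,(u)} + [R_{p,(v)}]` that extends the standard one
of the polygon is opposite to the standard one of the ribbon: with respect to it the generator
rotates by `e^{2 π i u / p}` at the centre of the polygon and by `e^{- 2 π i v / p}` at `b`.
For `u = v` this gives the tower of two equally rotating copies of `Poly_{1,(u)}`; different `u` and
`v` account for the action of `Aut(C_p)` on the pieces. For `u + v = 0` (equivalently: for `u = v`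
with the other pole of the ribbon in place of `b`) the surgery does not produce `Poly_2`. -/
def poly2 (p : ℕ) [Fact p.Prime] (u v : (ZMod p)ˣ) : CpSpace p :=
  twistedRibbonSurgery
    (X := ribbonSurgery (polyConjDisk p u) v)
    (FixedDisk.survive (polyConjDisk p u) (equatorDisk p v) (poleDisk p v)
      (equatorDisk_ne_poleDisk v))

end

/-!
The proof distinguishes the two surfaces by the degrees that circle-valued functions have at their
fixed points.

Near each fixed point the surface has a chart in which the generator acts as a rotation
(`RotChart`), and a circle-valued function which is continuous away from the fixed points has a
degree at the centre of such a chart (`RotChart.HasDeg`). A homeomorphism `e` that intertwines the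
generator with its `a`-th power multiplies all degrees at a fixed point by a sign `ε = ± 1`, and if
the rotation angles at the point and at its image are `α` and `β`, then `ε α = a β`
(`RotChart.exists_sign`). No orientations, manifold structures or homology groups are needed: the
only topological input is that functions on star-convex sets have logarithms, and that the
variation of a logarithm around a circle does not depend on the circle.

On the tower of two polygons the rotation angles at the six fixed points are `u, -2u, -2u` for the
centre and the two vertices of the first polygon, `v` for the remaining pole of the ribbon, and
`-2v, -2v` for the two vertices of the second polygon, in charts for which the degrees of every
circle-valued function add up to zero (`poly2_degree_sum`). This is a residue theorem: for a polygon
with holes the variations along opposite edges cancel (`polygon_degree_sum`, `polygon_relation`),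
for the ribbon the relation is planar (`exists_log_outside_holes`), and the degrees along the glued
circles cancel (`degree_sum_of_pieces`).

On the sphere with two ribbons the fixed points come in pairs of poles. Both poles of a pair have
charts with the same angle, and some circle-valued function has degree `p` at both of them and is
continuous everywhere else (`exists_isPolePair_sphSix`). On a single sphere this function is the
`p`-th power of the direction, composed with a collapse of half of the circle which makes it
constant on the sectors containing the disks that are removed; so it extends over whatever is
glued in.

Carry such a function over by an isomorphism. Its degrees on the tower are `± p` at two points and
`0` at the others, so the two signs are opposite, and the angles at the two points are opposite as
well. Hence every angle of the tower is the negative of the angle at some other fixed point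
(`exists_weight_eq_neg`). As `p` is odd and `u + v ≠ 0`, the partner of the angle `u` can only be
`-2v`, and the partner of `v` can only be `-2u`. Adding `u = 2v` and `v = 2u` gives
`u + v = 2(u + v)`, a contradiction.
-/

section

open Complex Metric Set Filter Topology

variable {p : ℕ}

/-! ### Circle-valued functions: logarithms and degrees -/

/-- The direction `z / ‖z‖` of a nonzero complex number, as a point of the circle
(with `dir 0 = 1`). -/
noncomputable def dir (z : ℂ) : Circle := Circle.exp (arg z)

lemma coe_dir {z : ℂ} (hz : z ≠ 0) : (dir z : ℂ) = z / ‖z‖ := by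
  have h := Complex.norm_mul_exp_arg_mul_I z
  have hz' : (‖z‖ : ℂ) ≠ 0 := by exact_mod_cast norm_ne_zero_iff.2 hz
  rw [dir, Circle.coe_exp, eq_div_iff hz', mul_comm, h]

lemma dir_mul {z w : ℂ} (hz : z ≠ 0) (hw : w ≠ 0) : dir (z * w) = dir z * dir w := by
  ext
  rw [Circle.coe_mul, coe_dir hz, coe_dir hw, coe_dir (mul_ne_zero hz hw), norm_mul]
  push_cast
  rw [div_mul_div_comm]

lemma dir_ofReal {r : ℝ} (hr : 0 < r) : dir (r : ℂ) = 1 := by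
  rw [dir, arg_ofReal_of_nonneg hr.le, Circle.exp_zero]

lemma dir_circle (c : Circle) : dir (c : ℂ) = c := Circle.exp_arg c

lemma dir_exp (w : ℂ) : dir (exp w) = Circle.exp w.im := by
  ext
  rw [coe_dir (exp_ne_zero w), norm_exp, Circle.coe_exp, div_eq_iff (by
    exact_mod_cast (Real.exp_pos _).ne')]
  push_cast
  rw [← Complex.exp_add]
  congr 1
  conv_lhs => rw [← re_add_im w]
  ring

lemma continuousOn_dir : ContinuousOn dir {0}ᶜ := by
  have : ContinuousOn (fun z : ℂ => z / (‖z‖ : ℂ)) {0}ᶜ := by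
    refine continuousOn_id.div (by fun_prop) ?_
    intro z hz
    exact_mod_cast norm_ne_zero_iff.2 hz
  exact Topology.IsInducing.subtypeVal.continuousOn_iff.2 (this.congr fun z hz => coe_dir hz)

/-- A circle-valued function on a star-convex set has a continuous logarithm. -/
lemma exists_log_of_starConvex {S : Set ℂ} {z₀ : ℂ} (hS : StarConvex ℝ z₀ S)
    {f : ℂ → Circle} (hf : ContinuousOn f S) :
    ∃ φ : ℂ → ℝ, ContinuousOn φ S ∧ ∀ z ∈ S, f z = Circle.exp (φ z) := by
  have hmem : ∀ (t : unitInterval) (z : S), z₀ + (t : ℝ) • ((z : ℂ) - z₀) ∈ S := fun t z =>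
    hS.add_smul_sub_mem z.2 t.2.1 t.2.2
  let H : C(unitInterval × S, Circle) :=
    { toFun := fun q => f (z₀ + (q.1 : ℝ) • ((q.2 : ℂ) - z₀))
      continuous_toFun := by
        refine hf.comp_continuous ?_ fun q => hmem q.1 q.2
        fun_prop }
  let f₀ : C(S, ℝ) := ContinuousMap.const _ (arg (f z₀ : ℂ))
  have H₀ : ∀ a, H (0, a) = Circle.exp (f₀ a) := fun a => by
    simp [H, f₀, Circle.exp_arg]
  let G := Circle.isCoveringMap_exp.liftHomotopy H f₀ H₀
  have hG : ∀ q, Circle.exp (G q) = H q := fun q =>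
    congrFun (Circle.isCoveringMap_exp.liftHomotopy_lifts H f₀ H₀) q
  classical
  refine ⟨fun z => if h : z ∈ S then G (1, ⟨z, h⟩) else 0, ?_, ?_⟩
  · rw [continuousOn_iff_continuous_domRestrict]
    have : Continuous fun z : S => G (1, z) := by fun_prop
    refine this.congr fun z => ?_
    simp
  · intro z hz
    simp only [dif_pos hz, hG]
    simp [H]

/-- Two continuous logarithms of the same function on a preconnected set differ by a constant. -/
lemma sub_eq_sub_of_exp_eq {E : Type*} [TopologicalSpace E] {S : Set E} (hS : IsPreconnected S)
    {φ ψ : E → ℝ} (hφ : ContinuousOn φ S) (hψ : ContinuousOn ψ S)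
    (h : ∀ z ∈ S, Circle.exp (φ z) = Circle.exp (ψ z)) {x y : E} (hx : x ∈ S) (hy : y ∈ S) :
    φ x - ψ x = φ y - ψ y := by
  have hd : IsDiscrete (range ((↑) : ℤ → ℝ)) :=
    ⟨(Int.isClosedEmbedding_coe_real.isEmbedding.toHomeomorph).symm.isEmbedding.discreteTopology⟩
  have hc : ContinuousOn (fun z => (φ z - ψ z) / (2 * Real.pi)) S := (hφ.sub hψ).div_const _
  obtain ⟨c, -, hc'⟩ := hS.eqOn_const_of_mapsTo hd hc (by
    intro z hz
    obtain ⟨m, hm⟩ := Circle.exp_eq_exp.1 (h z hz)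
    refine ⟨m, ?_⟩
    have := Real.pi_pos
    simp only
    rw [hm]; field_simp; ring) (range_nonempty _)
  have h1 := (hc' hx).trans (hc' hy).symm
  simp only at h1
  have := Real.pi_pos
  field_simp at h1
  linarith

/-- A circle-valued function on an annulus (possibly degenerate, possibly a punctured disk)
centred at `0` is a power of `dir` up to a factor which has a logarithm. -/
lemma exists_deg_annulus {J : Set ℝ} (hJ : J.OrdConnected) (hJ₀ : J ⊆ Ioi 0) {f : ℂ → Circle}
    (hf : ContinuousOn f {z | ‖z‖ ∈ J}) :
    ∃ (n : ℤ) (φ : ℂ → ℝ), ContinuousOn φ {z | ‖z‖ ∈ J} ∧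
      ∀ z, ‖z‖ ∈ J → f z = dir z ^ n * Circle.exp (φ z) := by
  rcases J.eq_empty_or_nonempty with rfl | ⟨a, ha⟩
  · exact ⟨0, 0, by simp⟩
  -- the annulus lifts through the exponential function to a vertical strip, which is convex
  set P : Set ℂ := {w | ‖exp w‖ ∈ J} with hP
  have hPc : Convex ℝ P := by
    have h1 : (Real.exp ⁻¹' J).OrdConnected := hJ.preimage_mono Real.exp_monotone
    have h2 := (convex_iff_ordConnected.2 h1).linear_preimage Complex.reLm
    have h3 : P = Complex.reLm ⁻¹' (Real.exp ⁻¹' J) := by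
      ext w; simp [hP, norm_exp]
    rwa [h3]
  have ha' : ((Real.log a : ℝ) : ℂ) ∈ P := by
    simp only [hP, mem_ofPred_eq, norm_exp, ofReal_re, Real.exp_log (hJ₀ ha)]
    exact ha
  obtain ⟨ψ, hψ, hfψ⟩ := exists_log_of_starConvex (hPc.starConvex ha')
    (f := fun w => f (exp w)) (hf.comp continuous_exp.continuousOn fun w hw => hw)
  -- the degree is the monodromy of the logarithm `ψ` of the lifted function
  have hshift : ∀ w, w + 2 * Real.pi * I ∈ P ↔ w ∈ P := fun w => by
    simp only [hP, mem_ofPred_eq, Complex.exp_periodic w]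
  have hψ' : ContinuousOn (fun w => ψ (w + 2 * Real.pi * I)) P :=
    hψ.comp (by fun_prop) fun w hw => (hshift w).2 hw
  have hE : ∀ w ∈ P, Circle.exp (ψ (w + 2 * Real.pi * I)) = Circle.exp (ψ w) := fun w hw => by
    rw [← hfψ w hw, ← hfψ _ ((hshift w).2 hw), Complex.exp_periodic w]
  obtain ⟨n, hn⟩ := Circle.exp_eq_exp.1 (hE _ ha')
  have hconst : ∀ w ∈ P, ψ (w + 2 * Real.pi * I) = ψ w + n * (2 * Real.pi) := fun w hw => by
    have := sub_eq_sub_of_exp_eq hPc.isPreconnected hψ' hψ hE hw ha'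
    linarith
  classical
  -- without the linear part the logarithm is periodic and descends to the annulus
  set h : ℂ → ℝ := fun w => if w ∈ P then ψ w - n * w.im else 0 with hh
  have hper : Function.Periodic h (2 * Real.pi * I) := fun w => by
    by_cases hw : w ∈ P
    · simp only [hh, if_pos hw, if_pos ((hshift w).2 hw), hconst w hw]
      simp; ring
    · simp only [hh, if_neg hw, if_neg (fun h => hw ((hshift w).1 h))]
  have hexp : ∀ w, h (log (exp w)) = h w := fun w => by
    obtain ⟨k, hk⟩ := Complex.exp_eq_exp_iff_exists_int.1 (Complex.exp_log (exp_ne_zero w))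
    rw [hk]
    exact hper.int_mul k w
  have hne : ∀ z : ℂ, ‖z‖ ∈ J → z ≠ 0 := fun z hz => norm_pos_iff.1 (hJ₀ hz)
  have hhc : ContinuousOn h P := by
    have : ContinuousOn (fun w : ℂ => ψ w - n * w.im) P := hψ.sub (by fun_prop)
    exact this.congr fun w hw => if_pos hw
  refine ⟨n, fun z => h (log z), ?_, ?_⟩
  · intro z hz
    have hz0 := hne z hz
    -- a branch of the logarithm near `z`
    set L : ℂ → ℂ := fun z' => log z + log (z' / z) with hL
    have hLe : ∀ z' ≠ 0, exp (L z') = z' := fun z' hz' => by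
      rw [hL, Complex.exp_add, Complex.exp_log hz0, Complex.exp_log (div_ne_zero hz' hz0),
        mul_div_cancel₀ _ hz0]
    have hLc : ContinuousAt L z := by
      refine continuousAt_const.add (ContinuousAt.clog ?_ ?_)
      · fun_prop
      · rw [div_self hz0]; exact one_mem_slitPlane
    have hLm : MapsTo L {z | ‖z‖ ∈ J} P := fun z' hz' => by
      simp only [hP, mem_ofPred_eq, hLe z' (hne z' hz')]
      exact hz'
    have h1 : ContinuousWithinAt (fun z' => h (L z')) {z | ‖z‖ ∈ J} z :=
      (hhc _ (hLm hz)).comp hLc.continuousWithinAt hLm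
    refine h1.congr (fun z' hz' => ?_) ?_
    · conv_lhs => rw [← hLe z' (hne z' hz')]
      exact hexp _
    · conv_lhs => rw [← hLe z hz0]
      exact hexp _
  · intro z hz
    have hz0 := hne z hz
    have hlog : log z ∈ P := by
      simp only [hP, mem_ofPred_eq, Complex.exp_log hz0]
      exact hz
    have := hfψ _ hlog
    simp only [Complex.exp_log hz0] at this
    rw [this]
    simp only [hh, if_pos hlog]
    rw [dir, ← Circle.exp_zsmul, ← Circle.exp_add, log_im, zsmul_eq_mul]
    congr 1
    ring

/-- The restriction of `f` to the circle with centre `c` and radius `r` has degree `n`. -/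
def CircleDeg (f : ℂ → Circle) (c : ℂ) (r : ℝ) (n : ℤ) : Prop :=
  ∃ φ : ℂ → ℝ, ContinuousOn φ (sphere c r) ∧
    ∀ z ∈ sphere c r, f z = dir (z - c) ^ n * Circle.exp (φ z)

lemma exists_circleDeg {f : ℂ → Circle} {c : ℂ} {r : ℝ} (hr : 0 < r)
    (hf : ContinuousOn f (sphere c r)) : ∃ n, CircleDeg f c r n := by
  obtain ⟨n, φ, hφ, h⟩ := exists_deg_annulus (J := {r}) ordConnected_singleton
    (by simpa using hr) (f := fun z => f (c + z))
    (hf.comp (by fun_prop) fun z hz => by simpa using hz)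
  refine ⟨n, fun z => φ (z - c), hφ.comp (by fun_prop) fun z hz => ?_, fun z hz => ?_⟩
  · simpa [dist_eq_norm] using hz
  · have := h (z - c) (by simpa [dist_eq_norm] using hz)
    simpa using this

lemma CircleDeg.congr {f g : ℂ → Circle} {c : ℂ} {r : ℝ} {n : ℤ} (h : CircleDeg f c r n)
    (hfg : ∀ z ∈ sphere c r, g z = f z) : CircleDeg g c r n := by
  obtain ⟨φ, hφ, h⟩ := h
  exact ⟨φ, hφ, fun z hz => (hfg z hz).trans (h z hz)⟩

lemma CircleDeg.mul {f g : ℂ → Circle} {c : ℂ} {r : ℝ} {n m : ℤ} (hf : CircleDeg f c r n)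
    (hg : CircleDeg g c r m) : CircleDeg (fun z => f z * g z) c r (n + m) := by
  obtain ⟨φ, hφ, hf⟩ := hf
  obtain ⟨ψ, hψ, hg⟩ := hg
  refine ⟨fun z => φ z + ψ z, hφ.add hψ, fun z hz => ?_⟩
  simp only [hf z hz, hg z hz, zpow_add, Circle.exp_add]
  exact mul_mul_mul_comm _ _ _ _

lemma CircleDeg.unique {f : ℂ → Circle} {c : ℂ} {r : ℝ} (hr : 0 < r) {n m : ℤ}
    (hn : CircleDeg f c r n) (hm : CircleDeg f c r m) : n = m := by
  obtain ⟨φ, hφ, hn⟩ := hn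
  obtain ⟨ψ, hψ, hm⟩ := hm
  set γ : ℝ → ℂ := fun t => c + r * (Circle.exp t : ℂ) with hγ
  have hγc : Continuous γ := by
    have : Continuous fun t : ℝ => (Circle.exp t : ℂ) :=
      continuous_subtype_val.comp Circle.exp.continuous
    fun_prop
  have hγs : ∀ t, γ t ∈ sphere c r := fun t => by
    simp [hγ, abs_of_pos hr]
  have hr' : (r : ℂ) ≠ 0 := by exact_mod_cast hr.ne'
  have hdir : ∀ t, dir (γ t - c) = Circle.exp t := fun t => by
    rw [hγ]
    simp only [add_sub_cancel_left]
    rw [dir_mul hr' (Circle.coe_ne_zero _), dir_ofReal hr, one_mul, dir_circle]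
  have h1 : ∀ t ∈ (univ : Set ℝ), Circle.exp (n * t + φ (γ t)) = Circle.exp (m * t + ψ (γ t)) := by
    intro t _
    have h2 := (hn _ (hγs t)).symm.trans (hm _ (hγs t))
    rw [hdir, ← Circle.exp_zsmul, ← Circle.exp_zsmul, zsmul_eq_mul, zsmul_eq_mul] at h2
    rw [Circle.exp_add, Circle.exp_add, h2]
  have hcφ : Continuous fun t => φ (γ t) := hφ.comp_continuous hγc hγs
  have hcψ : Continuous fun t => ψ (γ t) := hψ.comp_continuous hγc hγs
  have h3 := sub_eq_sub_of_exp_eq isPreconnected_univ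
    (φ := fun t => n * t + φ (γ t)) (ψ := fun t => m * t + ψ (γ t))
    ((continuous_const.mul continuous_id).add hcφ).continuousOn
    ((continuous_const.mul continuous_id).add hcψ).continuousOn h1 (mem_univ 0)
    (mem_univ (2 * Real.pi))
  have h4 : γ (2 * Real.pi) = γ 0 := by simp [hγ]
  simp only [h4] at h3
  have h5 : ((n : ℝ) - m) * (2 * Real.pi) = 0 := by linarith
  have h6 : (n : ℝ) - m = 0 := by
    rcases mul_eq_zero.1 h5 with h | h
    · exact h
    · exact absurd h (by positivity)
  exact_mod_cast sub_eq_zero.1 h6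

/-! ### Planar domains with holes -/

/-- Around a hole a circle-valued function is a power of the direction from the centre of the hole,
up to a function which extends over the hole. -/
lemma fill_hole {K : Set ℂ} (hK : IsClosed K) {c : ℂ} {r : ℝ} (hr : 0 < r)
    (hd : ∀ z ∈ K, r ≤ ‖z - c‖) (hs : sphere c r ⊆ K) {f : ℂ → Circle} (hf : ContinuousOn f K) :
    ∃ (n : ℤ) (g : ℂ → Circle), ContinuousOn g (K ∪ closedBall c r) ∧
      ∀ z ∈ K, f z = dir (z - c) ^ n * g z := by
  obtain ⟨n, φ, hφ, h⟩ := exists_circleDeg hr (hf.mono hs)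
  obtain ⟨Φ, hΦ⟩ := ContinuousMap.exists_restrict_eq (isClosed_sphere (x := c) (ε := r))
    ⟨_, continuousOn_iff_continuous_domRestrict.1 hφ⟩
  have hΦ' : ∀ z ∈ sphere c r, Φ z = φ z := fun z hz => by
    have := congrArg (fun F => F ⟨z, hz⟩) hΦ
    exact this
  classical
  set g : ℂ → Circle :=
    fun z => if z ∈ K then (dir (z - c) ^ n)⁻¹ * f z else Circle.exp (Φ z) with hg
  refine ⟨n, g, ContinuousOn.union_of_isClosed ?_ ?_ hK isClosed_closedBall, ?_⟩
  · have h1 : ContinuousOn (fun z => (dir (z - c) ^ n)⁻¹ * f z) K := by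
      refine ContinuousOn.mul (ContinuousOn.inv (ContinuousOn.zpow ?_ n)) hf
      refine continuousOn_dir.comp (by fun_prop) fun z hz => ?_
      have h2 := hd z hz
      intro h3
      rw [mem_singleton_iff] at h3
      rw [h3, norm_zero] at h2
      linarith
    exact h1.congr fun z hz => if_pos hz
  · have h1 : ContinuousOn (fun z => Circle.exp (Φ z)) (closedBall c r) :=
      (Circle.exp.continuous.comp Φ.continuous).continuousOn
    refine h1.congr fun z hz => ?_
    by_cases hzK : z ∈ K
    · have hz' : z ∈ sphere c r := by
        have h2 := hd z hzK
        rw [mem_closedBall, dist_eq_norm] at hz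
        rw [mem_sphere, dist_eq_norm]
        linarith
      simp only [hg, if_pos hzK, h z hz', hΦ' z hz', inv_mul_cancel_left]
    · simp only [hg, if_neg hzK]
  · intro z hz
    simp only [hg, if_pos hz, mul_inv_cancel_left]

lemma dir_sub_eq {z c : ℂ} (h : ‖c‖ < ‖z‖) :
    dir (z - c) = dir z * Circle.exp (arg (1 - c / z)) := by
  have hz : z ≠ 0 := norm_pos_iff.1 ((norm_nonneg c).trans_lt h)
  have h1 : 1 - c / z ≠ 0 := by
    intro h1
    have h2 : c = z := by
      rw [sub_eq_zero, eq_div_iff hz, one_mul] at h1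
      exact h1.symm
    rw [h2] at h
    exact lt_irrefl _ h
  rw [← dir, ← dir_mul hz h1]
  congr 1
  field_simp

lemma one_sub_mem_slitPlane {w : ℂ} (h : ‖w‖ < 1) : 1 - w ∈ slitPlane := by
  refine mem_slitPlane_iff.2 (Or.inl ?_)
  have := (abs_re_le_norm w).trans_lt h
  simp only [sub_re, one_re]
  linarith [le_abs_self w.re]

/-- The direction from a point `c` has degree `0` around a circle that does not enclose `c`. -/
lemma circleDeg_dir_sub_zero {c c' : ℂ} {r : ℝ} (h : r < ‖c' - c‖) (n : ℤ) :
    CircleDeg (fun z => dir (z - c) ^ n) c' r 0 := by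
  have h0 : ∀ z ∈ sphere c' r, ‖c' - z‖ < ‖c' - c‖ := fun z hz => by
    rw [mem_sphere, dist_eq_norm, norm_sub_rev] at hz
    rwa [hz]
  refine ⟨fun z => n * (arg (c' - c) + arg (1 - (c' - z) / (c' - c))), ?_, fun z hz => ?_⟩
  · refine continuousOn_const.mul (continuousOn_const.add ?_)
    intro z hz
    refine (ContinuousAt.comp (f := fun z => 1 - (c' - z) / (c' - c)) (g := arg)
      (continuousAt_arg (one_sub_mem_slitPlane ?_)) (by fun_prop)).continuousWithinAt
    have h1 := h0 z hz
    rw [norm_div, div_lt_one ((norm_nonneg _).trans_lt h1)]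
    exact h1
  · have h1 := dir_sub_eq (h0 z hz)
    rw [sub_sub_sub_cancel_left] at h1
    simp only [h1, zpow_zero, one_mul]
    rw [dir, ← Circle.exp_add, ← Circle.exp_zsmul, zsmul_eq_mul]

lemma CircleDeg.prod {ι : Type*} (s : Finset ι) {f : ι → ℂ → Circle} {c : ℂ} {r : ℝ} {n : ι → ℤ}
    (h : ∀ i ∈ s, CircleDeg (f i) c r (n i)) :
    CircleDeg (fun z => ∏ i ∈ s, f i z) c r (∑ i ∈ s, n i) := by
  classical
  induction s using Finset.induction_on with
  | empty => exact ⟨fun _ => 0, continuousOn_const, fun z _ => by simp⟩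
  | insert a s ha ih =>
    have h1 := (h a (Finset.mem_insert_self a s)).mul
      (ih fun i hi => h i (Finset.mem_insert_of_mem hi))
    simpa only [Finset.prod_insert ha, Finset.sum_insert ha] using h1

/-- A circle-valued function on a star-convex domain with round holes is a product of powers of
the directions from the centres of the holes, up to a factor with a logarithm. -/
lemma exists_log_of_holes {S : Set ℂ} (hSc : IsClosed S) {z₀ : ℂ} (hS : StarConvex ℝ z₀ S)
    {ι : Type*} (s : Finset ι) (c : ι → ℂ) (r : ι → ℝ) (hr : ∀ i, 0 < r i)
    (hd : ∀ i j, i ≠ j → r i + r j < ‖c i - c j‖) (hcS : ∀ i, closedBall (c i) (r i) ⊆ S)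
    {f : ℂ → Circle} (hf : ContinuousOn f {z ∈ S | ∀ i ∈ s, r i ≤ ‖z - c i‖}) :
    ∃ (n : ι → ℤ) (φ : ℂ → ℝ), ContinuousOn φ S ∧
      ∀ z ∈ S, (∀ i ∈ s, r i ≤ ‖z - c i‖) →
        f z = (∏ i ∈ s, dir (z - c i) ^ n i) * Circle.exp (φ z) := by
  classical
  induction s using Finset.induction_on generalizing f with
  | empty =>
    obtain ⟨φ, hφ, h⟩ := exists_log_of_starConvex hS (hf.mono fun z hz => ⟨hz, by simp⟩)
    exact ⟨0, φ, hφ, fun z hz _ => by simpa using h z hz⟩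
  | insert a s ha ih =>
    have hK : IsClosed {z ∈ S | ∀ i ∈ insert a s, r i ≤ ‖z - c i‖} := by
      have : {z ∈ S | ∀ i ∈ insert a s, r i ≤ ‖z - c i‖}
          = S ∩ ⋂ i ∈ insert a s, {z | r i ≤ ‖z - c i‖} := by
        ext z; simp only [mem_ofPred_eq, mem_inter_iff, mem_iInter]
      rw [this]
      exact hSc.inter (isClosed_biInter fun i _ => isClosed_le (by fun_prop) (by fun_prop))
    obtain ⟨m, g, hg, hfg⟩ := fill_hole hK (hr a) (fun z hz => hz.2 a (Finset.mem_insert_self a s))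
      (fun z hz => by
        refine ⟨hcS a (sphere_subset_closedBall hz), fun i hi => ?_⟩
        rw [mem_sphere, dist_eq_norm] at hz
        by_cases hia : i = a
        · rw [hia, hz]
        · have h1 := hd i a hia
          have h2 := norm_sub_le_norm_sub_add_norm_sub (c i) z (c a)
          rw [norm_sub_rev (c i) z] at h2
          linarith) hf
    obtain ⟨n, φ, hφ, h⟩ := ih (f := g) (hg.mono (by
      rintro z ⟨hzS, hz⟩
      by_cases hza : r a ≤ ‖z - c a‖
      · left
        refine ⟨hzS, fun i hi => ?_⟩
        rcases Finset.mem_insert.1 hi with rfl | hi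
        · exact hza
        · exact hz i hi
      · right
        rw [mem_closedBall, dist_eq_norm]
        exact (not_le.1 hza).le))
    refine ⟨fun i => if i = a then m else n i, φ, hφ, fun z hzS hz => ?_⟩
    rw [hfg z ⟨hzS, hz⟩, h z hzS fun i hi => hz i (Finset.mem_insert_of_mem hi),
      Finset.prod_insert ha, mul_assoc]
    simp only [if_true]
    congr 2
    refine Finset.prod_congr rfl fun i hi => ?_
    rw [if_neg]
    rintro rfl
    exact ha hi

/-- On the outside of all the holes of a star-convex domain, a circle-valued function is a power
of `dir` up to a factor with a logarithm; the exponent is the sum of the degrees around the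
holes. -/
lemma exists_log_outside_holes {S : Set ℂ} (hSc : IsClosed S) {z₀ : ℂ} (hS : StarConvex ℝ z₀ S)
    {ι : Type*} [Fintype ι] (c : ι → ℂ) (r : ι → ℝ) (hr : ∀ i, 0 < r i)
    (hd : ∀ i j, i ≠ j → r i + r j < ‖c i - c j‖) (hcS : ∀ i, closedBall (c i) (r i) ⊆ S)
    {f : ℂ → Circle} (hf : ContinuousOn f {z ∈ S | ∀ i, r i ≤ ‖z - c i‖})
    {d : ι → ℤ} (hdeg : ∀ i, CircleDeg f (c i) (r i) (d i)) {R : ℝ} (hR : ∀ i, ‖c i‖ < R)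
    (hR₀ : 0 < R) :
    ∃ φ : ℂ → ℝ, ContinuousOn φ {z ∈ S | R ≤ ‖z‖} ∧
      ∀ z ∈ S, R ≤ ‖z‖ → (∀ i, r i ≤ ‖z - c i‖) →
        f z = dir z ^ (∑ i, d i) * Circle.exp (φ z) := by
  classical
  obtain ⟨n, φ, hφ, h⟩ := exists_log_of_holes hSc hS Finset.univ c r hr hd hcS
    (f := f) (by simpa using hf)
  have hn : n = d := by
    funext j
    have h1 : CircleDeg f (c j) (r j) ((∑ i, if i = j then n j else 0) + 0) := by
      refine CircleDeg.congr ((CircleDeg.prod Finset.univ (f := fun i z => dir (z - c i) ^ n i)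
        (n := fun i => if i = j then n j else 0) fun i _ => ?_).mul
        (g := fun z => Circle.exp (φ z)) ?_) fun z hz => ?_
      · by_cases hij : i = j
        · subst hij
          rw [if_pos rfl]
          exact ⟨fun _ => 0, continuousOn_const, fun z _ => by simp⟩
        · simp only [if_neg hij]
          refine circleDeg_dir_sub_zero ?_ _
          have := hd j i (Ne.symm hij)
          linarith [hr i]
      · exact ⟨φ, hφ.mono (sphere_subset_closedBall.trans (hcS j)), fun z _ => by simp⟩
      · refine h z (hcS j (sphere_subset_closedBall hz)) fun i _ => ?_
        rw [mem_sphere, dist_eq_norm] at hz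
        by_cases hij : i = j
        · rw [hij, hz]
        · have h1 := hd i j hij
          have h2 := norm_sub_le_norm_sub_add_norm_sub (c i) z (c j)
          rw [norm_sub_rev (c i) z] at h2
          linarith
    simpa using h1.unique (hr j) (hdeg j)
  subst hn
  refine ⟨fun z => φ z + ∑ i, n i * arg (1 - c i / z), ?_, fun z hz hRz hrz => ?_⟩
  · refine (hφ.mono fun z hz => hz.1).add (continuousOn_finsetSum _ fun i _ => ?_)
    refine continuousOn_const.mul fun z hz => ?_
    have hz0 : z ≠ 0 := norm_pos_iff.1 (hR₀.trans_le hz.2)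
    refine (ContinuousAt.comp (f := fun z => 1 - c i / z) (g := arg)
      (continuousAt_arg (one_sub_mem_slitPlane ?_))
        (by fun_prop (disch := exact hz0))).continuousWithinAt
    rw [norm_div, div_lt_one (hR₀.trans_le hz.2)]
    exact (hR i).trans_le hz.2
  · simp only [h z hz fun i _ => hrz i]
    rw [add_comm, Circle.exp_add, ← mul_assoc]
    congr 1
    have hexp : ∀ t : Finset ι, Circle.exp (∑ i ∈ t, n i * arg (1 - c i / z))
        = ∏ i ∈ t, Circle.exp (n i * arg (1 - c i / z)) := fun t => by
      induction t using Finset.induction_on with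
      | empty => simp
      | insert a s ha ih => rw [Finset.sum_insert ha, Finset.prod_insert ha, Circle.exp_add, ih]
    have hpow : ∀ t : Finset ι, dir z ^ (∑ i ∈ t, n i) = ∏ i ∈ t, dir z ^ n i := fun t => by
      induction t using Finset.induction_on with
      | empty => simp
      | insert a s ha ih => rw [Finset.sum_insert ha, Finset.prod_insert ha, zpow_add, ih]
    rw [hexp, hpow, ← Finset.prod_mul_distrib]
    refine Finset.prod_congr rfl fun i _ => ?_
    rw [dir_sub_eq ((hR i).trans_le hRz), mul_zpow, ← Circle.exp_zsmul,
      zsmul_eq_mul]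

/-! ### The corners of the polygon -/

/-- The point with coordinate `ξ` near the `m`-th vertex `e^{π i m / p}` of the polygon: the closed
unit disk corresponds to `0 ≤ ξ.im`, and the boundary circle to the real line. -/
noncomputable def cornerPt (p : ℕ) (m : ℤ) (ξ : ℂ) : ℂ :=
  exp (((m * (Real.pi / p) : ℝ) + ξ) * I)

/-- The angular coordinate at a vertex of the quotient of the polygon: the half disks at the `p`
corners which meet there are mapped to the sectors of angle `2 π / p` of a disk. -/
noncomputable def cornerCoord (p : ℕ) [NeZero p] (m : ℤ) (ξ : ℂ) : ℂ :=
  (ZMod.toCircle (-(m : ZMod p)) : ℂ) * (-I * ξ) ^ ((2 / p : ℝ) : ℂ)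

/-- The closed unit disk with half disks of size `r` about the vertices of the polygon removed. -/
def truncDisk (p : ℕ) (r : ℝ) : Set ℂ :=
  {z | ‖z‖ ≤ 1 ∧ ∀ (m : ℤ) (ξ : ℂ), z = cornerPt p m ξ → r ≤ ‖ξ‖}

lemma norm_cornerPt (m : ℤ) (ξ : ℂ) : ‖cornerPt p m ξ‖ = Real.exp (-ξ.im) := by
  rw [cornerPt, norm_exp]
  congr 1
  simp

lemma continuous_cornerPt (m : ℤ) : Continuous (cornerPt p m) := by
  unfold cornerPt
  fun_prop

lemma cornerPt_eq_iff {m m' : ℤ} {ξ ξ' : ℂ} [NeZero p] :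
    cornerPt p m ξ = cornerPt p m' ξ' ↔
      ∃ l : ℤ, ξ' = ξ + ((((m - m' + 2 * p * l : ℤ) : ℝ) * (Real.pi / p) : ℝ) : ℂ) := by
  have hp : (p : ℂ) ≠ 0 := by exact_mod_cast NeZero.ne p
  unfold cornerPt
  rw [exp_eq_exp_iff_exists_int]
  constructor
  · rintro ⟨l, hl⟩
    refine ⟨-l, ?_⟩
    have h1 : (((m * (Real.pi / p) : ℝ) + ξ) : ℂ)
        = ((m' * (Real.pi / p) : ℝ) + ξ') + l * (2 * Real.pi) :=
      mul_right_cancel₀ I_ne_zero (by linear_combination hl)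
    push_cast at h1 ⊢
    field_simp at h1 ⊢
    linear_combination -h1
  · rintro ⟨l, rfl⟩
    refine ⟨-l, ?_⟩
    push_cast
    field_simp
    ring

lemma cornerPt_ofReal (m : ℤ) (s : ℝ) :
    cornerPt p m s = exp (((m * (Real.pi / p) + s : ℝ) : ℂ) * I) := by
  unfold cornerPt
  push_cast
  rfl

lemma starConvex_truncDisk (r : ℝ) : StarConvex ℝ 0 (truncDisk p r) := by
  rw [starConvex_zero_iff]
  rintro z ⟨hz, hzr⟩ a ha ha1
  refine ⟨?_, fun m ξ h => ?_⟩
  · rw [norm_smul, Real.norm_eq_abs, abs_of_nonneg ha]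
    nlinarith [norm_nonneg z]
  · have ha0 : 0 < a := by
      rcases ha.eq_or_lt with rfl | h0
      · rw [zero_smul] at h
        exact absurd h.symm (exp_ne_zero _)
      · exact h0
    -- radial motion is vertical motion in the coordinate `ξ`
    have h1 : z = cornerPt p m (ξ + Real.log a * I) := by
      have h2 : cornerPt p m (ξ + Real.log a * I) * a = cornerPt p m ξ := by
        have h3 : (a : ℂ) = exp (Real.log a : ℝ) := by
          rw [← ofReal_exp, Real.exp_log ha0]
        conv_lhs => rw [h3]
        unfold cornerPt
        rw [← Complex.exp_add]
        congr 1
        linear_combination ((Real.log a : ℝ) : ℂ) * I_mul_I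
      have ha' : (a : ℂ) ≠ 0 := by exact_mod_cast ha0.ne'
      refine mul_right_cancel₀ ha' ?_
      rw [h2, ← h, real_smul, mul_comm]
    have h2 := hzr _ _ h1
    have h3 : 0 ≤ ξ.im + Real.log a := by
      rw [h1, norm_cornerPt, Real.exp_le_one_iff] at hz
      simp only [add_im, mul_im, ofReal_re, I_im, ofReal_im, I_re] at hz
      linarith
    have h4 : Real.log a ≤ 0 := Real.log_nonpos ha ha1
    refine h2.trans ?_
    rw [norm_def, norm_def]
    refine Real.sqrt_le_sqrt ?_
    rw [normSq_apply, normSq_apply]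
    simp only [add_re, add_im, mul_re, mul_im, ofReal_re, ofReal_im, I_re, I_im]
    nlinarith

lemma isClosed_truncDisk (r : ℝ) : IsClosed (truncDisk p r) := by
  have h : truncDisk p r = {z | ‖z‖ ≤ 1} ∩ ⋂ m : ℤ, (cornerPt p m '' ball 0 r)ᶜ := by
    ext z
    simp only [truncDisk, mem_ofPred_eq, mem_inter_iff, mem_iInter, mem_compl_iff, mem_image,
      mem_ball_zero_iff, not_exists, not_and]
    refine and_congr_right fun _ => forall_congr' fun m => forall_congr' fun ξ => ?_
    constructor
    · intro h h1 h2
      exact absurd (h h2.symm) (not_le.2 h1)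
    · intro h h1
      exact not_lt.1 fun h2 => h h2 h1.symm
  rw [h]
  refine (isClosed_le continuous_norm continuous_const).inter
    (isClosed_iInter fun m => IsOpen.isClosed_compl ?_)
  have h1 : IsOpenMap (cornerPt p m) := by
    refine Complex.isOpenMap_exp.comp ?_
    exact ((Homeomorph.addLeft (((m * (Real.pi / p) : ℝ) : ℂ))).trans
      (Homeomorph.mulRight₀ I I_ne_zero)).isOpenMap
  exact h1 _ isOpen_ball

lemma cornerPt_mem_truncDisk [NeZero p] {r : ℝ} {m : ℤ} {ξ : ℂ}
    (h0 : 0 ≤ ξ.im) (h1 : r ≤ ‖ξ‖) (h2 : |ξ.re| ≤ Real.pi / p - r) :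
    cornerPt p m ξ ∈ truncDisk p r := by
  have hp : (0 : ℝ) < p := by exact_mod_cast NeZero.pos p
  refine ⟨by rw [norm_cornerPt, Real.exp_le_one_iff]; linarith, fun m' ξ' h => ?_⟩
  obtain ⟨l, rfl⟩ := cornerPt_eq_iff.1 h
  generalize m - m' + 2 * p * l = k
  by_cases hk : k = 0
  · simpa [hk] using h1
  · refine le_trans ?_ (abs_re_le_norm _)
    rw [add_re, ofReal_re]
    have h3 : (1 : ℝ) ≤ |(k : ℝ)| := by exact_mod_cast Int.one_le_abs hk
    have h4 : Real.pi / p ≤ |(k : ℝ) * (Real.pi / p)| := by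
      rw [abs_mul, abs_of_pos (by positivity : 0 < Real.pi / p)]
      nlinarith [(by positivity : 0 < Real.pi / p)]
    have h5 := abs_sub_abs_le_abs_sub ((k : ℝ) * (Real.pi / p)) (-ξ.re)
    rw [abs_neg, sub_neg_eq_add, add_comm _ ξ.re] at h5
    linarith

lemma neg_I_mul_cpow {r β : ℝ} (hr : 0 < r) (h0 : 0 ≤ β) (h1 : β ≤ Real.pi) (a : ℝ) :
    (-I * (r * (Circle.exp β : ℂ))) ^ (a : ℂ)
      = (r ^ a : ℝ) * (Circle.exp (a * (β - Real.pi / 2)) : ℂ) := by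
  have hpi := Real.pi_pos
  have h2 : -I * (r * (Circle.exp β : ℂ)) = exp (Real.log r + (β - Real.pi / 2 : ℝ) * I) := by
    rw [Complex.exp_add, ← ofReal_exp, Real.exp_log hr, Circle.coe_exp, ofReal_sub, sub_mul,
      Complex.exp_sub]
    have : exp (((Real.pi / 2 : ℝ) : ℂ) * I) = I := by
      push_cast
      exact exp_pi_div_two_mul_I
    rw [this, div_I]
    ring
  rw [h2, cpow_def_of_ne_zero (exp_ne_zero _), log_exp, Real.rpow_def_of_pos hr, Circle.coe_exp,
    ofReal_exp, ← Complex.exp_add]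
  · congr 1
    push_cast
    ring
  · simp; linarith
  · simp; linarith

lemma cornerCoord_exp [NeZero p] (m : ℤ) {r β : ℝ} (hr : 0 < r) (h0 : 0 ≤ β)
    (h1 : β ≤ Real.pi) :
    cornerCoord p m (r * (Circle.exp β : ℂ))
      = (r ^ (2 / p : ℝ) : ℝ) * (Circle.exp ((2 * β - Real.pi - 2 * Real.pi * m) / p) : ℂ) := by
  rw [cornerCoord, neg_I_mul_cpow hr h0 h1, ← mul_assoc, mul_comm _ ((_ : ℝ) : ℂ), mul_assoc,
    ← Circle.coe_mul]
  congr 2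
  have h2 : ZMod.toCircle (-(m : ZMod p)) = Circle.exp (-(2 * Real.pi * m / p)) := by
    ext
    rw [← Int.cast_neg, ZMod.toCircle_intCast, Circle.coe_exp]
    congr 1
    push_cast
    ring
  rw [h2, ← Circle.exp_add]
  congr 1
  ring

lemma sum_range_natCast [NeZero p] {M : Type*} [AddCommMonoid M] (g : ZMod p → M) :
    ∑ j ∈ Finset.range p, g (j : ZMod p) = ∑ k, g k := by
  refine Finset.sum_bij' (fun j _ => (j : ZMod p)) (fun k _ => k.val) ?_ ?_ ?_ ?_ ?_
  · simp
  · intro k _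
    simpa using ZMod.val_lt k
  · intro j hj
    exact ZMod.val_cast_of_lt (Finset.mem_range.1 hj)
  · intro k _
    simp
  · simp

/-- The variations of a logarithm along the arcs about the vertices of one parity add up to the
degree in the angular coordinate at the common image of these vertices. -/
lemma sum_arc_variation [NeZero p] (hp : Odd p) {r : ℝ} (hr : 0 < r) (ε : ℤ) {Ω : ℂ → ℝ}
    {G : ℂ → Circle} {d : ℤ} (hG : CircleDeg G 0 (r ^ (2 / p : ℝ)) d)
    (hΩ : ∀ j : ℕ, ContinuousOn Ω
      ((fun ξ : ℂ => (((2 * j + ε : ℤ) * (Real.pi / p) : ℝ) : ℂ) + ξ) ''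
        {ξ | ‖ξ‖ = r ∧ 0 ≤ ξ.im}))
    (hΩG : ∀ (j : ℕ) (ξ : ℂ), ‖ξ‖ = r → 0 ≤ ξ.im →
      Circle.exp (Ω ((((2 * j + ε : ℤ) * (Real.pi / p) : ℝ) : ℂ) + ξ))
        = G (cornerCoord p (2 * j + ε) ξ)) :
    ∑ j ∈ Finset.range p, (Ω ((((2 * j + ε : ℤ) * (Real.pi / p) - r : ℝ) : ℂ))
      - Ω ((((2 * j + ε : ℤ) * (Real.pi / p) + r : ℝ) : ℂ))) = 2 * Real.pi * d := by
  have hpi := Real.pi_pos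
  have hp0 : (0 : ℝ) < p := by exact_mod_cast NeZero.pos p
  obtain ⟨φ, hφ, hGφ⟩ := hG
  set ρ : ℝ := r ^ (2 / p : ℝ) with hρ
  have hρ0 : 0 < ρ := Real.rpow_pos_of_pos hr _
  have hcexp : Continuous fun t : ℝ => (Circle.exp t : ℂ) :=
    continuous_subtype_val.comp Circle.exp.continuous
  have hsph : ∀ t : ℝ, (ρ : ℂ) * (Circle.exp t : ℂ) ∈ sphere (0 : ℂ) ρ := fun t => by
    simp [abs_of_pos hρ0]
  -- a logarithm of `G` as a function of the angle, on the circle of radius `ρ`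
  set lam : ℝ → ℝ := fun α => d * α + φ (ρ * (Circle.exp α : ℂ)) with hlam
  have hlamc : Continuous lam := by
    refine (continuous_const.mul continuous_id).add (hφ.comp_continuous ?_ hsph)
    fun_prop
  have hGlam : ∀ α : ℝ, G (ρ * (Circle.exp α : ℂ)) = Circle.exp (lam α) := fun α => by
    have hρ' : (ρ : ℂ) ≠ 0 := by exact_mod_cast hρ0.ne'
    rw [hGφ _ (hsph α), sub_zero, dir_mul hρ' (Circle.coe_ne_zero _), dir_ofReal hρ0, one_mul,
      dir_circle, hlam, ← Circle.exp_zsmul, zsmul_eq_mul, Circle.exp_add]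
  -- an arc about the `m`-th vertex is an arc of angle `2 π / p` in the angular coordinate
  have key : ∀ m : ℤ, (∃ j : ℕ, m = 2 * j + ε) →
      Ω (((m * (Real.pi / p) - r : ℝ) : ℂ)) - Ω (((m * (Real.pi / p) + r : ℝ) : ℂ))
      = lam ((Real.pi - 2 * Real.pi * m) / p) - lam ((-Real.pi - 2 * Real.pi * m) / p) := by
    rintro m ⟨j, rfl⟩
    set m : ℤ := 2 * j + ε with hm
    set γ : ℝ → ℂ := fun β => ((m * (Real.pi / p) : ℝ) : ℂ) + r * (Circle.exp β : ℂ) with hγ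
    have hn : ∀ β, ‖(r : ℂ) * (Circle.exp β : ℂ)‖ = r := fun β => by simp [abs_of_pos hr]
    have him : ∀ β ∈ Icc 0 Real.pi, 0 ≤ ((r : ℂ) * (Circle.exp β : ℂ)).im := fun β hβ => by
      rw [im_ofReal_mul, Circle.coe_exp, exp_ofReal_mul_I_im]
      exact mul_nonneg hr.le (Real.sin_nonneg_of_mem_Icc hβ)
    have h1 : ContinuousOn (fun β => Ω (γ β)) (Icc 0 Real.pi) := by
      refine (hΩ j).comp (Continuous.continuousOn (by fun_prop)) fun β hβ => ?_
      exact ⟨_, ⟨hn β, him β hβ⟩, rfl⟩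
    have h2 : ContinuousOn (fun β : ℝ => lam ((2 * β - Real.pi - 2 * Real.pi * m) / p))
        (Icc 0 Real.pi) := by
      refine (hlamc.comp ?_).continuousOn
      fun_prop
    have h3 := sub_eq_sub_of_exp_eq isPreconnected_Icc h1 h2 (fun β hβ => by
      rw [← hGlam, hΩG j _ (hn β) (him β hβ), cornerCoord_exp _ hr hβ.1 hβ.2])
      (left_mem_Icc.2 hpi.le) (right_mem_Icc.2 hpi.le)
    have e0 : γ 0 = ((m * (Real.pi / p) + r : ℝ) : ℂ) := by simp [hγ]
    have e1 : γ Real.pi = ((m * (Real.pi / p) - r : ℝ) : ℂ) := by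
      simp only [hγ, Circle.coe_exp, exp_pi_mul_I]
      push_cast; ring
    simp only [e0, e1] at h3
    rw [show 2 * 0 - Real.pi - 2 * Real.pi * (m : ℝ) = -Real.pi - 2 * Real.pi * m by ring,
      show 2 * Real.pi - Real.pi - 2 * Real.pi * (m : ℝ) = Real.pi - 2 * Real.pi * m by ring] at h3
    linarith
  -- the values of the periodic part of `lam` at the ends of these arcs
  set g : ZMod p → ℝ := fun k =>
    φ (ρ * ((Circle.exp (Real.pi / p) : ℂ) * (ZMod.toCircle k : ℂ))) with hg
  have hto : ∀ m : ℤ, ZMod.toCircle (m : ZMod p) = Circle.exp (2 * Real.pi * m / p) := fun m => by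
    ext
    rw [ZMod.toCircle_intCast, Circle.coe_exp]
    congr 1
    push_cast
    ring
  have key2 : ∀ j : ℕ, Ω ((((2 * j + ε : ℤ) * (Real.pi / p) - r : ℝ) : ℂ))
      - Ω ((((2 * j + ε : ℤ) * (Real.pi / p) + r : ℝ) : ℂ))
      = 2 * Real.pi * d / p + (g (-(2 * (j : ZMod p) + ε)) - g (-(2 * (j : ZMod p) + ε) - 1)) := by
    intro j
    rw [key _ ⟨j, rfl⟩]
    set m : ℤ := 2 * j + ε with hm
    have e1 : -(2 * (j : ZMod p) + ε) = ((-m : ℤ) : ZMod p) := by rw [hm]; push_cast; ring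
    have e2 : -(2 * (j : ZMod p) + ε) - 1 = ((-m - 1 : ℤ) : ZMod p) := by rw [hm]; push_cast; ring
    rw [e2, e1]
    simp only [hg, hto, ← Circle.coe_mul, ← Circle.exp_add, hlam]
    rw [show Real.pi / p + 2 * Real.pi * ((-m : ℤ) : ℝ) / p = (Real.pi - 2 * Real.pi * m) / p by
      push_cast; ring, show Real.pi / p + 2 * Real.pi * ((-m - 1 : ℤ) : ℝ) / p
        = (-Real.pi - 2 * Real.pi * m) / p by push_cast; ring]
    field_simp
    ring
  have h2u : IsUnit (2 : ZMod p) := by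
    have : Nat.Coprime 2 p := (Nat.coprime_two_left).2 hp
    exact_mod_cast (ZMod.unitOfCoprime 2 this).isUnit
  -- `2` is invertible modulo `p`, so the periodic parts add up to the same sum at both ends
  have hbij : ∀ c : ZMod p, ∑ k : ZMod p, g (-(2 * k + ε) - c) = ∑ k, g k := fun c => by
    refine Function.Bijective.sum_comp (e := fun k : ZMod p => -(2 * k + ε) - c) ?_ g
    refine Finite.injective_iff_bijective.1 fun a b hab => ?_
    exact h2u.mul_left_cancel (by linear_combination -hab)
  have h4 := hbij 0
  simp only [sub_zero] at h4
  simp only [key2, Finset.sum_add_distrib, Finset.sum_sub_distrib]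
  rw [sum_range_natCast (fun k : ZMod p => g (-(2 * k + ε))),
    sum_range_natCast (fun k : ZMod p => g (-(2 * k + ε) - 1)), h4, hbij]
  simp
  field_simp

lemma sum_range_two_mul {M : Type*} [AddCommMonoid M] (A : ℕ → M) (n : ℕ) :
    ∑ m ∈ Finset.range (2 * n), A m = ∑ j ∈ Finset.range n, (A (2 * j) + A (2 * j + 1)) := by
  induction n with
  | zero => simp
  | succ n ih =>
    rw [show 2 * (n + 1) = 2 * n + 1 + 1 by ring, Finset.sum_range_succ, Finset.sum_range_succ,
      Finset.sum_range_succ, ih, add_assoc]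

/-- The total degree of a circle-valued function on the closed surface obtained from the polygon
vanishes: the variation along the boundary of the truncated polygon consists of the variations along
the edges, which cancel in pairs, and of the variations along the arcs about the vertices. -/
lemma polygon_degree_sum [NeZero p] (hp : Odd p) {r : ℝ} (hr : 0 < r)
    (hrp : 2 * r ≤ Real.pi / p) {F : ℂ → Circle} {N : ℤ} {Φ : ℂ → ℝ} {R : ℝ}
    (hR : R ≤ Real.exp (-r)) (hΦ : ContinuousOn Φ {z ∈ truncDisk p r | R ≤ ‖z‖})
    (hF : ∀ z ∈ truncDisk p r, R ≤ ‖z‖ → F z = dir z ^ N * Circle.exp (Φ z))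
    (hedge : ∀ (m : ℤ) (s : ℝ), r ≤ s → s ≤ Real.pi / p - r →
      F (cornerPt p m s) = F (cornerPt p (m + 1 + p) (-s)))
    {G₀ G₁ : ℂ → Circle} {d₀ d₁ : ℤ} (hG₀ : CircleDeg G₀ 0 (r ^ (2 / p : ℝ)) d₀)
    (hG₁ : CircleDeg G₁ 0 (r ^ (2 / p : ℝ)) d₁)
    (hFG₀ : ∀ (m : ℤ) (ξ : ℂ), Even m → ‖ξ‖ = r → 0 ≤ ξ.im →
      F (cornerPt p m ξ) = G₀ (cornerCoord p m ξ))
    (hFG₁ : ∀ (m : ℤ) (ξ : ℂ), Odd m → ‖ξ‖ = r → 0 ≤ ξ.im →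
      F (cornerPt p m ξ) = G₁ (cornerCoord p m ξ)) :
    N + d₀ + d₁ = 0 := by
  have hpi := Real.pi_pos
  have hp0 : (0 : ℝ) < p := by exact_mod_cast NeZero.pos p
  set Ω : ℂ → ℝ := fun ζ => N * ζ.re + Φ (exp (ζ * I)) with hΩdef
  -- `Ω` is a logarithm of `F` in the coordinate `ζ ↦ exp (ζ I)`
  set W : Set ℂ := {ζ | exp (ζ * I) ∈ truncDisk p r ∧ R ≤ ‖exp (ζ * I)‖} with hW
  have hΩc : ContinuousOn Ω W := by
    refine (continuousOn_const.mul continuous_re.continuousOn).add ?_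
    exact hΦ.comp (Continuous.continuousOn (by fun_prop)) fun ζ hζ => hζ
  have hΩF : ∀ ζ ∈ W, Circle.exp (Ω ζ) = F (exp (ζ * I)) := fun ζ hζ => by
    rw [hF _ hζ.1 hζ.2, dir_exp, hΩdef, Circle.exp_add, ← Circle.exp_zsmul, zsmul_eq_mul]
    simp
  have hWmem : ∀ (m : ℤ) (ξ : ℂ), 0 ≤ ξ.im → ξ.im ≤ r → r ≤ ‖ξ‖ → |ξ.re| ≤ Real.pi / p - r →
      ((m * (Real.pi / p) : ℝ) : ℂ) + ξ ∈ W := fun m ξ h0 h1 h2 h3 => by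
    refine ⟨cornerPt_mem_truncDisk h0 h2 h3, hR.trans ?_⟩
    have := norm_cornerPt (p := p) m ξ
    rw [cornerPt] at this
    rw [this]
    exact Real.exp_le_exp.2 (by linarith)
  have hWarc : ∀ (m : ℤ) (ξ : ℂ), ‖ξ‖ = r → 0 ≤ ξ.im →
      ((m * (Real.pi / p) : ℝ) : ℂ) + ξ ∈ W := fun m ξ h0 h1 => by
    refine hWmem m ξ h1 ?_ h0.ge ?_
    · exact (le_abs_self _).trans ((abs_im_le_norm ξ).trans h0.le)
    · have := (abs_re_le_norm ξ).trans h0.le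
      linarith
  have hWedge : ∀ (m : ℤ) (s : ℝ), r ≤ |s| → |s| ≤ Real.pi / p - r →
      ((m * (Real.pi / p) : ℝ) : ℂ) + s ∈ W := fun m s h0 h1 => by
    refine hWmem m s (by simp) (by simpa using hr.le) ?_ (by simpa using h1)
    rwa [norm_real, Real.norm_eq_abs]
  have hper : ∀ (m : ℤ) (x : ℝ), Ω (((m + 2 * p : ℤ) * (Real.pi / p) + x : ℝ) : ℂ)
      = Ω ((m * (Real.pi / p) + x : ℝ) : ℂ) + 2 * Real.pi * N := fun m x => by
    have h1 : exp ((((m + 2 * p : ℤ) * (Real.pi / p) + x : ℝ) : ℂ) * I)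
        = exp (((m * (Real.pi / p) + x : ℝ) : ℂ) * I) := by
      rw [exp_eq_exp_iff_exists_int]
      have hp' : (p : ℂ) ≠ 0 := by exact_mod_cast NeZero.ne p
      refine ⟨1, ?_⟩
      push_cast
      field_simp
      ring
    simp only [hΩdef, h1, ofReal_re]
    push_cast
    field_simp
    ring
  -- `B m` is the variation along the `m`-th edge; opposite edges are run through in opposite
  -- directions
  set B : ℤ → ℝ := fun m => Ω ((((m + 1 : ℤ) * (Real.pi / p) - r : ℝ) : ℂ))
    - Ω (((m * (Real.pi / p) + r : ℝ) : ℂ)) with hB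
  have hBp : ∀ m : ℤ, B (m + p) = -B m := fun m => by
    have h1 : ContinuousOn (fun s : ℝ => Ω (((m * (Real.pi / p) : ℝ) : ℂ) + s))
        (Icc r (Real.pi / p - r)) := by
      refine hΩc.comp (Continuous.continuousOn (by fun_prop)) fun s hs => ?_
      have hs0 : |s| = s := abs_of_nonneg (hr.le.trans hs.1)
      exact hWedge m s (by rw [hs0]; exact hs.1) (by rw [hs0]; exact hs.2)
    have h2' : ∀ s ∈ Icc r (Real.pi / p - r),
        (((m + 1 + p : ℤ) * (Real.pi / p) : ℝ) : ℂ) + ((-s : ℝ) : ℂ) ∈ W := fun s hs => by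
      have hs0 : |-s| = s := by rw [abs_neg, abs_of_nonneg (hr.le.trans hs.1)]
      exact hWedge _ _ (by rw [hs0]; exact hs.1) (by rw [hs0]; exact hs.2)
    have h2 : ContinuousOn
        (fun s : ℝ => Ω ((((m + 1 + p : ℤ) * (Real.pi / p) : ℝ) : ℂ) + ((-s : ℝ) : ℂ)))
        (Icc r (Real.pi / p - r)) :=
      hΩc.comp (Continuous.continuousOn (by fun_prop)) h2'
    have h3 := sub_eq_sub_of_exp_eq isPreconnected_Icc h1 h2 (fun s hs => by
      have hs0 : |s| = s := abs_of_nonneg (hr.le.trans hs.1)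
      rw [hΩF _ (h2' s hs), hΩF _ (hWedge m s (by rw [hs0]; exact hs.1) (by rw [hs0]; exact hs.2))]
      have := hedge m s hs.1 hs.2
      simpa only [cornerPt, ofReal_neg] using this)
      (left_mem_Icc.2 (by linarith)) (right_mem_Icc.2 (by linarith))
    have e : ∀ x y : ℝ, ((x : ℂ) + (y : ℂ)) = ((x + y : ℝ) : ℂ) := fun x y => by push_cast; rfl
    simp only [e] at h3
    simp only [hB]
    have e1 : ((m : ℝ) * (Real.pi / p) + (Real.pi / p - r))
        = ((m + 1 : ℤ) * (Real.pi / p) - r) := by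
      push_cast; ring
    have e2 : (((m + 1 + p : ℤ) : ℝ) * (Real.pi / p) + -r)
        = ((m + p + 1 : ℤ) * (Real.pi / p) - r) := by
      push_cast; ring
    have e3 : (((m + 1 + p : ℤ) : ℝ) * (Real.pi / p) + -(Real.pi / p - r))
        = ((m + p : ℤ) * (Real.pi / p) + r) := by
      push_cast; ring
    rw [e1, e2, e3] at h3
    linarith
  have hsumB : ∑ m ∈ Finset.range (2 * p), B m = 0 := by
    rw [two_mul, Finset.sum_range_add, ← Finset.sum_add_distrib]
    refine Finset.sum_eq_zero fun m _ => ?_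
    rw [add_comm p m, Nat.cast_add, hBp]
    ring
  -- `A m` is the variation along the arc about the `m`-th vertex, in the direction opposite to that
  -- of the boundary of the polygon
  set A : ℤ → ℝ := fun m => Ω (((m * (Real.pi / p) - r : ℝ) : ℂ))
    - Ω (((m * (Real.pi / p) + r : ℝ) : ℂ)) with hA
  have htel : ∑ m ∈ Finset.range (2 * p), (B m - A (m + 1)) = 2 * Real.pi * N := by
    have h1 : ∀ m : ℕ, B m - A (m + 1) = Ω ((((m + 1 : ℕ) : ℤ) * (Real.pi / p) + r : ℝ) : ℂ)
        - Ω ((((m : ℕ) : ℤ) * (Real.pi / p) + r : ℝ) : ℂ) := fun m => by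
      simp only [hB, hA]
      push_cast
      ring
    simp only [h1]
    rw [Finset.sum_range_sub (fun m : ℕ => Ω ((((m : ℕ) : ℤ) * (Real.pi / p) + r : ℝ) : ℂ))]
    have := hper 0 r
    rw [zero_add] at this
    rw [Nat.cast_mul, Nat.cast_two, this]
    simp
  have harc : ∀ (ε : ℤ) {G : ℂ → Circle} {d : ℤ}, CircleDeg G 0 (r ^ (2 / p : ℝ)) d →
      (∀ (j : ℕ) (ξ : ℂ), ‖ξ‖ = r → 0 ≤ ξ.im →
        F (cornerPt p (2 * j + ε) ξ) = G (cornerCoord p (2 * j + ε) ξ)) →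
      ∑ j ∈ Finset.range p, A (2 * j + ε) = 2 * Real.pi * d := fun ε G d hG hFG => by
    refine sum_arc_variation hp hr ε hG (fun j => hΩc.mono ?_) fun j ξ h0 h1 => ?_
    · rintro _ ⟨ξ, ⟨h0, h1⟩, rfl⟩
      exact hWarc _ ξ h0 h1
    · rw [hΩF _ (hWarc _ ξ h0 h1), ← hFG j ξ h0 h1, cornerPt]
  have hsumA : ∑ m ∈ Finset.range (2 * p), A (m + 1) = 2 * Real.pi * (d₀ + d₁) := by
    rw [sum_range_two_mul (fun m : ℕ => A (m + 1)), Finset.sum_add_distrib]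
    have h1 := harc 1 hG₁ fun j ξ h0 h1 => hFG₁ _ ξ ⟨j, by ring⟩ h0 h1
    have h2 := harc 2 hG₀ fun j ξ h0 h1 => hFG₀ _ ξ ⟨j + 1, by ring⟩ h0 h1
    have e1 : ∀ j : ℕ, A (((2 * j : ℕ) : ℤ) + 1) = A (2 * j + 1) := fun j => by push_cast; rfl
    have e2 : ∀ j : ℕ, A (((2 * j + 1 : ℕ) : ℤ) + 1) = A (2 * j + 2) := fun j => by
      push_cast; congr 1
    simp only [e1, e2]
    rw [h1, h2]
    ring
  rw [Finset.sum_sub_distrib, hsumB, hsumA] at htel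
  have h5 : ((N : ℝ) + d₀ + d₁) * (2 * Real.pi) = 0 := by linarith
  rcases mul_eq_zero.1 h5 with h | h
  · exact_mod_cast h
  · exact absurd h (by positivity)

/-! ### The quotient of the polygon near its vertices -/

/-- The retraction of the plane onto the closed unit disk. -/
noncomputable def toDisk (z : ℂ) : UnitDisk :=
  ⟨z / (max 1 ‖z‖ : ℝ), by
    have h : (0 : ℝ) < max 1 ‖z‖ := lt_max_of_lt_left one_pos
    rw [mem_closedBall_zero_iff, norm_div, norm_real, Real.norm_eq_abs, abs_of_pos h,
      div_le_one h]
    exact le_max_right _ _⟩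

lemma coe_toDisk {z : ℂ} (hz : ‖z‖ ≤ 1) : (toDisk z : ℂ) = z := by
  simp [toDisk, max_eq_left hz]

lemma toDisk_coe (z : UnitDisk) : toDisk (z : ℂ) = z := Subtype.ext (coe_toDisk z.norm_le)

lemma continuous_toDisk : Continuous toDisk := by
  refine Continuous.subtype_mk (Continuous.div continuous_id (by fun_prop) fun z => ?_) _
  have h : (0 : ℝ) < max 1 ‖z‖ := lt_max_of_lt_left one_pos
  exact_mod_cast h.ne'

lemma toDisk_mul (c : Circle) (z : ℂ) : toDisk (c * z) = UnitDisk.rot c (toDisk z) := by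
  refine Subtype.ext ?_
  simp only [toDisk, UnitDisk.rot, norm_mul, Circle.norm_coe, one_mul, mul_div_assoc]

/-- The image in the quotient of the polygon of a point of the unit disk (or of its retraction to
the unit disk). -/
noncomputable def polyMk (p : ℕ) (z : ℂ) : Quot (EdgeRel p) := Quot.mk _ (toDisk z)

lemma continuous_polyMk : Continuous (polyMk p) := continuous_quot_mk.comp continuous_toDisk

lemma polyMk_coe (z : UnitDisk) : polyMk p (z : ℂ) = Quot.mk _ z := by
  rw [polyMk, toDisk_coe]

lemma poly1_act_polyMk [NeZero p] (u : (ZMod p)ˣ) (z : ℂ) :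
    (poly1 p u).act (polyMk p z) = polyMk p ((ZMod.toCircle (u : ZMod p) : ℂ) * z) := by
  rw [polyMk, polyMk, toDisk_mul]
  rfl

lemma cornerPt_add_vertex [NeZero p] (m k : ℤ) (ξ : ℂ) :
    cornerPt p (m + k) ξ = cornerPt p m (ξ + ((k * (Real.pi / p) : ℝ) : ℂ)) := by
  unfold cornerPt
  congr 1
  push_cast
  ring

lemma edgeRel_iff [NeZero p] {z w : UnitDisk} : EdgeRel p z w ↔ ∃ (m : ℤ) (s : ℝ), 0 ≤ s ∧
    s ≤ Real.pi / p ∧ (z : ℂ) = cornerPt p m s ∧ (w : ℂ) = cornerPt p (m + 1 + p) (-s : ℝ) := by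
  have hp : (p : ℂ) ≠ 0 := by exact_mod_cast NeZero.ne p
  unfold EdgeRel
  refine exists_congr fun m => exists_congr fun s => and_congr_right fun _ =>
    and_congr_right fun _ => ?_
  rw [cornerPt_ofReal, cornerPt_ofReal]
  have : (((m + 1 + p : ℤ) * (Real.pi / p) + -s : ℝ) : ℂ)
      = (((m + 1) * (Real.pi / p) + Real.pi - s : ℝ) : ℂ) := by
    push_cast
    field_simp
    ring
  rw [this]

lemma cornerPt_congr [NeZero p] {m m' : ℤ} (h : m ≡ m' [ZMOD (2 * p)]) (ξ : ℂ) :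
    cornerPt p m ξ = cornerPt p m' ξ := by
  obtain ⟨l, hl⟩ := h.dvd
  refine cornerPt_eq_iff.2 ⟨l, ?_⟩
  have : m - m' + 2 * p * l = 0 := by rw [← hl]; ring
  simp [this]

lemma EdgeRel.symm [NeZero p] {z w : UnitDisk} (h : EdgeRel p z w) : EdgeRel p w z := by
  rw [edgeRel_iff] at h ⊢
  obtain ⟨m, s, h0, h1, hz, hw⟩ := h
  refine ⟨m + p, Real.pi / p - s, by linarith, by linarith, ?_, ?_⟩
  · rw [hw, show m + 1 + (p : ℤ) = m + p + 1 by ring, cornerPt_add_vertex (m + p)]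
    congr 1
    push_cast
    ring
  · rw [hz, show m + (p : ℤ) + 1 + p = (m + 2 * p) + 1 by ring, cornerPt_add_vertex (m + 2 * p)]
    rw [cornerPt_congr (m := m) (m' := m + 2 * p)
      (by rw [Int.modEq_iff_dvd]; exact ⟨1, by ring⟩)]
    congr 1
    push_cast
    ring

lemma norm_cornerPt_le {m : ℤ} {ξ : ℂ} (h : 0 ≤ ξ.im) : ‖cornerPt p m ξ‖ ≤ 1 := by
  rw [norm_cornerPt, Real.exp_le_one_iff]
  linarith

lemma polyMk_edge [NeZero p] (m : ℤ) {s : ℝ} (h0 : 0 ≤ s) (h1 : s ≤ Real.pi / p) :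
    polyMk p (cornerPt p m s) = polyMk p (cornerPt p (m + 1 + p) (-s : ℝ)) :=
  Quot.sound (edgeRel_iff.2 ⟨m, s, h0, h1, coe_toDisk (norm_cornerPt_le (by simp)),
    coe_toDisk (norm_cornerPt_le (by simp))⟩)

/-- The vertices of one parity have the same image. -/
lemma polyMk_vertex_eq [NeZero p] (m k : ℤ) :
    polyMk p (cornerPt p (m + 2 * k) 0) = polyMk p (cornerPt p m 0) := by
  have hpi : 0 ≤ Real.pi / p := by positivity
  have h1 : ∀ m : ℤ, polyMk p (cornerPt p (m + (1 + p)) 0) = polyMk p (cornerPt p m 0) :=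
      fun m => by
    have := polyMk_edge (p := p) m le_rfl hpi
    rw [neg_zero, ofReal_zero] at this
    rw [this, add_assoc]
  have h2 : ∀ t m : ℤ, polyMk p (cornerPt p (m + t * (1 + p)) 0) = polyMk p (cornerPt p m 0) := by
    intro t
    induction t using Int.induction_on with
    | zero => simp
    | succ t ih =>
      intro m
      rw [add_mul, one_mul, ← add_assoc, h1, ih]
    | pred t ih =>
      intro m
      rw [← h1 (m + (-t - 1) * (1 + p)), ← ih m]
      congr 2
      ring
  rw [← h2 (2 * k) m]
  congr 1
  refine cornerPt_congr ?_ _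
  rw [Int.modEq_iff_dvd]
  exact ⟨k, by ring⟩

lemma cornerCoord_zero [NeZero p] (m : ℤ) : cornerCoord p m 0 = 0 := by
  have : (((2 / p : ℝ) : ℂ)) ≠ 0 := by
    have hp : (0 : ℝ) < p := by exact_mod_cast NeZero.pos p
    exact_mod_cast (div_pos two_pos hp).ne'
  rw [cornerCoord, mul_zero, zero_cpow this, mul_zero]

lemma cornerCoord_congr [NeZero p] {m m' : ℤ} (h : m ≡ m' [ZMOD p]) (ξ : ℂ) :
    cornerCoord p m ξ = cornerCoord p m' ξ := by
  rw [cornerCoord, cornerCoord, (ZMod.intCast_eq_intCast_iff m m' p).2 h]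

/-- Polar coordinates in the upper half plane. -/
lemma exists_polar {ξ : ℂ} (h : 0 ≤ ξ.im) :
    ∃ β ∈ Icc 0 Real.pi, ξ = (‖ξ‖ : ℝ) * (Circle.exp β : ℂ) :=
  ⟨arg ξ, ⟨arg_nonneg_iff.2 h, arg_le_pi ξ⟩, (norm_mul_exp_arg_mul_I ξ).symm⟩

lemma norm_cornerCoord [NeZero p] (m : ℤ) {ξ : ℂ} (h : 0 ≤ ξ.im) :
    ‖cornerCoord p m ξ‖ = ‖ξ‖ ^ (2 / p : ℝ) := by
  have hp : (0 : ℝ) < p := by exact_mod_cast NeZero.pos p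
  by_cases h0 : ξ = 0
  · rw [h0, cornerCoord_zero, norm_zero, Real.zero_rpow (div_pos two_pos hp).ne']
  · obtain ⟨β, hβ, h1⟩ := exists_polar h
    have h2 : 0 < ‖ξ‖ := norm_pos_iff.2 h0
    conv_lhs => rw [h1]
    rw [cornerCoord_exp _ h2 hβ.1 hβ.2, norm_mul, Circle.norm_coe, mul_one, norm_real,
      Real.norm_eq_abs, abs_of_pos (Real.rpow_pos_of_pos h2 _)]

lemma cornerCoord_edge [NeZero p] (m : ℤ) {s : ℝ} (hs : 0 ≤ s) :
    cornerCoord p (m + 1 + p) (-s : ℝ) = cornerCoord p m s := by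
  rcases hs.eq_or_lt with rfl | hs
  · simp [cornerCoord_zero]
  · have hp : (p : ℝ) ≠ 0 := by exact_mod_cast NeZero.ne p
    have h1 := cornerCoord_exp (p := p) m hs le_rfl Real.pi_pos.le
    have h2 := cornerCoord_exp (p := p) (m + 1 + p) hs Real.pi_pos.le le_rfl
    have e1 : (s : ℂ) * (Circle.exp Real.pi : ℂ) = (-s : ℝ) := by
      rw [Circle.coe_exp, exp_pi_mul_I]; push_cast; ring
    rw [e1] at h2
    rw [Circle.exp_zero, Circle.coe_one, mul_one] at h1
    rw [h1, h2]
    refine congrArg (fun c : Circle => ((s ^ (2 / p : ℝ) : ℝ) : ℂ) * (c : ℂ))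
      (Circle.exp_eq_exp.2 ⟨-1, ?_⟩)
    push_cast
    field_simp
    ring

/-- Near the vertices of one parity, points with the same angular coordinate have the same image in
the quotient. -/
lemma polyMk_eq_of_cornerCoord_eq [NeZero p] (hp : Odd p) {m m' : ℤ} (hm : m ≡ m' [ZMOD 2])
    {ξ ξ' : ℂ} (h : 0 ≤ ξ.im) (h' : 0 ≤ ξ'.im) (hξ : ‖ξ‖ ≤ Real.pi / p)
    (heq : cornerCoord p m ξ = cornerCoord p m' ξ') :
    polyMk p (cornerPt p m ξ) = polyMk p (cornerPt p m' ξ') := by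
  have hp0 : (0 : ℝ) < p := by exact_mod_cast NeZero.pos p
  have hpi := Real.pi_pos
  have hnorm : ‖ξ‖ = ‖ξ'‖ := by
    have h1 := norm_cornerCoord (p := p) m h
    rw [heq, norm_cornerCoord _ h'] at h1
    exact ((Real.rpow_left_inj (norm_nonneg _) (norm_nonneg _) (div_pos two_pos hp0).ne').1 h1).symm
  by_cases h0 : ξ = 0
  · have h0' : ξ' = 0 := by rw [← norm_eq_zero, ← hnorm, h0, norm_zero]
    obtain ⟨k, hk⟩ := hm.dvd
    rw [h0, h0', show m' = m + 2 * k by linarith, polyMk_vertex_eq]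
  · obtain ⟨β, hβ, e⟩ := exists_polar h
    obtain ⟨β', hβ', e'⟩ := exists_polar h'
    rw [← hnorm] at e'
    set r := ‖ξ‖ with hr
    have hr0 : 0 < r := norm_pos_iff.2 h0
    rw [e, e', cornerCoord_exp _ hr0 hβ.1 hβ.2, cornerCoord_exp _ hr0 hβ'.1 hβ'.2] at heq
    have h3 : ((r ^ (2 / p : ℝ) : ℝ) : ℂ) ≠ 0 := by
      exact_mod_cast (Real.rpow_pos_of_pos hr0 _).ne'
    obtain ⟨l, hl⟩ := Circle.exp_eq_exp.1 (Circle.coe_injective (mul_left_cancel₀ h3 heq))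
    have h4 : β - β' = Real.pi * ((m - m' + p * l : ℤ) : ℝ) := by
      push_cast
      field_simp at hl
      linarith
    obtain ⟨q, hq⟩ := hp
    obtain ⟨t, ht⟩ := hm.dvd
    have hk1 : (m - m' + p * l : ℤ) ≤ 1 := by
      have : ((m - m' + p * l : ℤ) : ℝ) ≤ 1 := by
        by_contra hcon
        have := hβ.2; have := hβ'.1
        nlinarith
      exact_mod_cast this
    have hk2 : -1 ≤ (m - m' + p * l : ℤ) := by
      have : -1 ≤ ((m - m' + p * l : ℤ) : ℝ) := by
        by_contra hcon
        have := hβ.1; have := hβ'.2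
        nlinarith
      exact_mod_cast this
    have e3 : (r : ℂ) * (Circle.exp Real.pi : ℂ) = (-r : ℝ) := by
      rw [Circle.coe_exp, exp_pi_mul_I]; push_cast; ring
    have e4 : (r : ℂ) * (Circle.exp 0 : ℂ) = (r : ℝ) := by simp
    obtain h5 | h5 | h5 : (m - m' + p * l : ℤ) = 0 ∨ (m - m' + p * l : ℤ) = 1 ∨
        (m - m' + p * l : ℤ) = -1 := by omega
    · rw [h5, Int.cast_zero, mul_zero, sub_eq_zero] at h4
      have h6 : Even l := by
        have : Even ((p : ℤ) * l) := ⟨t, by linarith⟩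
        rcases Int.even_mul.1 this with h | h
        · rw [hq] at h; exact absurd h (by rw [Int.not_even_iff_odd]; exact ⟨q, by push_cast; ring⟩)
        · exact h
      obtain ⟨l', hl'⟩ := h6
      rw [e, e', h4]
      congr 1
      refine cornerPt_congr ?_ _
      rw [Int.modEq_iff_dvd]
      exact ⟨l', by rw [hl'] at h5; linear_combination -h5⟩
    · rw [h5] at h4
      have h6 : β = Real.pi := by have := hβ.2; have := hβ'.1; push_cast at h4; linarith
      have h7 : β' = 0 := by push_cast at h4; linarith
      have h8 : Odd l := by
        by_contra h8
        rw [Int.not_odd_iff_even] at h8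
        obtain ⟨l', hl'⟩ := h8
        rw [hl'] at h5
        have : 2 * (-t + p * l') = 1 := by linear_combination h5 + ht
        omega
      obtain ⟨l', hl'⟩ := h8
      rw [e, e', h6, h7, e3, e4, polyMk_edge m' hr0.le hξ]
      congr 1
      refine cornerPt_congr ?_ _
      rw [Int.modEq_iff_dvd]
      exact ⟨l' + 1, by rw [hl'] at h5; linear_combination -h5⟩
    · rw [h5] at h4
      have h6 : β = 0 := by have := hβ.1; have := hβ'.2; push_cast at h4; linarith
      have h7 : β' = Real.pi := by push_cast at h4; linarith
      have h8 : Odd l := by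
        by_contra h8
        rw [Int.not_odd_iff_even] at h8
        obtain ⟨l', hl'⟩ := h8
        rw [hl'] at h5
        have : 2 * (-t + p * l') = -1 := by linear_combination h5 + ht
        omega
      obtain ⟨l', hl'⟩ := h8
      rw [e, e', h6, h7, e3, e4, polyMk_edge m hr0.le hξ]
      congr 1
      refine cornerPt_congr ?_ _
      rw [Int.modEq_iff_dvd]
      exact ⟨l', by rw [hl'] at h5; linear_combination -h5⟩

/-- The half disk of radius `1 / p` in the upper half plane. -/
def halfDisk (p : ℕ) : Set ℂ := {ξ | 0 ≤ ξ.im ∧ ‖ξ‖ ≤ 1 / p}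

/-- The radius in the angular coordinate that corresponds to the radius `1 / p` at each corner. -/
noncomputable def vertexRadius (p : ℕ) : ℝ := (1 / p : ℝ) ^ (2 / p : ℝ)

open Classical in
/-- The inverse of the angular coordinate at the common image of the vertices whose parity is that
of `ε`. -/
noncomputable def vertexMap (p : ℕ) [NeZero p] (ε : ℤ) (w : ℂ) : Quot (EdgeRel p) :=
  if h : ∃ q : ℤ × ℂ, q.1 ≡ ε [ZMOD 2] ∧ q.2 ∈ halfDisk p ∧ cornerCoord p q.1 q.2 = w then
    polyMk p (cornerPt p h.choose.1 h.choose.2) else polyMk p 0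

lemma vertexRadius_pos [NeZero p] : 0 < vertexRadius p := by
  have hp : (0 : ℝ) < p := by exact_mod_cast NeZero.pos p
  exact Real.rpow_pos_of_pos (by positivity) _

lemma one_div_le_pi_div [NeZero p] : (1 : ℝ) / p ≤ Real.pi / p := by
  have hp : (0 : ℝ) < p := by exact_mod_cast NeZero.pos p
  have := Real.pi_gt_three
  gcongr
  linarith

lemma vertexMap_cornerCoord [NeZero p] (hp : Odd p) {ε m : ℤ} (hm : m ≡ ε [ZMOD 2]) {ξ : ℂ}
    (hξ : ξ ∈ halfDisk p) : vertexMap p ε (cornerCoord p m ξ) = polyMk p (cornerPt p m ξ) := by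
  have h : ∃ q : ℤ × ℂ, q.1 ≡ ε [ZMOD 2] ∧ q.2 ∈ halfDisk p ∧
      cornerCoord p q.1 q.2 = cornerCoord p m ξ := ⟨(m, ξ), hm, hξ, rfl⟩
  rw [vertexMap, dif_pos h]
  obtain ⟨h1, h2, h3⟩ := h.choose_spec
  exact polyMk_eq_of_cornerCoord_eq hp (h1.trans hm.symm) h2.1 hξ.1
    (h2.2.trans one_div_le_pi_div) h3

lemma exists_cornerCoord_eq [NeZero p] (hp : Odd p) (ε : ℤ) {w : ℂ} (hw : ‖w‖ ≤ vertexRadius p) :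
    ∃ m ∈ Finset.Ico (0 : ℤ) (2 * p), m ≡ ε [ZMOD 2] ∧ ∃ ξ ∈ halfDisk p, cornerCoord p m ξ = w := by
  have hp0 : (0 : ℝ) < p := by exact_mod_cast NeZero.pos p
  have hp1 : (0 : ℤ) < 2 * p := by have := NeZero.pos p; omega
  have hpi := Real.pi_pos
  suffices h : ∃ m : ℤ, m ≡ ε [ZMOD 2] ∧ ∃ ξ ∈ halfDisk p, cornerCoord p m ξ = w by
    obtain ⟨m, hm, ξ, hξ, h⟩ := h
    have h1 : m % (2 * p) ≡ m [ZMOD (2 * p)] := Int.mod_modEq _ _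
    refine ⟨m % (2 * p), Finset.mem_Ico.2 ⟨Int.emod_nonneg _ hp1.ne', Int.emod_lt_of_pos _ hp1⟩,
      (h1.of_dvd (Dvd.intro _ rfl)).trans hm, ξ, hξ, ?_⟩
    rw [← h]
    exact cornerCoord_congr (h1.of_dvd (Dvd.intro_left _ rfl)) ξ
  by_cases hw0 : w = 0
  · exact ⟨ε, rfl, 0, ⟨by simp, by simp⟩, by rw [cornerCoord_zero, hw0]⟩
  have hw1 : 0 < ‖w‖ := norm_pos_iff.2 hw0
  -- the half disks cut the circle into `p` arcs; `x` is the angle of `w` in units of such an arc,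
  -- and its integral part determines the half disk
  set x : ℝ := p * arg w / (2 * Real.pi) + 1 / 2 with hx
  set n : ℤ := ⌊x⌋ with hn
  obtain ⟨q, hq⟩ := hp
  have hr : 0 < ‖w‖ ^ (p / 2 : ℝ) := Real.rpow_pos_of_pos hw1 _
  have hβ : Real.pi * (x - n) ∈ Icc 0 Real.pi := by
    have h1 := Int.floor_le x
    have h2 := Int.lt_floor_add_one x
    constructor
    · exact mul_nonneg hpi.le (by linarith)
    · nlinarith
  refine ⟨-n - p * (n + ε), ?_, (‖w‖ ^ (p / 2 : ℝ) : ℝ) * (Circle.exp (Real.pi * (x - n)) : ℂ),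
    ⟨?_, ?_⟩, ?_⟩
  · rw [Int.modEq_iff_dvd, hq]
    exact ⟨ε + n + q * (n + ε), by push_cast; ring⟩
  · rw [im_ofReal_mul, Circle.coe_exp, exp_ofReal_mul_I_im]
    exact mul_nonneg hr.le (Real.sin_nonneg_of_mem_Icc hβ)
  · rw [norm_mul, Circle.norm_coe, mul_one, norm_real, Real.norm_eq_abs, abs_of_pos hr]
    have h1 := Real.rpow_le_rpow hw1.le hw (by positivity : (0 : ℝ) ≤ p / 2)
    rw [vertexRadius, ← Real.rpow_mul (by positivity)] at h1
    rwa [show (2 / p : ℝ) * (p / 2) = 1 by field_simp, Real.rpow_one] at h1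
  · rw [cornerCoord_exp _ hr hβ.1 hβ.2, ← Real.rpow_mul hw1.le,
      show (p / 2 : ℝ) * (2 / p) = 1 by field_simp, Real.rpow_one]
    conv_rhs => rw [← norm_mul_exp_arg_mul_I w]
    refine congrArg (fun c : Circle => (‖w‖ : ℂ) * (c : ℂ)) (Circle.exp_eq_exp.2 ⟨n + ε, ?_⟩)
    rw [hx]
    push_cast
    field_simp
    ring

/-- The factor `-I` turns the closed upper half plane into the right half plane, away from the cut
of the power function. -/
lemma continuousOn_cornerCoord [NeZero p] (m : ℤ) :
    ContinuousOn (cornerCoord p m) {ξ | 0 ≤ ξ.im} := by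
  have hp0 : (0 : ℝ) < p := by exact_mod_cast NeZero.pos p
  intro ξ hξ
  have hξ' : 0 ≤ ξ.im := hξ
  refine ContinuousAt.continuousWithinAt ?_
  refine continuousAt_const.mul ?_
  by_cases h0 : ξ = 0
  · subst h0
    have h1 : ContinuousAt (fun x : ℂ × ℂ => x.1 ^ x.2) (-I * 0, ((2 / p : ℝ) : ℂ)) := by
      rw [mul_zero]
      refine Complex.continuousAt_cpow_zero_of_re_pos ?_
      rw [ofReal_re]
      positivity
    exact ContinuousAt.comp (f := fun ξ : ℂ => (-I * ξ, ((2 / p : ℝ) : ℂ)))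
      (x := 0) h1 (by fun_prop)
  · refine ContinuousAt.cpow (by fun_prop) continuousAt_const ?_
    rw [mem_slitPlane_iff]
    by_cases h1 : ξ.im = 0
    · right
      have h2 : ξ.re ≠ 0 := fun h2 => h0 (Complex.ext h2 h1)
      simpa using h2
    · left
      simpa using lt_of_le_of_ne hξ' (Ne.symm h1)

lemma isCompact_halfDisk : IsCompact (halfDisk p) := by
  have h : halfDisk p = {ξ : ℂ | 0 ≤ ξ.im} ∩ closedBall 0 (1 / p) := by
    ext ξ
    simp [halfDisk]
  rw [h]
  exact (isCompact_closedBall _ _).inter_left (isClosed_le continuous_const continuous_im)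

/-- The preimage of a closed set is closed, since it is the union of the images of compact subsets
of the finitely many half disks. -/
lemma continuousOn_vertexMap [NeZero p] (hp : Odd p) (ε : ℤ) :
    ContinuousOn (vertexMap p ε) (closedBall 0 (vertexRadius p)) := by
  rw [continuousOn_iff_isClosed]
  intro C hC
  refine ⟨⋃ m ∈ {m ∈ Finset.Ico (0 : ℤ) (2 * p) | m ≡ ε [ZMOD 2]}, cornerCoord p m ''
    (halfDisk p ∩ (fun ξ => polyMk p (cornerPt p m ξ)) ⁻¹' C), ?_, ?_⟩
  · refine Set.Finite.isClosed_biUnion (Finset.finite_toSet _) fun m _ => IsCompact.isClosed ?_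
    refine IsCompact.image_of_continuousOn ?_
      ((continuousOn_cornerCoord m).mono fun ξ hξ => hξ.1.1)
    exact isCompact_halfDisk.inter_right
      (hC.preimage (continuous_polyMk.comp (continuous_cornerPt m)))
  · ext w
    simp only [mem_inter_iff, mem_preimage, mem_iUnion, mem_image, Finset.mem_filter]
    refine and_congr_left fun hw => ⟨fun h => ?_, ?_⟩
    · obtain ⟨m, hm, hmε, ξ, hξ, rfl⟩ := exists_cornerCoord_eq hp ε (mem_closedBall_zero_iff.1 hw)
      rw [vertexMap_cornerCoord hp hmε hξ] at h
      exact ⟨m, ⟨hm, hmε⟩, ξ, ⟨hξ, h⟩, rfl⟩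
    · rintro ⟨m, ⟨_, hmε⟩, ξ, ⟨hξ, h⟩, rfl⟩
      rwa [vertexMap_cornerCoord hp hmε hξ]

/-- The point `z` of the disk lies near a vertex whose parity is that of `ε`, and `w` is its angular
coordinate. -/
def NearVertex (p : ℕ) [NeZero p] (ε : ℤ) (w : ℂ) (z : UnitDisk) : Prop :=
  ∃ (m : ℤ) (ξ : ℂ), m ≡ ε [ZMOD 2] ∧ ξ ∈ halfDisk p ∧ (z : ℂ) = cornerPt p m ξ ∧
    cornerCoord p m ξ = w

/-- The angular coordinate is compatible with the identification of the edges. -/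
lemma NearVertex.of_edgeRel [NeZero p] (hp : Odd p) {ε : ℤ} {w : ℂ} {z z' : UnitDisk}
    (hzz' : EdgeRel p z z') (h : NearVertex p ε w z) : NearVertex p ε w z' := by
  have hp0 : (0 : ℝ) < p := by exact_mod_cast NeZero.pos p
  have hpi := Real.pi_gt_three
  have hpip : 1 / p < Real.pi / p := by gcongr; linarith
  have hpar : ∀ m : ℤ, m ≡ ε [ZMOD 2] → m + 1 + p ≡ ε [ZMOD 2] := fun m hm => by
    obtain ⟨q, hq⟩ := hp
    refine Int.ModEq.trans ?_ hm
    rw [Int.modEq_iff_dvd, hq]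
    exact ⟨-q - 1, by push_cast; ring⟩
  obtain ⟨m₀, s, h0, h1, hz, hz'⟩ := edgeRel_iff.1 hzz'
  obtain ⟨m, ξ, hm, hξ, hzm, hw⟩ := h
  obtain ⟨l, hl⟩ := cornerPt_eq_iff.1 (hz.symm.trans hzm)
  rw [← ofReal_add] at hl
  have hn : |s + ((m₀ - m + 2 * p * l : ℤ) : ℝ) * (Real.pi / p)| ≤ 1 / p := by
    have := hξ.2
    rwa [hl, norm_real, Real.norm_eq_abs] at this
  obtain ⟨hn1, hn2⟩ := abs_le.1 hn
  set k : ℤ := m₀ - m + 2 * p * l with hk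
  have hpp : 0 < Real.pi / p := by positivity
  have hk1 : k < 1 := by
    by_contra hcon
    have : (1 : ℝ) ≤ k := by exact_mod_cast not_lt.1 hcon
    nlinarith
  have hk2 : -2 < k := by
    by_contra hcon
    have : (k : ℝ) ≤ -2 := by exact_mod_cast not_lt.1 hcon
    nlinarith
  -- the point is on an edge that starts or ends at the vertex
  obtain hk0 | hk0 : k = 0 ∨ k = -1 := by omega
  · rw [hk0, Int.cast_zero, zero_mul, add_zero] at hl
    rw [hk0, Int.cast_zero, zero_mul, add_zero] at hn
    refine ⟨m + 1 + p, (-s : ℝ), hpar m hm, ⟨by simp, ?_⟩, ?_, ?_⟩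
    · rwa [norm_real, Real.norm_eq_abs, abs_neg]
    · rw [hz']
      refine cornerPt_congr ?_ _
      rw [Int.modEq_iff_dvd]
      exact ⟨l, by linear_combination -hk0 + hk⟩
    · rw [cornerCoord_edge m h0, ← hl, hw]
  · have hl' : ξ = (-(Real.pi / p - s) : ℝ) := by
      rw [hl, hk0]; push_cast; ring
    refine ⟨m - 1 + p, (Real.pi / p - s : ℝ), ?_, ⟨by simp, ?_⟩, ?_, ?_⟩
    · have := hpar (m - 2) (by
        refine Int.ModEq.trans ?_ hm
        rw [Int.modEq_iff_dvd]
        exact ⟨1, by ring⟩)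
      rwa [show m - 2 + 1 + (p : ℤ) = m - 1 + p by ring] at this
    · have := hξ.2
      rw [hl', norm_real, norm_neg] at this
      rwa [norm_real]
    · rw [hz', show m₀ + 1 + (p : ℤ) = m₀ + p + 1 by ring, cornerPt_add_vertex,
        show ((-s : ℝ) : ℂ) + (((1 : ℤ) * (Real.pi / p) : ℝ) : ℂ) = (Real.pi / p - s : ℝ) by
          push_cast; ring]
      refine cornerPt_congr ?_ _
      rw [Int.modEq_iff_dvd]
      exact ⟨l, by linear_combination -hk0 + hk⟩
    · rw [← hw, hl', ← cornerCoord_edge _ (by linarith : 0 ≤ Real.pi / p - s)]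
      refine cornerCoord_congr ?_ _
      rw [Int.modEq_iff_dvd]
      exact ⟨-2, by ring⟩

lemma nearVertex_iff_of_mk_eq [NeZero p] (hp : Odd p) {ε : ℤ} {w : ℂ} {z z' : UnitDisk}
    (h : Quot.mk (EdgeRel p) z = Quot.mk (EdgeRel p) z') :
    NearVertex p ε w z ↔ NearVertex p ε w z' := by
  let P : Quot (EdgeRel p) → Prop := Quot.lift (NearVertex p ε w) fun a b hab =>
    propext ⟨fun h => h.of_edgeRel hp hab, fun h => h.of_edgeRel hp hab.symm⟩
  exact iff_of_eq (congrArg P h)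

lemma NearVertex.unique [NeZero p] {ε ε' : ℤ} {w w' : ℂ} {z : UnitDisk}
    (h : NearVertex p ε w z) (h' : NearVertex p ε' w' z) : ε ≡ ε' [ZMOD 2] ∧ w = w' := by
  have hp0 : (0 : ℝ) < p := by exact_mod_cast NeZero.pos p
  obtain ⟨m, ξ, hm, hξ, hz, hw⟩ := h
  obtain ⟨m', ξ', hm', hξ', hz', hw'⟩ := h'
  obtain ⟨l, hl⟩ := cornerPt_eq_iff.1 (hz.symm.trans hz')
  have hk : m - m' + 2 * p * l = 0 := by
    by_contra hk
    have h1 : ‖ξ' - ξ‖ ≤ 2 / p := by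
      refine (norm_sub_le _ _).trans ?_
      have e : (2 : ℝ) / p = 1 / p + 1 / p := by ring
      rw [e]
      exact add_le_add hξ'.2 hξ.2
    rw [hl, add_sub_cancel_left, norm_real, Real.norm_eq_abs, abs_mul,
      abs_of_pos (by positivity : 0 < Real.pi / p)] at h1
    have h2 : (1 : ℝ) ≤ |((m - m' + 2 * p * l : ℤ) : ℝ)| := by exact_mod_cast Int.one_le_abs hk
    have h3 : 2 / (p : ℝ) < Real.pi / p := by
      have := Real.pi_gt_three
      gcongr; linarith
    have h4 : 0 < Real.pi / p := by positivity
    nlinarith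
  rw [hk, Int.cast_zero, zero_mul, ofReal_zero, add_zero] at hl
  have hmm : m ≡ m' [ZMOD (2 * p)] := by
    rw [Int.modEq_iff_dvd]
    exact ⟨l, by linear_combination -hk⟩
  refine ⟨hm.symm.trans ((hmm.of_dvd (Dvd.intro _ rfl)).trans hm'), ?_⟩
  rw [← hw, ← hw', hl]
  exact cornerCoord_congr (hmm.of_dvd (Dvd.intro_left _ rfl)) ξ

lemma mk_eq_vertexMap_iff [NeZero p] (hp : Odd p) {ε : ℤ} {w : ℂ} (hw : ‖w‖ ≤ vertexRadius p)
    (z : UnitDisk) : Quot.mk (EdgeRel p) z = vertexMap p ε w ↔ NearVertex p ε w z := by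
  constructor
  · intro h
    obtain ⟨m, -, hm, ξ, hξ, rfl⟩ := exists_cornerCoord_eq hp ε hw
    rw [vertexMap_cornerCoord hp hm hξ] at h
    exact (nearVertex_iff_of_mk_eq hp h).2
      ⟨m, ξ, hm, hξ, coe_toDisk (norm_cornerPt_le hξ.1), rfl⟩
  · rintro ⟨m, ξ, hm, hξ, hz, rfl⟩
    rw [vertexMap_cornerCoord hp hm hξ, ← hz, polyMk_coe]

lemma vertexMap_inj [NeZero p] (hp : Odd p) {ε ε' : ℤ} {w w' : ℂ} (hw : ‖w‖ ≤ vertexRadius p)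
    (hw' : ‖w'‖ ≤ vertexRadius p) (h : vertexMap p ε w = vertexMap p ε' w') :
    ε ≡ ε' [ZMOD 2] ∧ w = w' := by
  obtain ⟨z, hz⟩ := Quot.exists_rep (vertexMap p ε w)
  exact ((mk_eq_vertexMap_iff hp hw z).1 hz).unique
    ((mk_eq_vertexMap_iff hp hw' z).1 (hz.trans h))

lemma NearVertex.lt_norm [NeZero p] (h3 : 3 ≤ p) {ε : ℤ} {w : ℂ} {z : UnitDisk}
    (h : NearVertex p ε w z) : 2 / 3 < ‖(z : ℂ)‖ := by
  obtain ⟨m, ξ, -, hξ, hz, -⟩ := h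
  rw [hz, norm_cornerPt]
  have h1 : ξ.im ≤ 1 / 3 := by
    refine (le_abs_self _).trans ((abs_im_le_norm ξ).trans (hξ.2.trans ?_))
    exact one_div_le_one_div_of_le (by norm_num) (by exact_mod_cast h3)
  have h2 := Real.add_one_lt_exp (x := -(1 / 3 : ℝ)) (by norm_num)
  have h4 : Real.exp (-(1 / 3 : ℝ)) ≤ Real.exp (-ξ.im) := Real.exp_le_exp.2 (by linarith)
  linarith

lemma isOpen_image_vertexMap [NeZero p] (hp : Odd p) (ε : ℤ) {U : Set ℂ} (hU : IsOpen U)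
    (hUR : U ⊆ ball 0 (vertexRadius p)) : IsOpen (vertexMap p ε '' U) := by
  have hp0 : (0 : ℝ) < p := by exact_mod_cast NeZero.pos p
  refine isOpen_coinduced.2 (isOpen_iff_mem_nhds.2 fun z₀ hz₀ => ?_)
  obtain ⟨w, hwU, hw⟩ := hz₀
  have hwR : ‖w‖ < vertexRadius p := mem_ball_zero_iff.1 (hUR hwU)
  obtain ⟨m, ξ, hm, hξ, hz, rfl⟩ := (mk_eq_vertexMap_iff hp hwR.le z₀).1 hw.symm
  -- the coordinate `ξ` on the disk near `z₀`
  set L : UnitDisk → ℂ := fun z => ξ - I * log (z / z₀) with hL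
  have hz₀ : (z₀ : ℂ) ≠ 0 := by rw [hz]; exact exp_ne_zero _
  have hLc : ContinuousAt L z₀ := by
    refine continuousAt_const.sub (continuousAt_const.mul (ContinuousAt.clog ?_ ?_))
    · fun_prop
    · rw [div_self hz₀]; exact one_mem_slitPlane
  have hL0 : L z₀ = ξ := by simp [hL, div_self hz₀]
  have hLp : ∀ z : UnitDisk, (z : ℂ) ≠ 0 → cornerPt p m (L z) = z := fun z hz0 => by
    have h1 : cornerPt p m (L z) = cornerPt p m ξ * exp (log (z / z₀)) := by
      unfold cornerPt
      rw [← Complex.exp_add]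
      congr 1
      linear_combination -log (z / z₀) * I_mul_I
    rw [h1, ← hz, exp_log (div_ne_zero hz0 hz₀), mul_div_cancel₀ _ hz₀]
  have hLim : ∀ z : UnitDisk, (z : ℂ) ≠ 0 → 0 ≤ (L z).im := fun z hz0 => by
    have h1 := z.norm_le
    rw [← hLp z hz0, norm_cornerPt, Real.exp_le_one_iff] at h1
    linarith
  have hne : ∀ᶠ z : UnitDisk in 𝓝 z₀, (z : ℂ) ≠ 0 :=
    continuous_subtype_val.continuousAt.eventually_ne hz₀
  have h1 : Tendsto (fun z => cornerCoord p m (L z)) (𝓝 z₀) (𝓝 (cornerCoord p m ξ)) := by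
    have h2 : Tendsto (cornerCoord p m) (𝓝[{ξ | 0 ≤ ξ.im}] ξ) (𝓝 (cornerCoord p m ξ)) :=
      continuousOn_cornerCoord m ξ hξ.1
    refine h2.comp (tendsto_nhdsWithin_iff.2 ⟨?_, ?_⟩)
    · rw [← hL0]; exact hLc
    · exact hne.mono hLim
  filter_upwards [h1.eventually (hU.mem_nhds hwU), hne] with z hzU hz0
  have hzR : ‖cornerCoord p m (L z)‖ < vertexRadius p := mem_ball_zero_iff.1 (hUR hzU)
  refine ⟨_, hzU, ?_⟩
  rw [vertexMap_cornerCoord hp hm ⟨hLim z hz0, ?_⟩, hLp z hz0, polyMk_coe]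
  rw [norm_cornerCoord m (hLim z hz0), vertexRadius] at hzR
  exact ((Real.rpow_lt_rpow_iff (norm_nonneg _) (by positivity) (by positivity)).1 hzR).le

/-- The rotation angle at a vertex of the quotient is `-2 u`: in the angular coordinate the half
disk at the `m`-th corner is turned by `-2 π m / p`, and the generator adds `2 u` to `m`. -/
lemma poly1_act_vertexMap [NeZero p] (hp : Odd p) (u : (ZMod p)ˣ) (ε : ℤ) {w : ℂ}
    (hw : ‖w‖ ≤ vertexRadius p) : (poly1 p u).act (vertexMap p ε w)
      = vertexMap p ε ((ZMod.toCircle (-2 * (u : ZMod p)) : ℂ) * w) := by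
  obtain ⟨m, -, hm, ξ, hξ, rfl⟩ := exists_cornerCoord_eq hp ε hw
  have h1 : (ZMod.toCircle (-2 * (u : ZMod p)) : ℂ) * cornerCoord p m ξ
      = cornerCoord p (m + 2 * (u : ZMod p).val) ξ := by
    rw [cornerCoord, cornerCoord, ← mul_assoc, ← Circle.coe_mul, ← AddChar.map_add_eq_mul]
    congr 4
    push_cast
    rw [ZMod.natCast_zmod_val]
    ring
  have h2 : (ZMod.toCircle (u : ZMod p) : ℂ) * cornerPt p m ξ
      = cornerPt p (m + 2 * (u : ZMod p).val) ξ := by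
    rw [ZMod.toCircle_apply, cornerPt, cornerPt, ← Complex.exp_add]
    congr 1
    push_cast
    ring
  rw [h1, vertexMap_cornerCoord hp hm hξ, poly1_act_polyMk, h2,
    vertexMap_cornerCoord hp (Int.ModEq.trans ?_ hm) hξ]
  rw [Int.modEq_iff_dvd]
  exact ⟨-(u : ZMod p).val, by ring⟩

/-! ### The fixed points of the polygon -/

lemma toCircle_ne_one [NeZero p] {k : ZMod p} (hk : k ≠ 0) : ZMod.toCircle k ≠ 1 := fun h =>
  hk (ZMod.injective_toCircle (h.trans (AddChar.map_zero_eq_one _).symm))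

lemma exists_eq_cornerPt [NeZero p] {z : ℂ} (hz : ‖z‖ = 1) :
    ∃ (m : ℤ) (s : ℝ), 0 ≤ s ∧ s < Real.pi / p ∧ z = cornerPt p m s := by
  have hp0 : (0 : ℝ) < p := by exact_mod_cast NeZero.pos p
  have hpp : 0 < Real.pi / p := by have := Real.pi_pos; positivity
  set x : ℝ := arg z / (Real.pi / p) with hx
  have h1 := Int.floor_le x
  have h2 := Int.lt_floor_add_one x
  have hxz : arg z = x * (Real.pi / p) := by rw [hx, div_mul_cancel₀ _ hpp.ne']
  refine ⟨⌊x⌋, (x - ⌊x⌋) * (Real.pi / p), mul_nonneg (by linarith) hpp.le, ?_, ?_⟩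
  · nlinarith
  · rw [cornerPt_ofReal, show (⌊x⌋ : ℝ) * (Real.pi / p) + (x - ⌊x⌋) * (Real.pi / p)
      = arg z by rw [hxz]; ring]
    have := norm_mul_exp_arg_mul_I z
    rw [hz, ofReal_one, one_mul] at this
    exact this.symm

/-- The point `z` lies in the interior of the `m`-th edge of the polygon or of the opposite one. -/
def OnOpenEdge (p : ℕ) (m : ℤ) (z : UnitDisk) : Prop :=
  ∃ (m' : ℤ) (s : ℝ), m' ≡ m [ZMOD p] ∧ 0 < s ∧ s < Real.pi / p ∧ (z : ℂ) = cornerPt p m' s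

lemma modEq_of_cornerPt_eq [NeZero p] {m m' : ℤ} {s s' : ℝ} (h0 : 0 < s) (h1 : s < Real.pi / p)
    (h0' : 0 ≤ s') (h1' : s' ≤ Real.pi / p) (h : cornerPt p m s = cornerPt p m' s') :
    m ≡ m' [ZMOD (2 * p)] ∧ s' = s := by
  have hp0 : (0 : ℝ) < p := by exact_mod_cast NeZero.pos p
  have hpp : 0 < Real.pi / p := by have := Real.pi_pos; positivity
  obtain ⟨l, hl⟩ := cornerPt_eq_iff.1 h
  rw [← ofReal_add, ofReal_inj] at hl
  set k : ℤ := m - m' + 2 * p * l with hk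
  have hk1 : k < 1 := by
    by_contra hcon
    have : (1 : ℝ) ≤ k := by exact_mod_cast not_lt.1 hcon
    nlinarith
  have hk2 : -1 < k := by
    by_contra hcon
    have : (k : ℝ) ≤ -1 := by exact_mod_cast not_lt.1 hcon
    nlinarith
  have hk0 : k = 0 := by omega
  refine ⟨?_, by rw [hl, hk0]; simp⟩
  rw [Int.modEq_iff_dvd]
  exact ⟨l, by linear_combination hk - hk0⟩

lemma OnOpenEdge.of_edgeRel [NeZero p] {m : ℤ} {z z' : UnitDisk} (hzz' : EdgeRel p z z')
    (h : OnOpenEdge p m z) : OnOpenEdge p m z' := by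
  obtain ⟨m₀, s₀, h0, h1, hz, hz'⟩ := edgeRel_iff.1 hzz'
  obtain ⟨m', s, hm', hs0, hs1, hzs⟩ := h
  obtain ⟨hmm, rfl⟩ := modEq_of_cornerPt_eq hs0 hs1 h0 h1 (hzs.symm.trans hz)
  refine ⟨m₀ + p, Real.pi / p - s₀, ?_, by linarith, by linarith, ?_⟩
  · refine Int.ModEq.trans ?_ hm'
    refine Int.ModEq.trans ?_ (hmm.of_dvd (Dvd.intro_left _ rfl)).symm
    rw [Int.modEq_iff_dvd]
    exact ⟨-1, by ring⟩
  · rw [hz', show m₀ + 1 + (p : ℤ) = m₀ + p + 1 by ring, cornerPt_add_vertex]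
    congr 1
    push_cast
    ring

lemma vertexMap_zero [NeZero p] (hp : Odd p) {m ε : ℤ} (hm : m ≡ ε [ZMOD 2]) :
    vertexMap p ε 0 = polyMk p (cornerPt p m 0) := by
  have := vertexMap_cornerCoord hp hm (ξ := 0) ⟨by simp, by simp⟩
  rwa [cornerCoord_zero] at this

lemma poly1_fixedSet [Fact p.Prime] (hp : Odd p) (u : (ZMod p)ˣ) :
    (poly1 p u).fixedSet = {polyMk p 0, vertexMap p 0 0, vertexMap p 1 0} := by
  have hR := (vertexRadius_pos (p := p)).le
  ext x
  change x ∈ (poly1 p u).fixedSet ↔ x = polyMk p 0 ∨ x = vertexMap p 0 0 ∨ x = vertexMap p 1 0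
  constructor
  · intro hx
    obtain ⟨z, rfl⟩ := Quot.exists_rep x
    have hx' : Quot.mk (EdgeRel p) (UnitDisk.rot (ZMod.toCircle (u : ZMod p)) z)
        = Quot.mk (EdgeRel p) z := hx
    rcases z.norm_le.lt_or_eq with hz | hz
    · left
      have h1 := congrArg Subtype.val (edgeRel_mk_eq hz hx')
      have h2 : ((ZMod.toCircle (u : ZMod p) : ℂ) - 1) * z = 0 := by
        have h3 : (ZMod.toCircle (u : ZMod p) : ℂ) * z = z := h1
        linear_combination h3
      rcases mul_eq_zero.1 h2 with h | h
      · exact absurd (Circle.ext (sub_eq_zero.1 h)) (toCircle_ne_one u.ne_zero)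
      · rw [← polyMk_coe, h]
    · right
      obtain ⟨m, s, h0, h1, hzm⟩ := exists_eq_cornerPt (p := p) hz
      rcases h0.eq_or_lt with rfl | h0
      · rw [← polyMk_coe, hzm, ofReal_zero]
        rcases Int.even_or_odd' m with ⟨l, h | h⟩
        · exact Or.inl (vertexMap_zero hp (Int.modEq_iff_dvd.2 ⟨-l, by rw [h]; ring⟩)).symm
        · exact Or.inr (vertexMap_zero hp (Int.modEq_iff_dvd.2 ⟨-l, by rw [h]; ring⟩)).symm
      · exfalso
        -- the edge identifications do not relate an edge to a rotated edge
        let P : Quot (EdgeRel p) → Prop := Quot.lift (OnOpenEdge p m) fun a b hab =>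
          propext ⟨fun h => h.of_edgeRel hab, fun h => h.of_edgeRel hab.symm⟩
        have h2 : OnOpenEdge p m z := ⟨m, s, rfl, h0, h1, hzm⟩
        have h3 : OnOpenEdge p m (UnitDisk.rot (ZMod.toCircle (u : ZMod p)) z) :=
          (iff_of_eq (congrArg P hx')).2 h2
        obtain ⟨m', s', hm', h0', h1', hz'⟩ := h3
        have h4 : ((UnitDisk.rot (ZMod.toCircle (u : ZMod p)) z : UnitDisk) : ℂ)
            = cornerPt p (m + 2 * (u : ZMod p).val) s := by
          change (ZMod.toCircle (u : ZMod p) : ℂ) * z = _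
          rw [hzm, ZMod.toCircle_apply, cornerPt, cornerPt, ← Complex.exp_add]
          congr 1
          push_cast
          ring
        obtain ⟨h5, -⟩ := modEq_of_cornerPt_eq h0 h1 h0'.le h1'.le (h4.symm.trans hz')
        have h6 := (h5.of_dvd (Dvd.intro_left _ rfl)).trans hm'
        rw [← ZMod.intCast_eq_intCast_iff] at h6
        push_cast at h6
        rw [ZMod.natCast_zmod_val, add_eq_left] at h6
        have h2u : IsUnit (2 : ZMod p) := by
          have : Nat.Coprime 2 p := (Nat.coprime_two_left).2 hp
          exact_mod_cast (ZMod.unitOfCoprime 2 this).isUnit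
        exact u.ne_zero ((h2u.mul_right_eq_zero).1 h6)
  · have hv : ∀ ε, vertexMap p ε 0 ∈ (poly1 p u).fixedSet := fun ε => by
      refine (poly1_act_vertexMap hp u ε (by simpa using hR)).trans ?_
      rw [mul_zero]
    rintro (rfl | rfl | rfl)
    · refine (poly1_act_polyMk u 0).trans ?_
      rw [mul_zero]
    · exact hv 0
    · exact hv 1

lemma polyMk_zero_ne_vertexMap [NeZero p] (hp : Odd p) (ε : ℤ) :
    polyMk p 0 ≠ vertexMap p ε 0 := by
  intro h
  rw [vertexMap_zero hp rfl, polyMk, polyMk] at h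
  have h0 : ‖(toDisk 0 : ℂ)‖ < 1 := by rw [coe_toDisk (by simp)]; simp
  have h1 := congrArg (fun z : UnitDisk => ‖(z : ℂ)‖) (edgeRel_mk_eq h0 h.symm)
  rw [coe_toDisk (norm_cornerPt_le (by simp)), norm_cornerPt, coe_toDisk (by simp)] at h1
  simp at h1

lemma vertexMap_zero_ne [NeZero p] (hp : Odd p) : vertexMap p 0 0 ≠ vertexMap p 1 0 := by
  intro h
  have hR := (vertexRadius_pos (p := p)).le
  have := (vertexMap_inj hp (by simpa using hR) (by simpa using hR) h).1
  exact absurd this (by decide)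

/-! ### Degrees at isolated points -/

/-- The circle-valued function `g`, defined near `0`, has degree `n` at `0`. -/
def PunctDeg (g : ℂ → Circle) (n : ℤ) : Prop :=
  ∃ ρ > 0, ∃ φ : ℂ → ℝ, ContinuousOn φ (ball 0 ρ \ {0}) ∧
    ∀ z, z ≠ 0 → ‖z‖ < ρ → g z = dir z ^ n * Circle.exp (φ z)

lemma PunctDeg.exists_circleDeg {g : ℂ → Circle} {n : ℤ} (h : PunctDeg g n) :
    ∃ ρ > 0, ∀ r, 0 < r → r < ρ → CircleDeg g 0 r n := by
  obtain ⟨ρ, hρ, φ, hφ, h⟩ := h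
  refine ⟨ρ, hρ, fun r h0 h1 => ⟨φ, hφ.mono fun z hz => ?_, fun z hz => ?_⟩⟩
  · rw [mem_sphere_zero_iff_norm] at hz
    exact ⟨by rwa [mem_ball_zero_iff, hz],
      by rw [mem_singleton_iff, ← ne_eq, ← norm_pos_iff, hz]; exact h0⟩
  · rw [mem_sphere_zero_iff_norm] at hz
    rw [sub_zero]
    exact h z (by rw [← norm_pos_iff, hz]; exact h0) (by rwa [hz])

lemma PunctDeg.unique {g : ℂ → Circle} {n m : ℤ} (hn : PunctDeg g n) (hm : PunctDeg g m) :
    n = m := by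
  obtain ⟨ρ, hρ, h⟩ := hn.exists_circleDeg
  obtain ⟨ρ', hρ', h'⟩ := hm.exists_circleDeg
  have h0 : 0 < min ρ ρ' / 2 := by positivity
  have h1 : min ρ ρ' / 2 < min ρ ρ' := by linarith
  exact (h _ h0 (h1.trans_le (min_le_left _ _))).unique h0
    (h' _ h0 (h1.trans_le (min_le_right _ _)))

lemma PunctDeg.congr {g g' : ℂ → Circle} {n : ℤ} (h : PunctDeg g n) {ρ : ℝ} (hρ : 0 < ρ)
    (hgg' : ∀ z, z ≠ 0 → ‖z‖ < ρ → g' z = g z) : PunctDeg g' n := by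
  obtain ⟨ρ', hρ', φ, hφ, h⟩ := h
  refine ⟨min ρ ρ', lt_min hρ hρ', φ, hφ.mono
    (sdiff_subset_sdiff_left (ball_subset_ball (min_le_right _ _))), fun z h0 h1 => ?_⟩
  rw [hgg' z h0 (h1.trans_le (min_le_left _ _)), h z h0 (h1.trans_le (min_le_right _ _))]

/-- The degree of a function on a punctured disk is attained on all its circles. -/
lemma exists_punctDeg {g : ℂ → Circle} {R : ℝ} (hR : 0 < R)
    (hg : ContinuousOn g (ball 0 R \ {0})) :
    ∃ n, PunctDeg g n ∧ ∀ r, 0 < r → r < R → CircleDeg g 0 r n := by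
  have hset : {z : ℂ | ‖z‖ ∈ Ioo 0 R} = ball 0 R \ {0} := by
    ext z
    simp only [mem_ofPred_eq, mem_Ioo, Set.mem_sdiff, mem_ball_zero_iff, mem_singleton_iff,
      norm_pos_iff]
    tauto
  obtain ⟨n, φ, hφ, h⟩ := exists_deg_annulus (J := Ioo 0 R) ordConnected_Ioo (fun x hx => hx.1)
    (f := g) (by rwa [hset])
  refine ⟨n, ⟨R, hR, φ, by rwa [← hset], fun z h0 h1 => h z ⟨norm_pos_iff.2 h0, h1⟩⟩,
    fun r h0 h1 => ⟨φ, hφ.mono fun z hz => ?_, fun z hz => ?_⟩⟩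
  · rw [mem_sphere_zero_iff_norm] at hz
    exact ⟨by rwa [hz], by rwa [hz]⟩
  · rw [mem_sphere_zero_iff_norm] at hz
    rw [sub_zero]
    exact h z ⟨by rwa [hz], by rwa [hz]⟩

lemma PunctDeg.circleDeg {g : ℂ → Circle} {R : ℝ} (hR : 0 < R)
    (hg : ContinuousOn g (ball 0 R \ {0})) {n : ℤ} (h : PunctDeg g n) {r : ℝ} (h0 : 0 < r)
    (h1 : r < R) : CircleDeg g 0 r n := by
  obtain ⟨m, hm, hm'⟩ := exists_punctDeg hR hg
  rw [h.unique hm]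
  exact hm' r h0 h1

lemma punctDeg_zero_of_continuousOn {g : ℂ → Circle} {R : ℝ} (hR : 0 < R)
    (hg : ContinuousOn g (ball 0 R)) : PunctDeg g 0 := by
  obtain ⟨φ, hφ, h⟩ := exists_log_of_starConvex
    ((convex_ball (0 : ℂ) R).starConvex (mem_ball_self hR)) hg
  exact ⟨R, hR, φ, hφ.mono sdiff_subset, fun z _ h1 => by
    simpa using h z (mem_ball_zero_iff.2 h1)⟩

/-- Degrees are multiplicative under composition with a map whose only zero is `0`. -/
lemma PunctDeg.comp {g : ℂ → Circle} {n : ℤ} (hg : PunctDeg g n) {h : ℂ → ℂ} {m : ℤ}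
    (hm : PunctDeg (fun z => dir (h z)) m) {ρ : ℝ} (hρ : 0 < ρ) (hc : ContinuousOn h (ball 0 ρ))
    (h0 : h 0 = 0) (hne : ∀ z, z ≠ 0 → ‖z‖ < ρ → h z ≠ 0) :
    PunctDeg (fun z => g (h z)) (m * n) := by
  obtain ⟨ρ₁, hρ₁, φ, hφ, hg⟩ := hg
  obtain ⟨ρ₂, hρ₂, ψ, hψ, hm⟩ := hm
  have hca : ContinuousAt h 0 := hc.continuousAt (ball_mem_nhds 0 hρ)
  have hev : ∀ᶠ z in 𝓝 (0 : ℂ), h z ∈ ball (0 : ℂ) ρ₁ := by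
    refine hca.eventually ?_
    rw [h0]
    exact ball_mem_nhds 0 hρ₁
  obtain ⟨ρ₃, hρ₃, hb⟩ := Metric.eventually_nhds_iff_ball.1 hev
  set δ := min (min ρ ρ₂) ρ₃ with hδ
  have e1 : δ ≤ ρ := (min_le_left _ _).trans (min_le_left _ _)
  have e2 : δ ≤ ρ₂ := (min_le_left _ _).trans (min_le_right _ _)
  have e3 : δ ≤ ρ₃ := min_le_right _ _
  refine ⟨δ, by positivity, fun z => n * ψ z + φ (h z), ?_, fun z hz0 hz1 => ?_⟩
  · refine (continuousOn_const.mul (hψ.mono (sdiff_subset_sdiff_left (ball_subset_ball e2)))).add ?_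
    refine hφ.comp (hc.mono (sdiff_subset.trans (ball_subset_ball e1))) fun z hz => ?_
    exact ⟨hb z (ball_subset_ball e3 hz.1),
      hne z hz.2 ((mem_ball_zero_iff.1 hz.1).trans_le e1)⟩
  · have h2 : ‖h z‖ < ρ₁ :=
      mem_ball_zero_iff.1 (hb z (mem_ball_zero_iff.2 (hz1.trans_le e3)))
    simp only [hg (h z) (hne z hz0 (hz1.trans_le e1)) h2, hm z hz0 (hz1.trans_le e2)]
    rw [mul_zpow, ← zpow_mul, ← Circle.exp_zsmul, zsmul_eq_mul, Circle.exp_add, mul_assoc]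

/-! ### Charts at fixed points -/

/-- An open embedding of a disk about `0`, on which the generator acts as multiplication by
`e^{2 π i u / p}`. -/
structure RotChart [NeZero p] (X : CpSpace p) (u : ZMod p) where
  radius : ℝ
  radius_pos : 0 < radius
  toFun : ball (0 : ℂ) radius → X.carrier
  isOpenEmbedding : IsOpenEmbedding toFun
  act_toFun : ∀ w w' : ball (0 : ℂ) radius, (w' : ℂ) = ZMod.toCircle u * w →
    X.act (toFun w) = toFun w'

namespace RotChart

variable [NeZero p] {X Y : CpSpace p} {u v : ZMod p}

/-- The fixed point at which the chart is centred. -/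
def center (c : RotChart X u) : X.carrier := c.toFun ⟨0, mem_ball_self c.radius_pos⟩

lemma act_center (c : RotChart X u) : X.act c.center = c.center :=
  c.act_toFun _ _ (by simp)

open Classical in
/-- The chart as a function on the plane, constant outside of its disk. -/
noncomputable def ext (c : RotChart X u) (z : ℂ) : X.carrier :=
  if h : z ∈ ball (0 : ℂ) c.radius then c.toFun ⟨z, h⟩ else c.center

lemma ext_coe (c : RotChart X u) (w : ball (0 : ℂ) c.radius) : c.ext w = c.toFun w := by
  rw [ext, dif_pos w.2]

lemma ext_zero (c : RotChart X u) : c.ext 0 = c.center :=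
  c.ext_coe ⟨0, mem_ball_self c.radius_pos⟩

lemma continuousOn_ext (c : RotChart X u) : ContinuousOn c.ext (ball 0 c.radius) := by
  rw [continuousOn_iff_continuous_domRestrict]
  exact c.isOpenEmbedding.continuous.congr fun w => (c.ext_coe w).symm

lemma ext_injOn (c : RotChart X u) : InjOn c.ext (ball 0 c.radius) := fun z hz z' hz' h => by
  have h1 := (c.ext_coe ⟨z, hz⟩).symm.trans (h.trans (c.ext_coe ⟨z', hz'⟩))
  exact congrArg Subtype.val (c.isOpenEmbedding.injective h1)

lemma act_ext (c : RotChart X u) {z : ℂ} (hz : ‖z‖ < c.radius) :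
    X.act (c.ext z) = c.ext (ZMod.toCircle u * z) := by
  have hz' : ‖(ZMod.toCircle u : ℂ) * z‖ < c.radius := by rwa [norm_mul, Circle.norm_coe, one_mul]
  rw [c.ext_coe ⟨z, mem_ball_zero_iff.2 hz⟩, c.ext_coe ⟨_, mem_ball_zero_iff.2 hz'⟩]
  exact c.act_toFun _ _ rfl

lemma iterate_act_ext (c : RotChart X u) (n : ℕ) {z : ℂ} (hz : ‖z‖ < c.radius) :
    X.act^[n] (c.ext z) = c.ext (ZMod.toCircle ((n : ZMod p) * u) * z) := by
  induction n with
  | zero => simp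
  | succ n ih =>
    have hz' : ‖(ZMod.toCircle ((n : ZMod p) * u) : ℂ) * z‖ < c.radius := by
      rwa [norm_mul, Circle.norm_coe, one_mul]
    rw [Function.iterate_succ_apply', ih, c.act_ext hz', ← mul_assoc, ← Circle.coe_mul,
      ← AddChar.map_add_eq_mul]
    congr 4
    push_cast
    ring

open Classical in
/-- The inverse of the chart. -/
noncomputable def inv (c : RotChart X u) (x : X.carrier) : ℂ :=
  if h : ∃ w, c.toFun w = x then h.choose else 0

lemma inv_toFun (c : RotChart X u) (w : ball (0 : ℂ) c.radius) : c.inv (c.toFun w) = w := by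
  have h : ∃ w', c.toFun w' = c.toFun w := ⟨w, rfl⟩
  rw [inv, dif_pos h, c.isOpenEmbedding.injective h.choose_spec]

lemma ext_inv (c : RotChart X u) {x : X.carrier} (hx : x ∈ range c.toFun) :
    c.ext (c.inv x) = x := by
  obtain ⟨w, rfl⟩ := hx
  rw [inv_toFun, ext_coe]

lemma inv_ext (c : RotChart X u) {z : ℂ} (hz : ‖z‖ < c.radius) : c.inv (c.ext z) = z := by
  rw [c.ext_coe ⟨z, mem_ball_zero_iff.2 hz⟩, inv_toFun]

lemma norm_inv_lt (c : RotChart X u) {x : X.carrier} (hx : x ∈ range c.toFun) :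
    ‖c.inv x‖ < c.radius := by
  obtain ⟨w, rfl⟩ := hx
  rw [inv_toFun]
  exact mem_ball_zero_iff.1 w.2

lemma continuousOn_inv (c : RotChart X u) : ContinuousOn c.inv (range c.toFun) := by
  rintro _ ⟨w, rfl⟩
  refine ContinuousAt.continuousWithinAt ?_
  rw [ContinuousAt, ← c.isOpenEmbedding.map_nhds_eq, tendsto_map'_iff, inv_toFun]
  have h : c.inv ∘ c.toFun = Subtype.val := funext c.inv_toFun
  rw [h]
  exact continuous_subtype_val.continuousAt

/-- The degree of a circle-valued function at the centre of a chart. -/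
def HasDeg (c : RotChart X u) (f : X.carrier → Circle) (n : ℤ) : Prop :=
  PunctDeg (fun z => f (c.ext z)) n

/-- A homeomorphism, expressed in charts. -/
noncomputable def transition (c : RotChart X u) (c' : RotChart Y v) (e : X.carrier ≃ₜ Y.carrier)
    (z : ℂ) : ℂ := c'.inv (e (c.ext z))

lemma transition_zero (c : RotChart X u) (c' : RotChart Y v) {e : X.carrier ≃ₜ Y.carrier}
    (he : e c.center = c'.center) : c.transition c' e 0 = 0 := by
  rw [transition, ext_zero, he, ← c'.ext_zero, c'.inv_ext (by simpa using c'.radius_pos)]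

/-- Near the centre, a homeomorphism is expressed in charts as a continuous map that vanishes only
at `0`. -/
lemma exists_transition (c : RotChart X u) (c' : RotChart Y v) {e : X.carrier ≃ₜ Y.carrier}
    (he : e c.center = c'.center) : ∃ ρ > 0, ρ ≤ c.radius ∧
      (∀ z, ‖z‖ < ρ → e (c.ext z) ∈ range c'.toFun) ∧
      ContinuousOn (c.transition c' e) (ball 0 ρ) ∧
      ∀ z, z ≠ 0 → ‖z‖ < ρ → c.transition c' e z ≠ 0 := by
  have hca : ContinuousAt (fun z => e (c.ext z)) 0 :=
    e.continuous.continuousAt.comp (c.continuousOn_ext.continuousAt (ball_mem_nhds 0 c.radius_pos))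
  have hev : ∀ᶠ z in 𝓝 (0 : ℂ), e (c.ext z) ∈ range c'.toFun := by
    refine hca.eventually (c'.isOpenEmbedding.isOpen_range.mem_nhds ?_)
    simp only [ext_zero, he]
    exact ⟨_, rfl⟩
  obtain ⟨ρ, hρ, hb⟩ := Metric.eventually_nhds_iff_ball.1 hev
  have hb' : ∀ z, ‖z‖ < min ρ c.radius → e (c.ext z) ∈ range c'.toFun := fun z hz =>
    hb z (mem_ball_zero_iff.2 (hz.trans_le (min_le_left _ _)))
  refine ⟨min ρ c.radius, lt_min hρ c.radius_pos, min_le_right _ _, hb', ?_,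
    fun z h0 h1 h2 => h0 ?_⟩
  · refine c'.continuousOn_inv.comp (e.continuous.comp_continuousOn
      (c.continuousOn_ext.mono (ball_subset_ball (min_le_right _ _)))) fun z hz => ?_
    exact hb' z (mem_ball_zero_iff.1 hz)
  · have h3 := c'.ext_inv (hb' z h1)
    rw [transition] at h2
    rw [h2, ext_zero, ← he] at h3
    refine c.ext_injOn (mem_ball_zero_iff.2 (h1.trans_le (min_le_right _ _)))
      (mem_ball_self c.radius_pos) ?_
    rw [ext_zero]
    exact (e.injective h3).symm

/-- A homeomorphism multiplies degrees by a sign which depends only on the point. If it intertwines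
the generator with its `a`-th power, then this sign relates the rotation angles. -/
lemma exists_sign (c : RotChart X u) (c' : RotChart Y v) {e : X.carrier ≃ₜ Y.carrier}
    (he : e c.center = c'.center) {a : ℕ} (ha : ∀ x, e (X.act x) = Y.act^[a] (e x)) :
    ∃ ε : ℤ, (ε = 1 ∨ ε = -1) ∧ (ε : ZMod p) * u = a * v ∧
      ∀ (f : Y.carrier → Circle) (n : ℤ), c'.HasDeg f n → c.HasDeg (fun x => f (e x)) (ε * n) := by
  have he' : e.symm c'.center = c.center := by rw [← he, e.symm_apply_apply]
  obtain ⟨ρ, hρ, hρc, hr, hc, hne⟩ := c.exists_transition c' he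
  obtain ⟨ρ', hρ', hρc', hr', hc', hne'⟩ := c'.exists_transition c he'
  set t := c.transition c' e with ht
  set s := c'.transition c e.symm with hs
  have ht0 : t 0 = 0 := c.transition_zero c' he
  have hs0 : s 0 = 0 := c'.transition_zero c he'
  have hdirt : ContinuousOn (fun z => dir (t z)) (ball 0 ρ \ {0}) :=
    continuousOn_dir.comp (hc.mono sdiff_subset) fun z hz => hne z hz.2 (mem_ball_zero_iff.1 hz.1)
  have hdirs : ContinuousOn (fun z => dir (s z)) (ball 0 ρ' \ {0}) :=
    continuousOn_dir.comp (hc'.mono sdiff_subset) fun z hz => hne' z hz.2 (mem_ball_zero_iff.1 hz.1)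
  obtain ⟨m, hm, -⟩ := exists_punctDeg hρ hdirt
  obtain ⟨m', hm', -⟩ := exists_punctDeg hρ' hdirs
  -- `t` and `s` are inverse to each other near `0`
  have hst : ∀ᶠ z in 𝓝 (0 : ℂ), ‖s z‖ < ρ := by
    have := (hc'.continuousAt (ball_mem_nhds 0 hρ')).eventually
      (p := fun z => z ∈ ball (0 : ℂ) ρ) (by rw [hs0]; exact ball_mem_nhds 0 hρ)
    simpa only [mem_ball_zero_iff] using this
  obtain ⟨δ, hδ, hδb⟩ := Metric.eventually_nhds_iff_ball.1 hst
  have hid : ∀ z, z ≠ 0 → ‖z‖ < min δ ρ' → dir z = dir (t (s z)) := fun z _ hz => by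
    have h1 : ‖z‖ < ρ' := hz.trans_le (min_le_right _ _)
    have h2 : c.ext (s z) = e.symm (c'.ext z) := c.ext_inv (hr' z h1)
    rw [ht, transition, h2, e.apply_symm_apply, c'.inv_ext (h1.trans_le hρc')]
  have h1 : PunctDeg dir 1 := ⟨1, one_pos, 0, continuousOn_const, fun z _ _ => by simp⟩
  have hmm : m' * m = 1 :=
    ((hm.comp hm' hρ' hc' hs0 hne').congr (lt_min hδ hρ') hid).unique h1
  have hsign : m = 1 ∨ m = -1 := Int.isUnit_iff.1 (IsUnit.of_mul_eq_one_right _ hmm)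
  refine ⟨m, hsign, ?_, fun f n hf => ?_⟩
  · obtain ⟨ρ₁, hρ₁, φ, hφ, hmφ⟩ := hm
    set r := min ρ ρ₁ / 2 with hrdef
    have hr0 : 0 < r := by positivity
    have hrρ : r < ρ := by have := min_le_left ρ ρ₁; linarith
    have hrρ₁ : r < ρ₁ := by have := min_le_right ρ ρ₁; linarith
    have hrot : ∀ z, ‖z‖ < ρ → t (ZMod.toCircle u * z) = ZMod.toCircle ((a : ZMod p) * v) * t z :=
        fun z hz => by
      have h2 : ‖t z‖ < c'.radius := c'.norm_inv_lt (hr z hz)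
      have h3 : c'.ext (t z) = e (c.ext z) := c'.ext_inv (hr z hz)
      rw [ht, transition, ← c.act_ext (hz.trans_le hρc), ha, ← h3, c'.iterate_act_ext a h2,
        c'.inv_ext]
      rwa [norm_mul, Circle.norm_coe, one_mul]
    have hdirmul : ∀ (ω : Circle) (z : ℂ), z ≠ 0 → dir (ω * z) = ω * dir z := fun ω z hz => by
      rw [dir_mul (Circle.coe_ne_zero _) hz, dir_circle]
    have hsph : ∀ z ∈ sphere (0 : ℂ) r, z ≠ 0 ∧ ‖z‖ < ρ ∧ ‖z‖ < ρ₁ := fun z hz => by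
      rw [mem_sphere_zero_iff_norm] at hz
      exact ⟨norm_pos_iff.1 (by rwa [hz]), by rwa [hz], by rwa [hz]⟩
    have hrotS : ∀ (ω : Circle), ∀ z ∈ sphere (0 : ℂ) r, (ω : ℂ) * z ∈ sphere (0 : ℂ) r :=
        fun ω z hz => by
      rw [mem_sphere_zero_iff_norm] at hz ⊢
      rwa [norm_mul, Circle.norm_coe, one_mul]
    have hφS : ContinuousOn φ (sphere 0 r) := hφ.mono fun z hz =>
      ⟨mem_ball_zero_iff.2 (hsph z hz).2.2, (hsph z hz).1⟩
    -- with `dir (t z) = dir z ^ m * exp (φ z)`, a rotation of `z` changes `φ` by a constant `κ'`, a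
    -- logarithm of `exp κ = ζ ^ (a v - m u)`; after `p` rotations this shows that `κ' = 0`
    obtain ⟨κ, hκ⟩ :=
      Circle.exp_surjective (ZMod.toCircle ((a : ZMod p) * v) / ZMod.toCircle u ^ m)
    have hE : ∀ z ∈ sphere (0 : ℂ) r,
        Circle.exp (φ (ZMod.toCircle u * z)) = Circle.exp (φ z + κ) := fun z hz => by
      obtain ⟨h0, h2, h3⟩ := hsph z hz
      obtain ⟨h0', h2', h3'⟩ := hsph _ (hrotS (ZMod.toCircle u) z hz)
      have e1 := hmφ _ h0' h3'
      have e2 := hmφ z h0 h3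
      simp only at e1 e2
      rw [hrot z h2, hdirmul _ _ (hne z h0 h2), hdirmul _ _ h0, e2, mul_zpow] at e1
      rw [Circle.exp_add, hκ]
      have e3 : Circle.exp (φ (ZMod.toCircle u * z)) = (ZMod.toCircle u ^ m * dir z ^ m)⁻¹ *
          (ZMod.toCircle ((a : ZMod p) * v) * (dir z ^ m * Circle.exp (φ z))) := by
        rw [e1, inv_mul_cancel_left]
      have e4 : ∀ A B C E : Circle, (A * B)⁻¹ * (C * (B * E)) = E * (C / A) := fun A B C E => by
        rw [mul_left_comm C B E, mul_inv_rev, mul_comm B⁻¹, mul_assoc, inv_mul_cancel_left,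
          div_eq_mul_inv, mul_comm C E, mul_left_comm, mul_comm A⁻¹]
      rw [e3, e4]
    have hconn : IsPreconnected (sphere (0 : ℂ) r) :=
      isPreconnected_sphere (by rw [Complex.rank_real_complex]; exact Nat.one_lt_ofNat) 0 r
    set z₀ : ℂ := (r : ℂ) with hz₀
    have hz₀S : z₀ ∈ sphere (0 : ℂ) r := by simp [hz₀, abs_of_pos hr0]
    set κ' : ℝ := φ (ZMod.toCircle u * z₀) - φ z₀ with hκ'
    have hconst : ∀ z ∈ sphere (0 : ℂ) r, φ (ZMod.toCircle u * z) = φ z + κ' := fun z hz => by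
      have := sub_eq_sub_of_exp_eq hconn
        (hφS.comp (by fun_prop) (hrotS (ZMod.toCircle u))) (hφS.add continuousOn_const) hE hz hz₀S
      simp only [Function.comp, Pi.add_apply] at this
      linarith
    have hiter : ∀ n : ℕ, φ (ZMod.toCircle ((n : ZMod p) * u) * z₀) = φ z₀ + n * κ' := fun n => by
      induction n with
      | zero => simp
      | succ n ih =>
        have := hconst _ (hrotS (ZMod.toCircle ((n : ZMod p) * u)) z₀ hz₀S)
        rw [ih, ← mul_assoc, ← Circle.coe_mul, ← AddChar.map_add_eq_mul] at this
        rw [show ((n + 1 : ℕ) : ZMod p) * u = u + n * u by push_cast; ring, this]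
        push_cast
        ring
    have hκ0 : κ' = 0 := by
      have := hiter p
      simp only [CharP.cast_eq_zero, zero_mul, AddChar.map_zero_eq_one, Circle.coe_one,
        one_mul] at this
      have hp0 : (p : ℝ) ≠ 0 := by exact_mod_cast NeZero.ne p
      have h2 : (p : ℝ) * κ' = 0 := by linarith
      exact (mul_eq_zero.1 h2).resolve_left hp0
    have h4 := hE z₀ hz₀S
    rw [hconst z₀ hz₀S, hκ0, add_zero, Circle.exp_add, hκ, left_eq_mul, div_eq_one] at h4
    refine (ZMod.injective_toCircle ?_).symm
    rw [h4, ← AddChar.map_zsmul_eq_zpow, zsmul_eq_mul]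
  · refine (PunctDeg.comp hf hm hρ hc ht0 hne).congr hρ fun z _ hz => ?_
    exact congrArg f (c'.ext_inv (hr z hz)).symm

end RotChart

/-! ### Gluing -/

namespace CpSpace

lemma glue_inl_ne_inr {X Y : Type} {r : X → Y → Prop} {x : X} (hx : ∀ y, ¬ r x y) {y : Y} :
    Quot.mk (GlueRel r) (Sum.inl x) ≠ Quot.mk (GlueRel r) (Sum.inr y) := by
  intro h
  let P : Quot (GlueRel r) → Prop := Quot.lift (Sum.elim (fun t => t = x) fun _ => False) (by
    rintro _ _ ⟨h'⟩
    refine propext ⟨?_, False.elim⟩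
    rintro rfl
    exact hx _ h')
  have h1 : P (Quot.mk _ (Sum.inl x)) := rfl
  rw [h] at h1
  exact h1

lemma glue_inr_ne_inl {X Y : Type} {r : X → Y → Prop} {y : Y} (hy : ∀ x, ¬ r x y) {x : X} :
    Quot.mk (GlueRel r) (Sum.inr y) ≠ Quot.mk (GlueRel r) (Sum.inl x) := by
  intro h
  let P : Quot (GlueRel r) → Prop := Quot.lift (Sum.elim (fun _ => False) fun t => t = y) (by
    rintro _ _ ⟨h'⟩
    refine propext ⟨False.elim, ?_⟩
    rintro rfl
    exact hy _ h')
  have h1 : P (Quot.mk _ (Sum.inr y)) := rfl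
  rw [h] at h1
  exact h1

end CpSpace

namespace RotChart

variable [NeZero p] {X Y : CpSpace p} {u : ZMod p}

/-- A chart with values in an invariant subspace. -/
def restrict (c : RotChart X u) (A : Set X.carrier) (hA : ∀ x ∈ A, X.act x ∈ A)
    (h : ∀ w, c.toFun w ∈ A) : RotChart (X.restrict A hA) u where
  radius := c.radius
  radius_pos := c.radius_pos
  toFun w := ⟨c.toFun w, h w⟩
  isOpenEmbedding := by
    refine ⟨c.isOpenEmbedding.isEmbedding.codRestrict A h, ?_⟩
    refine isOpen_induced_iff.2 ⟨_, c.isOpenEmbedding.isOpen_range, ?_⟩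
    ext x
    constructor
    · rintro ⟨w, hw⟩
      exact ⟨w, Subtype.ext hw⟩
    · rintro ⟨w, rfl⟩
      exact ⟨w, rfl⟩
  act_toFun w w' h := Subtype.ext (c.act_toFun w w' h)

variable {r : X.carrier → Y.carrier → Prop} {hr : ∀ x y, r x y → r (X.act x) (Y.act y)}

/-- A chart of `X` away from the glued points, in the space obtained by gluing `X` and `Y`. -/
def glueInl (c : RotChart X u) (h : ∀ w y, ¬ r (c.toFun w) y) : RotChart (X.glue Y r hr) u where
  radius := c.radius
  radius_pos := c.radius_pos
  toFun w := Quot.mk _ (Sum.inl (c.toFun w))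
  isOpenEmbedding := by
    refine IsOpenEmbedding.of_continuous_injective_isOpenMap ?_ ?_ ?_
    · exact continuous_quot_mk.comp (continuous_inl.comp c.isOpenEmbedding.continuous)
    · intro w w' hw
      exact c.isOpenEmbedding.injective (CpSpace.glue_mk_eq_inl (h w') hw)
    · intro U hU
      refine isOpen_coinduced.2 (isOpen_sum_iff.2 ⟨?_, ?_⟩)
      · convert c.isOpenEmbedding.isOpenMap U hU using 1
        ext x
        constructor
        · rintro ⟨w, hw, hx⟩
          exact ⟨w, hw, (CpSpace.glue_mk_eq_inl (h w) hx.symm).symm⟩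
        · rintro ⟨w, hw, rfl⟩
          exact ⟨w, hw, rfl⟩
      · convert isOpen_empty
        ext y
        simp only [mem_preimage, mem_empty_iff_false, iff_false]
        rintro ⟨w, -, hy⟩
        exact CpSpace.glue_inl_ne_inr (h w) hy
  act_toFun w w' h := congrArg (fun t => Quot.mk _ (Sum.inl t)) (c.act_toFun w w' h)

/-- A chart of `Y` away from the glued points, in the space obtained by gluing `X` and `Y`. -/
def glueInr (c : RotChart Y u) (h : ∀ w x, ¬ r x (c.toFun w)) : RotChart (X.glue Y r hr) u where
  radius := c.radius
  radius_pos := c.radius_pos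
  toFun w := Quot.mk _ (Sum.inr (c.toFun w))
  isOpenEmbedding := by
    refine IsOpenEmbedding.of_continuous_injective_isOpenMap ?_ ?_ ?_
    · exact continuous_quot_mk.comp (continuous_inr.comp c.isOpenEmbedding.continuous)
    · intro w w' hw
      exact c.isOpenEmbedding.injective (CpSpace.glue_mk_eq_inr (h w') hw)
    · intro U hU
      refine isOpen_coinduced.2 (isOpen_sum_iff.2 ⟨?_, ?_⟩)
      · convert isOpen_empty
        ext x
        simp only [mem_preimage, mem_empty_iff_false, iff_false]
        rintro ⟨w, -, hx⟩
        exact CpSpace.glue_inr_ne_inl (h w) hx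
      · convert c.isOpenEmbedding.isOpenMap U hU using 1
        ext y
        constructor
        · rintro ⟨w, hw, hy⟩
          exact ⟨w, hw, (CpSpace.glue_mk_eq_inr (h w) hy.symm).symm⟩
        · rintro ⟨w, hw, rfl⟩
          exact ⟨w, hw, rfl⟩
  act_toFun w w' h := congrArg (fun t => Quot.mk _ (Sum.inr t)) (c.act_toFun w w' h)

/-- The degree can be computed from the values in the disk of the chart. -/
lemma HasDeg.of_comp {Z : CpSpace p} {v : ZMod p} {c : RotChart X u} {f : X.carrier → Circle}
    {n : ℤ} (h : c.HasDeg f n) {c' : RotChart Z v} {f' : Z.carrier → Circle}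
    (hrad : c'.radius = c.radius)
    (hf : ∀ w (hw : w ∈ ball (0 : ℂ) c.radius),
      f' (c'.toFun ⟨w, by rwa [hrad]⟩) = f (c.toFun ⟨w, hw⟩)) :
    c'.HasDeg f' n := by
  refine PunctDeg.congr h c.radius_pos fun z _ hz => ?_
  have hz' : z ∈ ball (0 : ℂ) c.radius := mem_ball_zero_iff.2 hz
  have hz'' : z ∈ ball (0 : ℂ) c'.radius := by rwa [hrad]
  have e1 := c.ext_coe ⟨z, hz'⟩
  have e2 := c'.ext_coe ⟨z, hz''⟩
  simp only at e1 e2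
  rw [e1, e2, hf z hz']

end RotChart

namespace CpSpace

variable {X Y : CpSpace p} {r : X.carrier → Y.carrier → Prop}
  {hr : ∀ x y, r x y → r (X.act x) (Y.act y)}

lemma restrict_fixedSet (A : Set X.carrier) (hA : ∀ x ∈ A, X.act x ∈ A) :
    (X.restrict A hA).fixedSet = Subtype.val ⁻¹' X.fixedSet := by
  ext x
  exact Subtype.ext_iff

lemma encard_restrict_fixedSet (A : Set X.carrier) (hA : ∀ x ∈ A, X.act x ∈ A) :
    (X.restrict A hA).fixedSet.encard = (A ∩ X.fixedSet).encard := by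
  rw [restrict_fixedSet]
  refine (Subtype.val_injective.encard_image _).symm.trans (congrArg _ ?_)
  exact Subtype.image_preimage_coe A X.fixedSet

lemma eq_or_rel_of_glue_mk_eq (h₁ : ∀ x x' y, r x y → r x' y → x = x') {x : X.carrier}
    {z : X.carrier ⊕ Y.carrier}
    (h : Quot.mk (GlueRel r) (Sum.inl x) = Quot.mk (GlueRel r) z) :
    Sum.elim (fun x' => x' = x) (fun y => r x y) z := by
  let P : Quot (GlueRel r) → Prop := Quot.lift
    (Sum.elim (fun x' => x' = x) fun y => r x y) (by
    rintro _ _ ⟨h'⟩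
    refine propext ⟨?_, fun h'' => h₁ _ _ _ h' h''⟩
    rintro rfl
    exact h')
  have h1 : P (Quot.mk _ (Sum.inl x)) := rfl
  rw [h] at h1
  exact h1

lemma glue_inl_injective (h₁ : ∀ x x' y, r x y → r x' y → x = x') :
    Function.Injective fun x : X.carrier => Quot.mk (GlueRel r) (Sum.inl x) := fun _ _ h =>
  (eq_or_rel_of_glue_mk_eq h₁ h).symm

lemma rel_of_glue_inl_eq_inr (h₁ : ∀ x x' y, r x y → r x' y → x = x') {x : X.carrier}
    {y : Y.carrier} (h : Quot.mk (GlueRel r) (Sum.inl x) = Quot.mk (GlueRel r) (Sum.inr y)) :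
    r x y := eq_or_rel_of_glue_mk_eq h₁ h

lemma glue_inr_injective (h₂ : ∀ x y y', r x y → r x y' → y = y') :
    Function.Injective fun y : Y.carrier => Quot.mk (GlueRel r) (Sum.inr y) := by
  intro y y' h
  let P : Quot (GlueRel r) → Prop := Quot.lift
    (Sum.elim (fun x => r x y) fun y' => y = y') (by
    rintro _ _ ⟨h'⟩
    refine propext ⟨fun h'' => h₂ _ _ _ h'' h', ?_⟩
    rintro rfl
    exact h')
  have h1 : P (Quot.mk _ (Sum.inr y)) := rfl
  rw [show Quot.mk (GlueRel r) (Sum.inr y) = Quot.mk (GlueRel r) (Sum.inr y') from h] at h1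
  exact h1

lemma glue_fixedSet (h₁ : ∀ x x' y, r x y → r x' y → x = x')
    (h₂ : ∀ x y y', r x y → r x y' → y = y') :
    (X.glue Y r hr).fixedSet = (fun x => Quot.mk (GlueRel r) (Sum.inl x)) '' X.fixedSet ∪
      (fun y => Quot.mk (GlueRel r) (Sum.inr y)) '' Y.fixedSet := by
  ext z
  constructor
  · intro hz
    obtain ⟨x | y, rfl⟩ := Quot.exists_rep z
    · exact Or.inl ⟨x, glue_inl_injective h₁ hz, rfl⟩
    · exact Or.inr ⟨y, glue_inr_injective h₂ hz, rfl⟩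
  · rintro (⟨x, hx, rfl⟩ | ⟨y, hy, rfl⟩)
    · exact congrArg (fun t => Quot.mk (GlueRel r) (Sum.inl t)) hx
    · exact congrArg (fun t => Quot.mk (GlueRel r) (Sum.inr t)) hy

lemma encard_glue_fixedSet (h₁ : ∀ x x' y, r x y → r x' y → x = x')
    (h₂ : ∀ x y y', r x y → r x y' → y = y') (h₀ : ∀ x y, r x y → x ∉ X.fixedSet) :
    (X.glue Y r hr).fixedSet.encard = X.fixedSet.encard + Y.fixedSet.encard := by
  refine (congrArg Set.encard (glue_fixedSet h₁ h₂)).trans ((encard_union_eq ?_).trans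
    (congrArg₂ _ ((glue_inl_injective h₁).encard_image _) ((glue_inr_injective h₂).encard_image _)))
  refine Set.disjoint_left.2 ?_
  rintro _ ⟨x, hx, rfl⟩ ⟨y, -, hy⟩
  exact h₀ x y (rel_of_glue_inl_eq_inr h₁ hy.symm) hx

lemma isOpen_glue {Z : Set (X.glue Y r hr).carrier}
    (h₁ : IsOpen ((fun x => (Quot.mk _ (Sum.inl x) : (X.glue Y r hr).carrier)) ⁻¹' Z))
    (h₂ : IsOpen ((fun y => (Quot.mk _ (Sum.inr y) : (X.glue Y r hr).carrier)) ⁻¹' Z)) : IsOpen Z :=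
  isOpen_coinduced.2 (isOpen_sum_iff.2 ⟨h₁, h₂⟩)

lemma continuousOn_glue {T : Type*} [TopologicalSpace T] {f : (X.glue Y r hr).carrier → T}
    {Z : Set (X.glue Y r hr).carrier}
    (h₁ : IsOpen ((fun x => (Quot.mk _ (Sum.inl x) : (X.glue Y r hr).carrier)) ⁻¹' Z))
    (h₂ : IsOpen ((fun y => (Quot.mk _ (Sum.inr y) : (X.glue Y r hr).carrier)) ⁻¹' Z))
    (hf₁ : ContinuousOn (fun x => f (Quot.mk _ (Sum.inl x)))
      ((fun x => (Quot.mk _ (Sum.inl x) : (X.glue Y r hr).carrier)) ⁻¹' Z))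
    (hf₂ : ContinuousOn (fun y => f (Quot.mk _ (Sum.inr y)))
      ((fun y => (Quot.mk _ (Sum.inr y) : (X.glue Y r hr).carrier)) ⁻¹' Z)) : ContinuousOn f Z := by
  refine (continuousOn_open_iff (isOpen_glue h₁ h₂)).2 fun V hV => ?_
  exact isOpen_glue (hf₁.isOpen_inter_preimage h₁ hV) (hf₂.isOpen_inter_preimage h₂ hV)

end CpSpace

/-! ### Gluing along conjugate disks -/

namespace ConjDisk

variable {X Y : CpSpace p} (D : ConjDisk X) (E : ConjDisk Y)

/-- The union of the disk and its conjugates. -/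
def conj : Set X.carrier := {x | ∃ (k : ℕ) (w : UnitDisk), X.act^[k] (D.toFun w) = x}

lemma mem_compl_of_notMem_conj {x : X.carrier} (hx : x ∉ D.conj) (k : ℕ) (w : UnitDisk)
    (_ : ‖(w : ℂ)‖ < 1) : X.act^[k] (D.toFun w) ≠ x := fun h => hx ⟨k, w, h⟩

lemma iterate_act_mod (X : CpSpace p) (k : ℕ) (x : X.carrier) : X.act^[k % p] x = X.act^[k] x := by
  conv_rhs => rw [← Nat.mod_add_div k p, Function.iterate_add_apply, Function.iterate_mul]
  congr 1
  exact (Function.iterate_fixed (X.iterate_act x) _).symm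

variable [NeZero p]

lemma iterate_act_inj (X : CpSpace p) (k : ℕ) {x y : X.carrier} (h : X.act^[k] x = X.act^[k] y) :
    x = y := X.act_injective.iterate k h

/-- The parameters of a point in the conjugates of a disk are unique. -/
lemma param_unique {k l : ℕ} {v w : UnitDisk} (h : X.act^[k] (D.toFun v) = X.act^[l] (D.toFun w)) :
    k ≡ l [MOD p] ∧ v = w := by
  have hp := NeZero.pos p
  have h1 : X.act^[(k + (p - l % p)) % p] (D.toFun v) = D.toFun w := by
    refine iterate_act_inj X l ?_
    have h2 := Nat.mod_lt l hp
    rw [← h, ← Function.iterate_add_apply, ← iterate_act_mod X (l + _), ← iterate_act_mod X k]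
    congr 1
    rw [Nat.add_mod_mod, ← Nat.mod_add_mod, ← Nat.add_assoc,
      show l % p + k + (p - l % p) = k + p by omega, Nat.add_mod_right]
  obtain ⟨h2, h3⟩ := D.inj_disjoint _ (Nat.mod_lt _ hp) v w h1
  refine ⟨?_, h3⟩
  have h4 := Nat.mod_lt l hp
  have h5 : k + (p - l % p) ≡ 0 [MOD p] := h2
  have h6 := h5.add_right (l % p)
  rw [show k + (p - l % p) + l % p = k + p by omega, Nat.zero_add] at h6
  have h7 : k ≡ k + p [MOD p] := (Nat.add_mod_right k p).symm
  exact (h7.trans h6).trans (Nat.mod_modEq l p)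

lemma rel_left_unique {x x' : D.compl.carrier} {y : E.compl.carrier}
    (h : ∃ (k : ℕ) (w : UnitDisk), ‖(w : ℂ)‖ = 1 ∧
      X.act^[k] (D.toFun w) = x.1 ∧ Y.act^[k] (E.toFun w) = y.1)
    (h' : ∃ (k : ℕ) (w : UnitDisk), ‖(w : ℂ)‖ = 1 ∧
      X.act^[k] (D.toFun w) = x'.1 ∧ Y.act^[k] (E.toFun w) = y.1) : x = x' := by
  obtain ⟨k, w, -, hx, hy⟩ := h
  obtain ⟨l, v, -, hx', hy'⟩ := h'
  obtain ⟨h1, rfl⟩ := E.param_unique (hy.trans hy'.symm)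
  refine Subtype.ext ?_
  rw [← hx, ← hx', ← iterate_act_mod X k, ← iterate_act_mod X l, h1]

lemma rel_right_unique {x : D.compl.carrier} {y y' : E.compl.carrier}
    (h : ∃ (k : ℕ) (w : UnitDisk), ‖(w : ℂ)‖ = 1 ∧
      X.act^[k] (D.toFun w) = x.1 ∧ Y.act^[k] (E.toFun w) = y.1)
    (h' : ∃ (k : ℕ) (w : UnitDisk), ‖(w : ℂ)‖ = 1 ∧
      X.act^[k] (D.toFun w) = x.1 ∧ Y.act^[k] (E.toFun w) = y'.1) : y = y' := by
  obtain ⟨k, w, -, hx, hy⟩ := h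
  obtain ⟨l, v, -, hx', hy'⟩ := h'
  obtain ⟨h1, rfl⟩ := D.param_unique (hx.trans hx'.symm)
  refine Subtype.ext ?_
  rw [← hy, ← hy', ← iterate_act_mod Y k, ← iterate_act_mod Y l, h1]

lemma inl_injective : Function.Injective (D.inl E) :=
  CpSpace.glue_inl_injective fun _ _ _ => D.rel_left_unique E

lemma inr_injective : Function.Injective (D.inr E) :=
  CpSpace.glue_inr_injective fun _ _ _ => D.rel_right_unique E

/-- A fixed point in a conjugate of the disk would also be in the next conjugate. -/
lemma disjoint_fixedSet [Fact p.Prime] {x : X.carrier} (hx : x ∈ X.fixedSet) : x ∉ D.conj := by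
  rintro ⟨k, w, rfl⟩
  have h1 : X.act^[k + 1] (D.toFun w) = X.act^[k] (D.toFun w) := by
    rw [Function.iterate_succ_apply']
    exact hx
  have h2 := (D.param_unique h1).1
  have h3 : 1 ≡ 0 [MOD p] := Nat.ModEq.add_left_cancel' k h2
  have h4 : p ∣ 1 := (Nat.modEq_zero_iff_dvd).1 h3
  exact (Fact.out : p.Prime).one_lt.ne' (Nat.dvd_one.1 h4)

lemma encard_compl_fixedSet [Fact p.Prime] : D.compl.fixedSet.encard = X.fixedSet.encard := by
  refine (CpSpace.encard_restrict_fixedSet _ _).trans (congrArg _ (inter_eq_right.2 ?_))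
  intro x hx k w _ h
  exact D.disjoint_fixedSet hx ⟨k, w, h⟩

lemma glue_fixedSet : (D.glue E).fixedSet
    = D.inl E '' D.compl.fixedSet ∪ D.inr E '' E.compl.fixedSet :=
  CpSpace.glue_fixedSet (fun _ _ _ => D.rel_left_unique E) fun _ _ _ => D.rel_right_unique E

lemma encard_glue_fixedSet [Fact p.Prime] :
    (D.glue E).fixedSet.encard = X.fixedSet.encard + Y.fixedSet.encard := by
  rw [← D.encard_compl_fixedSet, ← E.encard_compl_fixedSet]
  refine CpSpace.encard_glue_fixedSet (fun _ _ _ => D.rel_left_unique E)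
    (fun _ _ _ => D.rel_right_unique E) ?_
  rintro x y ⟨k, w, -, hx, -⟩ hxf
  exact D.disjoint_fixedSet (congrArg Subtype.val hxf) ⟨k, w, hx⟩

/-- A chart of `X` away from the removed disks, in the glued space. -/
def chartInl {u : ZMod p} (c : RotChart X u) (h : ∀ w, c.toFun w ∉ D.conj) :
    RotChart (D.glue E) u :=
  RotChart.glueInl (X := D.compl) (Y := E.compl)
    (c.restrict _ _ fun w => D.mem_compl_of_notMem_conj (h w)) (by
      rintro w y ⟨k, v, -, hx, -⟩
      exact h w ⟨k, v, hx⟩)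

/-- A chart of `Y` away from the removed disks, in the glued space. -/
def chartInr {u : ZMod p} (c : RotChart Y u) (h : ∀ w, c.toFun w ∉ E.conj) :
    RotChart (D.glue E) u :=
  RotChart.glueInr (X := D.compl) (Y := E.compl)
    (c.restrict _ _ fun w => E.mem_compl_of_notMem_conj (h w)) (by
      rintro w x ⟨k, v, -, -, hy⟩
      exact h w ⟨k, v, hy⟩)

end ConjDisk

/-! ### Gluing along invariant disks -/

namespace FixedDisk

variable [NeZero p] {X Y : CpSpace p} {u : (ZMod p)ˣ} (D : FixedDisk X u) (E : FixedDisk Y u)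

/-- The inclusion of `X` minus the removed disk into the glued space. -/
def inl : D.compl.carrier → (D.glue E).carrier := fun x => Quot.mk _ (Sum.inl x)

/-- The inclusion of `Y` minus the removed disk into the glued space. -/
def inr : E.compl.carrier → (D.glue E).carrier := fun y => Quot.mk _ (Sum.inr y)

lemma rel_left_unique {x x' : D.compl.carrier} {y : E.compl.carrier}
    (h : ∃ w : UnitDisk, ‖(w : ℂ)‖ = 1 ∧ D.toFun w = x.1 ∧ E.toFun w = y.1)
    (h' : ∃ w : UnitDisk, ‖(w : ℂ)‖ = 1 ∧ D.toFun w = x'.1 ∧ E.toFun w = y.1) : x = x' := by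
  obtain ⟨w, -, hx, hy⟩ := h
  obtain ⟨v, -, hx', hy'⟩ := h'
  rw [E.injective_toFun (hy.trans hy'.symm)] at hx
  exact Subtype.ext (hx.symm.trans hx')

lemma rel_right_unique {x : D.compl.carrier} {y y' : E.compl.carrier}
    (h : ∃ w : UnitDisk, ‖(w : ℂ)‖ = 1 ∧ D.toFun w = x.1 ∧ E.toFun w = y.1)
    (h' : ∃ w : UnitDisk, ‖(w : ℂ)‖ = 1 ∧ D.toFun w = x.1 ∧ E.toFun w = y'.1) : y = y' := by
  obtain ⟨w, -, hx, hy⟩ := h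
  obtain ⟨v, -, hx', hy'⟩ := h'
  rw [D.injective_toFun (hx.trans hx'.symm)] at hy
  exact Subtype.ext (hy.symm.trans hy')

/-- The centre of an invariant disk. -/
def center : X.carrier := D.toFun ⟨0, by simp⟩

lemma toFun_mem_fixedSet_iff [Fact p.Prime] {w : UnitDisk} :
    D.toFun w ∈ X.fixedSet ↔ (w : ℂ) = 0 := by
  have h1 : D.toFun w ∈ X.fixedSet ↔ D.toFun (UnitDisk.rot (ZMod.toCircle (u : ZMod p)) w)
      = D.toFun w := by rw [← D.act_toFun]; rfl
  rw [h1, D.injective_toFun.eq_iff, Subtype.ext_iff]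
  refine ⟨fun h => by_contra fun h0 => ?_, fun h => ?_⟩
  · exact toCircle_ne_one u.ne_zero (Circle.ext (mul_right_cancel₀ h0 (h.trans (one_mul _).symm)))
  · simp [UnitDisk.rot, h]

lemma encard_compl_fixedSet [Fact p.Prime] :
    D.compl.fixedSet.encard + 1 = X.fixedSet.encard := by
  have h1 : D.center ∈ X.fixedSet := D.toFun_mem_fixedSet_iff.2 rfl
  rw [← encard_sdiff_singleton_add_one h1]
  refine congrArg (· + 1) ((CpSpace.encard_restrict_fixedSet _ _).trans (congrArg _ ?_))
  ext x
  constructor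
  · rintro ⟨hx, hx'⟩
    refine ⟨hx', ?_⟩
    rintro rfl
    exact hx ⟨0, by simp⟩ (by simp) rfl
  · rintro ⟨hx, hx'⟩
    refine ⟨fun w hw h => hx' ?_, hx⟩
    rw [← h, toFun_mem_fixedSet_iff] at hx
    rw [mem_singleton_iff, ← h]
    exact congrArg D.toFun (Subtype.ext hx)

lemma glue_fixedSet : (D.glue E).fixedSet
    = D.inl E '' D.compl.fixedSet ∪ D.inr E '' E.compl.fixedSet :=
  CpSpace.glue_fixedSet (fun _ _ _ => D.rel_left_unique E) fun _ _ _ => D.rel_right_unique E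

lemma encard_glue_fixedSet [Fact p.Prime] :
    (D.glue E).fixedSet.encard = D.compl.fixedSet.encard + E.compl.fixedSet.encard := by
  refine CpSpace.encard_glue_fixedSet (fun _ _ _ => D.rel_left_unique E)
    (fun _ _ _ => D.rel_right_unique E) ?_
  rintro x y ⟨w, hw, hx, -⟩ hxf
  have h1 : x.1 ∈ X.fixedSet := congrArg Subtype.val hxf
  rw [← hx, toFun_mem_fixedSet_iff] at h1
  rw [h1, norm_zero] at hw
  exact zero_ne_one hw

/-- A chart of `X` away from the removed disk, in the glued space. -/
def chartInl {a : ZMod p} (c : RotChart X a) (h : ∀ w, c.toFun w ∉ range D.toFun) :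
    RotChart (D.glue E) a :=
  RotChart.glueInl (X := D.compl) (Y := E.compl)
    (c.restrict _ _ fun w v _ hv => h w ⟨v, hv⟩) (by
      rintro w y ⟨v, -, hx, -⟩
      exact h w ⟨v, hx⟩)

/-- A chart of `Y` away from the removed disk, in the glued space. -/
def chartInr {a : ZMod p} (c : RotChart Y a) (h : ∀ w, c.toFun w ∉ range E.toFun) :
    RotChart (D.glue E) a :=
  RotChart.glueInr (X := D.compl) (Y := E.compl)
    (c.restrict _ _ fun w v _ hv => h w ⟨v, hv⟩) (by
      rintro w y ⟨v, -, -, hx⟩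
      exact h w ⟨v, hx⟩)

end FixedDisk

/-! ### Pairs of poles -/

/-- The fixed points `x` and `x'` behave like the two poles of a sphere: the generator acts on
disks about `x` and `x'` as the *same* rotation, and there is a circle-valued function, continuous
away from `x` and `x'`, which has degree `p` at both points. The function is required to be
constant on the set `B`, which the disks avoid, so that surgery inside `B` does not affect it. -/
def IsPolePair [NeZero p] (X : CpSpace p) (x x' : X.carrier) (B : Set X.carrier) : Prop :=
  x ≠ x' ∧ ∃ (a : ZMod p) (c c' : RotChart X a) (f : X.carrier → Circle),
    c.center = x ∧ c'.center = x' ∧ (∀ w, c.toFun w ∉ B) ∧ (∀ w, c'.toFun w ∉ B) ∧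
    IsOpen ({x, x'}ᶜ : Set X.carrier) ∧ ContinuousOn f {x, x'}ᶜ ∧ (∀ b ∈ B, f b = 1) ∧
    c.HasDeg f p ∧ c'.HasDeg f p

namespace ConjDisk

variable [NeZero p] {X Y : CpSpace p} (D : ConjDisk X) (E : ConjDisk Y)

lemma rel_of_inl_eq_inr {x : D.compl.carrier} {y : E.compl.carrier}
    (h : D.inl E x = D.inr E y) : ∃ (k : ℕ) (w : UnitDisk), ‖(w : ℂ)‖ = 1 ∧
      X.act^[k] (D.toFun w) = x.1 ∧ Y.act^[k] (E.toFun w) = y.1 :=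
  CpSpace.rel_of_glue_inl_eq_inr (X := D.compl) (Y := E.compl)
    (r := fun x y => ∃ (k : ℕ) (w : UnitDisk), ‖(w : ℂ)‖ = 1 ∧
      X.act^[k] (D.toFun w) = x.1 ∧ Y.act^[k] (E.toFun w) = y.1)
    (fun _ _ _ => D.rel_left_unique E) h

lemma isPolePair_inl {x x' : D.compl.carrier} {B : Set X.carrier} (h : IsPolePair X x.1 x'.1 B)
    (hD : D.conj ⊆ B) {B' : Set (D.glue E).carrier} (hB' : ∀ z, D.inl E z ∈ B' → z.1 ∈ B) :
    IsPolePair (D.glue E) (D.inl E x) (D.inl E x') B' := by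
  obtain ⟨hne, a, c, c', f, hc, hc', hcB, hcB', ho, hf, hfB, hd, hd'⟩ := h
  let F : (D.glue E).carrier → Circle := Quot.lift (Sum.elim (fun z => f z.1) fun _ => 1) (by
    rintro _ _ ⟨k, w, -, hx, -⟩
    exact hfB _ (hD ⟨k, w, hx⟩))
  have hrel : ∀ z : D.compl.carrier, z.1 ∉ B → ∀ y : E.compl.carrier, ¬ ∃ (k : ℕ) (w : UnitDisk),
      ‖(w : ℂ)‖ = 1 ∧ X.act^[k] (D.toFun w) = z.1 ∧ Y.act^[k] (E.toFun w) = y.1 := by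
    rintro z hz y ⟨k, w, -, hx, -⟩
    exact hz (hD ⟨k, w, hx⟩)
  have hxB : x.1 ∉ B := hc ▸ hcB _
  have hxB' : x'.1 ∉ B := hc' ▸ hcB' _
  have e1 : D.inl E ⁻¹' {D.inl E x, D.inl E x'}ᶜ = Subtype.val ⁻¹' {x.1, x'.1}ᶜ := by
    ext z
    simp only [mem_preimage, mem_compl_iff, mem_insert_iff, mem_singleton_iff,
      (D.inl_injective E).eq_iff]
    exact not_congr (or_congr Subtype.ext_iff Subtype.ext_iff)
  have e2 : D.inr E ⁻¹' {D.inl E x, D.inl E x'}ᶜ = univ := by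
    refine eq_univ_of_forall fun z => ?_
    rintro (hz | hz)
    · exact CpSpace.glue_inl_ne_inr (hrel x hxB) hz.symm
    · exact CpSpace.glue_inl_ne_inr (hrel x' hxB') hz.symm
  have o1 : IsOpen (D.inl E ⁻¹' {D.inl E x, D.inl E x'}ᶜ) := by
    rw [e1]
    exact ho.preimage continuous_subtype_val
  have o2 : IsOpen (D.inr E ⁻¹' {D.inl E x, D.inl E x'}ᶜ) := by
    rw [e2]
    exact isOpen_univ
  refine ⟨fun h => hne (congrArg Subtype.val (D.inl_injective E h)), a,
    D.chartInl E c fun w hw => hcB w (hD hw), D.chartInl E c' fun w hw => hcB' w (hD hw),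
    F, congrArg (D.inl E) (Subtype.ext hc), congrArg (D.inl E) (Subtype.ext hc'),
    fun w hw => hcB w (hB' _ hw), fun w hw => hcB' w (hB' _ hw),
    CpSpace.isOpen_glue o1 o2, CpSpace.continuousOn_glue o1 o2 ?_ ?_, ?_,
    hd.of_comp rfl fun _ _ => rfl, hd'.of_comp rfl fun _ _ => rfl⟩
  · refine (hf.comp continuous_subtype_val.continuousOn ?_ :)
    intro z hz
    have hz' : z ∈ D.inl E ⁻¹' {D.inl E x, D.inl E x'}ᶜ := hz
    rwa [e1] at hz'
  · exact continuousOn_const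
  · intro b hb
    obtain ⟨z | z, rfl⟩ := Quot.exists_rep b
    · exact hfB _ (hB' z hb)
    · rfl

lemma isPolePair_inr {y y' : E.compl.carrier} {B : Set Y.carrier} (h : IsPolePair Y y.1 y'.1 B)
    (hE : E.conj ⊆ B) {B' : Set (D.glue E).carrier} (hB' : ∀ z, D.inr E z ∈ B' → z.1 ∈ B) :
    IsPolePair (D.glue E) (D.inr E y) (D.inr E y') B' := by
  obtain ⟨hne, a, c, c', f, hc, hc', hcB, hcB', ho, hf, hfB, hd, hd'⟩ := h
  let F : (D.glue E).carrier → Circle := Quot.lift (Sum.elim (fun _ => 1) fun z => f z.1) (by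
    rintro _ _ ⟨k, w, -, -, hy⟩
    exact (hfB _ (hE ⟨k, w, hy⟩)).symm)
  have hrel : ∀ z : E.compl.carrier, z.1 ∉ B → ∀ x : D.compl.carrier, ¬ ∃ (k : ℕ) (w : UnitDisk),
      ‖(w : ℂ)‖ = 1 ∧ X.act^[k] (D.toFun w) = x.1 ∧ Y.act^[k] (E.toFun w) = z.1 := by
    rintro z hz x ⟨k, w, -, -, hy⟩
    exact hz (hE ⟨k, w, hy⟩)
  have hyB : y.1 ∉ B := hc ▸ hcB _
  have hyB' : y'.1 ∉ B := hc' ▸ hcB' _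
  have e1 : D.inr E ⁻¹' {D.inr E y, D.inr E y'}ᶜ = Subtype.val ⁻¹' {y.1, y'.1}ᶜ := by
    ext z
    simp only [mem_preimage, mem_compl_iff, mem_insert_iff, mem_singleton_iff,
      (D.inr_injective E).eq_iff]
    exact not_congr (or_congr Subtype.ext_iff Subtype.ext_iff)
  have e2 : D.inl E ⁻¹' {D.inr E y, D.inr E y'}ᶜ = univ := by
    refine eq_univ_of_forall fun z => ?_
    rintro (hz | hz)
    · exact CpSpace.glue_inr_ne_inl (hrel y hyB) hz.symm
    · exact CpSpace.glue_inr_ne_inl (hrel y' hyB') hz.symm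
  have o1 : IsOpen (D.inr E ⁻¹' {D.inr E y, D.inr E y'}ᶜ) := by
    rw [e1]
    exact ho.preimage continuous_subtype_val
  have o2 : IsOpen (D.inl E ⁻¹' {D.inr E y, D.inr E y'}ᶜ) := by
    rw [e2]
    exact isOpen_univ
  refine ⟨fun h => hne (congrArg Subtype.val (D.inr_injective E h)), a,
    D.chartInr E c fun w hw => hcB w (hE hw), D.chartInr E c' fun w hw => hcB' w (hE hw),
    F, congrArg (D.inr E) (Subtype.ext hc), congrArg (D.inr E) (Subtype.ext hc'),
    fun w hw => hcB w (hB' _ hw), fun w hw => hcB' w (hB' _ hw),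
    CpSpace.isOpen_glue o2 o1, CpSpace.continuousOn_glue o2 o1 ?_ ?_, ?_,
    hd.of_comp rfl fun _ _ => rfl, hd'.of_comp rfl fun _ _ => rfl⟩
  · exact continuousOn_const
  · refine (hf.comp continuous_subtype_val.continuousOn ?_ :)
    intro z hz
    have hz' : z ∈ D.inr E ⁻¹' {D.inr E y, D.inr E y'}ᶜ := hz
    rwa [e1] at hz'
  · intro b hb
    obtain ⟨z | z, rfl⟩ := Quot.exists_rep b
    · rfl
    · exact hfB _ (hB' z hb)

/-- If all fixed points of `X` and of `Y` come in pairs of poles, then this is true of the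
surface obtained by gluing `X` and `Y` along conjugate disks. -/
lemma exists_isPolePair_glue [Fact p.Prime] {B : Set X.carrier} {C : Set Y.carrier}
    (hX : ∀ x ∈ X.fixedSet, ∃ x' ∈ X.fixedSet, IsPolePair X x x' B)
    (hY : ∀ y ∈ Y.fixedSet, ∃ y' ∈ Y.fixedSet, IsPolePair Y y y' C)
    (hD : D.conj ⊆ B) (hE : E.conj ⊆ C) {B' : Set (D.glue E).carrier}
    (hB : ∀ z, D.inl E z ∈ B' → z.1 ∈ B) (hC : ∀ z, D.inr E z ∈ B' → z.1 ∈ C) :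
    ∀ z ∈ (D.glue E).fixedSet, ∃ z' ∈ (D.glue E).fixedSet, IsPolePair (D.glue E) z z' B' := by
  intro z hz
  rw [glue_fixedSet] at hz
  obtain ⟨x, hx, rfl⟩ | ⟨y, hy, rfl⟩ := hz
  · obtain ⟨x', hx', h⟩ := hX x.1 (congrArg Subtype.val hx)
    refine ⟨D.inl E ⟨x', D.mem_compl_of_notMem_conj (D.disjoint_fixedSet hx')⟩, ?_,
      D.isPolePair_inl E h hD hB⟩
    exact congrArg (D.inl E) (Subtype.ext hx')
  · obtain ⟨y', hy', h⟩ := hY y.1 (congrArg Subtype.val hy)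
    refine ⟨D.inr E ⟨y', E.mem_compl_of_notMem_conj (E.disjoint_fixedSet hy')⟩, ?_,
      D.isPolePair_inr E h hE hC⟩
    exact congrArg (D.inr E) (Subtype.ext hy')

variable {D E} {F : ConjDisk X} {hF : ∀ k v w, X.act^[k] (D.toFun v) ≠ F.toFun w}

lemma val_mem_conj_of_inl_mem {z : D.compl.carrier} (hz : D.inl E z ∈ (survive D E F hF).conj) :
    z.1 ∈ F.conj := by
  obtain ⟨k, w, h⟩ := hz
  have h1 := D.inl_injective E ((D.iterate_act_inl E _ _).symm.trans h)
  exact ⟨k, w, (D.compl_iterate_act k _).symm.trans (congrArg Subtype.val h1)⟩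

lemma inr_notMem_conj {z : E.compl.carrier} : D.inr E z ∉ (survive D E F hF).conj := by
  rintro ⟨k, w, h⟩
  obtain ⟨l, v, -, hx, -⟩ := D.rel_of_inl_eq_inr E ((D.iterate_act_inl E _ _).symm.trans h)
  replace hx : X.act^[l] (D.toFun v) = X.act^[k] (F.toFun w) :=
    hx.trans (D.compl_iterate_act k _)
  have h2 : X.act^[(p - 1) * k + k] (F.toFun w) = F.toFun w := by
    rw [show (p - 1) * k + k = p * k by
      rw [← Nat.succ_mul, Nat.succ_eq_add_one, Nat.sub_add_cancel (NeZero.pos p)],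
      Function.iterate_mul]
    exact Function.iterate_fixed (X.iterate_act _) k
  refine hF ((p - 1) * k + l) v w ?_
  rw [Function.iterate_add_apply, hx, ← Function.iterate_add_apply, h2]

end ConjDisk

/-! ### The representation spheres -/

open Classical in
/-- The inversion `z ↦ 1 / conj z` of the Riemann sphere. -/
noncomputable def sphereInv (x : OnePoint ℂ) : OnePoint ℂ :=
  x.elim ((0 : ℂ) : OnePoint ℂ)
    fun z => if z = 0 then OnePoint.infty else (((starRingEnd ℂ z)⁻¹ : ℂ) : OnePoint ℂ)

lemma sphereInv_infty : sphereInv OnePoint.infty = ((0 : ℂ) : OnePoint ℂ) := rfl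

lemma sphereInv_zero : sphereInv ((0 : ℂ) : OnePoint ℂ) = OnePoint.infty := if_pos rfl

lemma sphereInv_coe {z : ℂ} (hz : z ≠ 0) :
    sphereInv (z : OnePoint ℂ) = (((starRingEnd ℂ z)⁻¹ : ℂ) : OnePoint ℂ) := if_neg hz

lemma sphereInv_sphereInv (x : OnePoint ℂ) : sphereInv (sphereInv x) = x := by
  induction x using OnePoint.rec with
  | infty => rw [sphereInv_infty, sphereInv_zero]
  | coe z =>
    rcases eq_or_ne z 0 with rfl | hz
    · rw [sphereInv_zero, sphereInv_infty]
    · rw [sphereInv_coe hz, sphereInv_coe (inv_ne_zero ((map_ne_zero _).2 hz))]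
      simp

lemma continuous_sphereInv : Continuous sphereInv := by
  rw [OnePoint.continuous_iff]
  have hconj : Tendsto (starRingEnd ℂ) (Bornology.cobounded ℂ) (Bornology.cobounded ℂ) := by
    rw [← tendsto_norm_atTop_iff_cobounded]
    simpa using tendsto_norm_cobounded_atTop
  refine ⟨?_, continuous_iff_continuousAt.2 fun z => ?_⟩
  · rw [coclosedCompact_eq_cocompact, ← Metric.cobounded_eq_cocompact]
    have h1 : Tendsto (fun z : ℂ => (((starRingEnd ℂ z)⁻¹ : ℂ) : OnePoint ℂ))
        (Bornology.cobounded ℂ) (𝓝 ((0 : ℂ) : OnePoint ℂ)) :=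
      (OnePoint.continuous_coe.tendsto 0).comp (tendsto_inv₀_cobounded.comp hconj)
    refine h1.congr' ?_
    filter_upwards [Bornology.eventually_ne_cobounded (0 : ℂ)] with z hz
    exact (sphereInv_coe hz).symm
  · rcases eq_or_ne z 0 with rfl | hz
    · rw [continuousAt_iff_punctured_nhds, sphereInv_zero]
      have h1 : Tendsto (fun z : ℂ => (((starRingEnd ℂ z)⁻¹ : ℂ) : OnePoint ℂ))
          (𝓝[≠] 0) (𝓝 (OnePoint.infty : OnePoint ℂ)) := by
        have h2 := OnePoint.tendsto_coe_infty (X := ℂ)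
        rw [coclosedCompact_eq_cocompact, ← Metric.cobounded_eq_cocompact] at h2
        refine h2.comp (?_ : Tendsto (fun z : ℂ => (starRingEnd ℂ z)⁻¹) _ _)
        have h3 : (fun z : ℂ => (starRingEnd ℂ z)⁻¹) = fun z => starRingEnd ℂ z⁻¹ := by
          funext z
          exact (map_inv₀ (starRingEnd ℂ) z).symm
        rw [h3]
        exact hconj.comp tendsto_inv₀_nhdsNE_zero
      refine h1.congr' ?_
      filter_upwards [self_mem_nhdsWithin] with z hz
      exact (sphereInv_coe hz).symm
    · have h1 : ContinuousAt (fun z : ℂ => (((starRingEnd ℂ z)⁻¹ : ℂ) : OnePoint ℂ)) z :=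
        OnePoint.continuous_coe.continuousAt.comp
          (continuous_conj.continuousAt.inv₀ ((map_ne_zero _).2 hz))
      refine h1.congr ?_
      filter_upwards [isOpen_ne.mem_nhds hz] with w hw
      exact (sphereInv_coe hw).symm

/-- The inversion as a homeomorphism. -/
noncomputable def sphereInvHomeo : OnePoint ℂ ≃ₜ OnePoint ℂ where
  toFun := sphereInv
  invFun := sphereInv
  left_inv := sphereInv_sphereInv
  right_inv := sphereInv_sphereInv
  continuous_toFun := continuous_sphereInv
  continuous_invFun := continuous_sphereInv

/-- The inversion preserves directions. -/
lemma dir_inv_conj (z : ℂ) : dir (starRingEnd ℂ z)⁻¹ = dir z := by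
  rcases eq_or_ne z 0 with rfl | hz
  · simp
  · have h1 : (starRingEnd ℂ z)⁻¹ = (((normSq z)⁻¹ : ℝ) : ℂ) * z := by
      rw [inv_def, normSq_conj, conj_conj, mul_comm]
    have h2 : 0 < (normSq z)⁻¹ := inv_pos.2 (normSq_pos.2 hz)
    rw [h1, dir_mul (by exact_mod_cast h2.ne') hz, dir_ofReal h2, one_mul]

section

variable [NeZero p] (u : (ZMod p)ˣ)

lemma repSphere_act_coe (z : ℂ) : (repSphere p u).act ((z : OnePoint ℂ) : (repSphere p u).carrier)
    = ((ZMod.toCircle (u : ZMod p) * z : ℂ) : OnePoint ℂ) := rfl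

lemma repSphere_act_infty :
    (repSphere p u).act ((OnePoint.infty : OnePoint ℂ) : (repSphere p u).carrier)
      = (OnePoint.infty : OnePoint ℂ) := rfl

lemma repSphere_act_sphereInv (x : OnePoint ℂ) :
    (repSphere p u).act (sphereInv x) = sphereInv ((repSphere p u).act x) := by
  induction x using OnePoint.rec with
  | infty =>
    rw [repSphere_act_infty, sphereInv_infty, repSphere_act_coe, mul_zero]
  | coe z =>
    rcases eq_or_ne z 0 with rfl | hz
    · rw [repSphere_act_coe, mul_zero, sphereInv_zero, repSphere_act_infty]
    · rw [repSphere_act_coe, sphereInv_coe hz, repSphere_act_coe,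
        sphereInv_coe (mul_ne_zero (Circle.coe_ne_zero _) hz), map_mul, mul_inv,
        ← Circle.coe_inv_eq_conj, Circle.coe_inv, inv_inv]

/-- The chart of the representation sphere at the pole `0`. -/
noncomputable def repSphereChartZero (R : ℝ) (hR : 0 < R) :
    RotChart (repSphere p u) (u : ZMod p) where
  radius := R
  radius_pos := hR
  toFun w := ((w : ℂ) : OnePoint ℂ)
  isOpenEmbedding := OnePoint.isOpenEmbedding_coe.comp isOpen_ball.isOpenEmbedding_subtypeVal
  act_toFun w w' h := by rw [h]; rfl

/-- The chart of the representation sphere at the pole `∞`. The generator acts on it as the *same*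
rotation as at the pole `0`, because the inversion reverses the orientation. -/
noncomputable def repSphereChartInfty (R : ℝ) (hR : 0 < R) :
    RotChart (repSphere p u) (u : ZMod p) where
  radius := R
  radius_pos := hR
  toFun w := sphereInv ((w : ℂ) : OnePoint ℂ)
  isOpenEmbedding := sphereInvHomeo.isOpenEmbedding.comp
    (OnePoint.isOpenEmbedding_coe.comp isOpen_ball.isOpenEmbedding_subtypeVal)
  act_toFun w w' h := by
    rw [repSphere_act_sphereInv, h]
    rfl

lemma repSphere_fixedSet [Fact p.Prime] : (repSphere p u).fixedSet
    = {(((0 : ℂ) : OnePoint ℂ) : (repSphere p u).carrier), (OnePoint.infty : OnePoint ℂ)} := by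
  ext x
  induction x using OnePoint.rec with
  | infty => exact iff_of_true rfl (Or.inr rfl)
  | coe z =>
    constructor
    · intro h
      have h1 : (ZMod.toCircle (u : ZMod p) : ℂ) * z = z := OnePoint.coe_injective h
      refine Or.inl (congrArg _ (by_contra fun h0 => toCircle_ne_one u.ne_zero ?_))
      exact Circle.ext (mul_right_cancel₀ h0 (h1.trans (one_mul _).symm))
    · rintro (h | h)
      · rw [OnePoint.coe_injective h]
        exact (repSphere_act_coe u 0).trans (by rw [mul_zero])
      · exact absurd h (OnePoint.coe_ne_infty z)

lemma encard_repSphere_fixedSet [Fact p.Prime] : (repSphere p u).fixedSet.encard = 2 := by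
  rw [repSphere_fixedSet]
  exact encard_pair (OnePoint.coe_ne_infty 0)

end

/-- The map of degree one of the circle to itself which collapses the right half of the circle. -/
noncomputable def circleCollapse (θ : Circle) : Circle :=
  if 0 ≤ (θ : ℂ).re then 1 else Circle.exp Real.pi * θ ^ 2

lemma continuous_circleCollapse : Continuous circleCollapse := by
  refine continuous_const.if_le (by fun_prop) continuous_const (by fun_prop) fun θ hθ => ?_
  have h1 := Circle.normSq_coe θ
  rw [normSq_apply, ← hθ] at h1
  refine Circle.ext ?_
  apply Complex.ext <;> simp [pow_two, ← hθ]
  linarith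

/-- The collapse moves no point to its antipode, so it is homotopic to the identity. -/
lemma circleCollapse_mul_inv_mem_slitPlane (θ : Circle) :
    ((circleCollapse θ * θ⁻¹ : Circle) : ℂ) ∈ slitPlane := by
  have h1 := Circle.normSq_coe θ
  rw [normSq_apply] at h1
  rw [mem_slitPlane_iff, circleCollapse]
  split_ifs with h
  · rw [one_mul, Circle.coe_inv_eq_conj, conj_re, conj_im]
    rcases h.eq_or_lt with h0 | h0
    · right
      intro h2
      rw [← h0, neg_eq_zero.1 h2] at h1
      norm_num at h1
    · exact Or.inl h0
  · left
    rw [pow_two, ← mul_assoc, mul_inv_cancel_right]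
    simp only [Circle.coe_mul, Circle.coe_exp, exp_pi_mul_I, neg_mul, one_mul, neg_re]
    linarith

lemma circleCollapse_eq (θ : Circle) :
    circleCollapse θ = θ * Circle.exp (arg (circleCollapse θ * θ⁻¹ : Circle)) := by
  rw [Circle.exp_arg, mul_comm θ, inv_mul_cancel_right]

lemma punctDeg_circleCollapse : PunctDeg (fun z => circleCollapse (dir z ^ p)) p := by
  refine ⟨1, one_pos, fun z => arg (circleCollapse (dir z ^ p) * (dir z ^ p)⁻¹ : Circle), ?_,
    fun z _ _ => ?_⟩
  · intro z hz
    have h1 : ContinuousAt dir z := continuousOn_dir.continuousAt (isOpen_ne.mem_nhds hz.2)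
    refine ContinuousAt.continuousWithinAt ?_
    refine (continuousAt_arg (circleCollapse_mul_inv_mem_slitPlane (dir z ^ p))).comp
      (f := fun z => ((circleCollapse (dir z ^ p) * (dir z ^ p)⁻¹ : Circle) : ℂ)) ?_
    refine (by fun_prop : Continuous fun θ : Circle => (θ : ℂ)).continuousAt.comp
      (f := fun z => circleCollapse (dir z ^ p) * (dir z ^ p)⁻¹) ?_
    exact (continuous_circleCollapse.continuousAt.comp (h1.pow p)).mul (h1.pow p).inv
  · rw [zpow_natCast]
    exact circleCollapse_eq _

/-- The part of the sphere which contains the disks that are removed in ribbon surgeries. -/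
def repSphereSectors (p : ℕ) [NeZero p] (u : (ZMod p)ˣ) : Set (repSphere p u).carrier :=
  {x | ∃ z : ℂ, x = ((z : OnePoint ℂ) : (repSphere p u).carrier) ∧ 1 / 2 ≤ ‖z‖ ∧ ‖z‖ ≤ 4 ∧
    0 ≤ ((dir z ^ p : Circle) : ℂ).re}

lemma isPolePair_repSphere [NeZero p] (u : (ZMod p)ˣ) : IsPolePair (repSphere p u)
    (((0 : ℂ) : OnePoint ℂ) : (repSphere p u).carrier) (OnePoint.infty : OnePoint ℂ)
    (repSphereSectors p u) := by
  let f : (repSphere p u).carrier → Circle :=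
    fun x => OnePoint.elim x 1 fun z => circleCollapse (dir z ^ p)
  have hcl : IsClosed ({((0 : ℂ) : OnePoint ℂ), OnePoint.infty} : Set (OnePoint ℂ)) :=
    (toFinite _).isClosed
  refine ⟨OnePoint.coe_ne_infty 0, u, repSphereChartZero u (1 / 2) (by norm_num),
    repSphereChartInfty u (1 / 4) (by norm_num), f, rfl, sphereInv_zero, ?_, ?_,
    hcl.isOpen_compl, ?_, ?_, ?_, ?_⟩
  · rintro ⟨w, hw⟩ ⟨z, hz, h1, -, -⟩
    rw [← OnePoint.coe_injective hz] at h1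
    exact absurd (mem_ball_zero_iff.1 hw) (not_lt.2 h1)
  · rintro ⟨w, hw⟩ ⟨z, hz, -, h2, -⟩
    replace hz : sphereInv (w : OnePoint ℂ) = z := hz
    rcases eq_or_ne w 0 with rfl | hw0
    · rw [sphereInv_zero] at hz
      exact OnePoint.coe_ne_infty z hz.symm
    · rw [sphereInv_coe hw0] at hz
      rw [← OnePoint.coe_injective hz, norm_inv, RCLike.norm_conj] at h2
      have h3 : (1 / 4 : ℝ)⁻¹ < ‖w‖⁻¹ :=
        (inv_lt_inv₀ (by norm_num) (norm_pos_iff.2 hw0)).2 (mem_ball_zero_iff.1 hw)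
      norm_num at h3
      linarith
  · intro x hx
    refine ContinuousAt.continuousWithinAt ?_
    induction x using OnePoint.rec with
    | infty => exact absurd (Or.inr rfl) hx
    | coe z =>
      have hz : z ≠ 0 := fun h => hx (Or.inl (congrArg _ h))
      have h1 : ContinuousAt dir z := continuousOn_dir.continuousAt (isOpen_ne.mem_nhds hz)
      refine OnePoint.continuousAt_coe.2 ?_
      exact continuous_circleCollapse.continuousAt.comp (h1.pow p)
  · rintro _ ⟨z, rfl, -, -, hz⟩
    exact if_pos hz
  · refine punctDeg_circleCollapse.congr (ρ := 1 / 2) (by norm_num) fun z _ hz => ?_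
    exact congrArg f
      ((repSphereChartZero u (1 / 2) (by norm_num)).ext_coe ⟨z, mem_ball_zero_iff.2 hz⟩)
  · refine punctDeg_circleCollapse.congr (ρ := 1 / 4) (by norm_num) fun z hz0 hz => ?_
    refine (congrArg f ((repSphereChartInfty u (1 / 4) (by norm_num)).ext_coe
      ⟨z, mem_ball_zero_iff.2 hz⟩)).trans ((congrArg f (sphereInv_coe hz0)).trans ?_)
    exact congrArg (fun θ => circleCollapse (θ ^ p)) (dir_inv_conj z)

lemma IsPolePair.symm [NeZero p] {X : CpSpace p} {x x' : X.carrier} {B : Set X.carrier}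
    (h : IsPolePair X x x' B) : IsPolePair X x' x B := by
  obtain ⟨hne, a, c, c', f, hc, hc', hcB, hcB', ho, hf, hfB, hd, hd'⟩ := h
  rw [pair_comm] at ho hf
  exact ⟨hne.symm, a, c', c, f, hc', hc, hcB', hcB, ho, hf, hfB, hd', hd⟩

lemma exists_isPolePair_repSphere [Fact p.Prime] (u : (ZMod p)ˣ) :
    ∀ x ∈ (repSphere p u).fixedSet, ∃ x' ∈ (repSphere p u).fixedSet,
      IsPolePair (repSphere p u) x x' (repSphereSectors p u) := by
  rw [repSphere_fixedSet]
  rintro _ (rfl | rfl)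
  · exact ⟨_, Or.inr rfl, isPolePair_repSphere u⟩
  · exact ⟨_, Or.inl rfl, (isPolePair_repSphere u).symm⟩

/-- The direction of a point in a round disk of radius `1 / p` about a point `c ≥ 1` of the real
axis is so close to `1` that its `p`-th power is in the right half plane. -/
lemma re_dir_pow_nonneg [Fact p.Prime] {c : ℝ} (hc : 1 ≤ c) (w : UnitDisk) :
    0 ≤ ((dir ((c : ℂ) + ((1 / p : ℝ) : ℂ) * w) ^ p : Circle) : ℂ).re := by
  have hp : (2 : ℝ) ≤ p := by exact_mod_cast (Fact.out : p.Prime).two_le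
  set z : ℂ := (c : ℂ) + ((1 / p : ℝ) : ℂ) * w with hz
  have hw : (w : ℂ).re ^ 2 + (w : ℂ).im ^ 2 ≤ 1 := by
    have h1 := w.norm_le
    have h2 := Complex.sq_norm (w : ℂ)
    rw [normSq_apply] at h2
    nlinarith [norm_nonneg (w : ℂ)]
  have hre : z.re = c + 1 / p * (w : ℂ).re := by simp [hz]
  have him : z.im = 1 / p * (w : ℂ).im := by simp [hz]
  set q : ℝ := 1 / p with hq
  have hq0 : 0 < q := by positivity
  have hqp : q * p = 1 := by rw [hq]; field_simp
  have hq2 : q ≤ 1 / 2 := one_div_le_one_div_of_le (by norm_num) hp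
  have hre0 : 0 < z.re := by
    have ha : |(w : ℂ).re| ≤ 1 := (abs_re_le_norm _).trans w.norm_le
    rw [hre]
    nlinarith [(abs_le.1 ha).1]
  have hz0 : 0 < ‖z‖ := norm_pos_iff.2 fun h => by simp [h] at hre0
  have hsin : |Real.sin (arg z)| ≤ q := by
    rw [sin_arg, abs_div, abs_of_pos hz0, div_le_iff₀ hz0]
    refine abs_le_of_sq_le_sq ?_ (by positivity)
    rw [mul_pow, Complex.sq_norm, normSq_apply, him, hre]
    set a := (w : ℂ).re
    set b := (w : ℂ).im
    have ha : |a| ≤ 1 := (abs_re_le_norm _).trans w.norm_le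
    have h1 : -(1 / 2) ≤ q * a := by nlinarith [(abs_le.1 ha).1]
    have h2 : b ^ 2 * (1 - q ^ 2) ≤ (c + q * a) ^ 2 := by
      have h3 : (1 + q * a) ^ 2 ≤ (c + q * a) ^ 2 := by gcongr; linarith
      have h4 : b ^ 2 * (1 - q ^ 2) ≤ (1 - a ^ 2) * (1 - q ^ 2) :=
        mul_le_mul_of_nonneg_right (by linarith) (by nlinarith)
      nlinarith [sq_nonneg (a + q)]
    nlinarith [mul_le_mul_of_nonneg_left h2 (sq_nonneg q)]
  have harg : |arg z| ≤ Real.pi / 2 := abs_arg_le_pi_div_two_iff.2 hre0.le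
  -- Jordan's inequality turns the bound for the sine into one for the angle
  have h1 := Real.mul_abs_le_abs_sin harg
  have h2 : |p * arg z| ≤ Real.pi / 2 := by
    rw [abs_mul, Nat.abs_cast]
    have h3 : 2 / Real.pi * |arg z| ≤ q := h1.trans hsin
    rw [div_mul_eq_mul_div, div_le_iff₀ Real.pi_pos] at h3
    nlinarith [Real.pi_pos]
  have h3 : ((dir z ^ p : Circle) : ℂ).re = Real.cos (p * arg z) := by
    rw [dir, ← Circle.exp_natCast_mul, Circle.coe_exp, exp_ofReal_mul_I_re]
  rw [h3]
  exact Real.cos_nonneg_of_mem_Icc (abs_le.1 h2)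

/-- The disks which are removed from representation spheres in ribbon surgeries are in the part of
the sphere on which a suitable circle-valued function is constant. -/
lemma sphereDisk_conj_subset [Fact p.Prime] (u : (ZMod p)ˣ) {c : ℝ} (h1 : 1 ≤ c) (h3 : c ≤ 3)
    (hr : (0 : ℝ) < 1 / p) (hc : (p : ℝ) * (1 / p) < 2 * c) :
    (sphereDisk p u c (1 / p) hr hc).conj ⊆ repSphereSectors p u := by
  have hp : (2 : ℝ) ≤ p := by exact_mod_cast (Fact.out : p.Prime).two_le
  rintro _ ⟨k, w, rfl⟩
  refine ⟨_, repSphere_iterate_act u k _, ?_, ?_, ?_⟩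
  all_goals
    have hq : (1 : ℝ) / p ≤ 1 / 2 := one_div_le_one_div_of_le (by norm_num) hp
    have hn : ‖((1 / p : ℝ) : ℂ) * w‖ ≤ 1 / 2 := by
      rw [norm_mul, norm_real, Real.norm_eq_abs, abs_of_pos hr]
      nlinarith [norm_nonneg (w : ℂ), w.norm_le]
    have hcn : ‖(c : ℂ)‖ = c := by
      rw [norm_real, Real.norm_eq_abs, abs_of_nonneg (by linarith)]
    have hn1 := norm_sub_le_norm_add (c : ℂ) (((1 / p : ℝ) : ℂ) * w)
    have hn2 := norm_add_le (c : ℂ) (((1 / p : ℝ) : ℂ) * w)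
  · rw [norm_mul, Circle.norm_coe, one_mul]
    linarith
  · rw [norm_mul, Circle.norm_coe, one_mul]
    linarith
  · have hne : (c : ℂ) + ((1 / p : ℝ) : ℂ) * w ≠ 0 := fun h => by
      rw [h, norm_zero] at hn1
      linarith
    rw [dir_mul (Circle.coe_ne_zero _) hne, dir_circle, mul_pow, ← AddChar.map_nsmul_eq_pow,
      nsmul_eq_mul, CharP.cast_eq_zero, zero_mul, AddChar.map_zero_eq_one, one_mul]
    exact re_dir_pow_nonneg h1 w

/-- All fixed points of the iterated ribbon surgery on a sphere come in pairs of poles. -/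
lemma exists_isPolePair_sphSix [Fact p.Prime] (i j k : (ZMod p)ˣ) :
    ∀ x ∈ (sphSix p i j k).fixedSet, ∃ x' ∈ (sphSix p i j k).fixedSet,
      IsPolePair (sphSix p i j k) x x' ∅ := by
  have hE : ∀ u : (ZMod p)ˣ, (equatorDisk p u).conj ⊆ repSphereSectors p u := fun u =>
    sphereDisk_conj_subset u le_rfl (by norm_num) _ _
  have hO : (outerDisk p i).conj ⊆ repSphereSectors p i :=
    sphereDisk_conj_subset i (by norm_num) le_rfl _ _
  refine ConjDisk.exists_isPolePair_glue _ _ (B := (ConjDisk.survive _ _ _ _).conj)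
    (C := repSphereSectors p k)
    (ConjDisk.exists_isPolePair_glue _ _ (exists_isPolePair_repSphere i)
      (exists_isPolePair_repSphere j) (hE i) (hE j)
      (fun z hz => hO (ConjDisk.val_mem_conj_of_inl_mem hz))
      (fun z hz => absurd hz ConjDisk.inr_notMem_conj))
    (exists_isPolePair_repSphere k) le_rfl (hE k) (fun z hz => hz.elim) fun z hz => hz.elim

lemma ncard_sphSix_fixedSet [Fact p.Prime] (i j k : (ZMod p)ˣ) :
    (sphSix p i j k).fixedSet.ncard = 6 := by
  have h : (sphSix p i j k).fixedSet.encard = 2 + 2 + 2 := by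
    refine (ConjDisk.encard_glue_fixedSet _ _).trans (congrArg₂ _
      ((ConjDisk.encard_glue_fixedSet _ _).trans (congrArg₂ _ ?_ ?_)) ?_) <;>
    exact encard_repSphere_fixedSet _
  rw [Set.ncard, h]
  rfl

/-! ### Circle-valued functions on the polygon -/

lemma circleDeg_affine_iff {f : ℂ → Circle} {c : ℂ} {r : ℝ} (hr : 0 < r) (ω : Circle) {n : ℤ} :
    CircleDeg (fun w => f (c + r * ω * w)) 0 1 n ↔ CircleDeg f c r n := by
  have hr0 : (r : ℂ) ≠ 0 := by exact_mod_cast hr.ne'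
  have hω : (ω : ℂ) ≠ 0 := Circle.coe_ne_zero ω
  have hdir : ∀ w : ℂ, w ≠ 0 → dir (r * ω * w) = ω * dir w := fun w hw => by
    rw [dir_mul (mul_ne_zero hr0 hω) hw, dir_mul hr0 hω, dir_ofReal hr, one_mul, dir_circle]
  have hexp : Circle.exp (n * arg ω) = ω ^ n := by
    rw [← zsmul_eq_mul, Circle.exp_zsmul, Circle.exp_arg]
  constructor
  · rintro ⟨φ, hφ, h⟩
    have hmem : ∀ z ∈ sphere c r, (z - c) / (r * ω) ∈ sphere (0 : ℂ) 1 := fun z hz => by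
      rw [mem_sphere, dist_eq_norm] at hz
      rw [mem_sphere_zero_iff_norm, norm_div, norm_mul, norm_real, Real.norm_eq_abs,
        abs_of_pos hr, Circle.norm_coe, mul_one, hz, div_self hr.ne']
    refine ⟨fun z => φ ((z - c) / (r * ω)) - n * arg ω, ?_, fun z hz => ?_⟩
    · exact (hφ.comp (Continuous.continuousOn (by fun_prop)) hmem).sub continuousOn_const
    · have hz' := hmem z hz
      have h0 : (z - c) / (r * ω) ≠ 0 := fun h0 => by
        rw [h0, mem_sphere_zero_iff_norm, norm_zero] at hz'
        exact zero_ne_one hz'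
      have h1 : (r : ℂ) * ω * ((z - c) / (r * ω)) = z - c := by field_simp
      have h2 := h _ hz'
      have h3 := hdir _ h0
      rw [h1] at h3
      simp only [h1, add_sub_cancel, sub_zero] at h2
      rw [h2, h3, Circle.exp_sub, hexp, mul_zpow]
      rw [mul_comm (ω ^ n), mul_assoc, mul_div_cancel]
  · rintro ⟨φ, hφ, h⟩
    have hmem : ∀ w ∈ sphere (0 : ℂ) 1, c + r * ω * w ∈ sphere c r := fun w hw => by
      rw [mem_sphere_zero_iff_norm] at hw
      rw [mem_sphere, dist_eq_norm, add_sub_cancel_left, norm_mul, norm_mul, norm_real,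
        Real.norm_eq_abs, abs_of_pos hr, Circle.norm_coe, hw, mul_one, mul_one]
    refine ⟨fun w => φ (c + r * ω * w) + n * arg ω, ?_, fun w hw => ?_⟩
    · exact (hφ.comp (Continuous.continuousOn (by fun_prop)) hmem).add continuousOn_const
    · have h0 : w ≠ 0 := fun h0 => by
        rw [h0, mem_sphere_zero_iff_norm, norm_zero] at hw
        exact zero_ne_one hw
      simp only [h _ (hmem w hw)]
      rw [add_sub_cancel_left, sub_zero, hdir w h0, Circle.exp_add, hexp, mul_zpow,
        mul_comm (ω ^ n), mul_assoc, mul_comm (ω ^ n)]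

lemma three_le [Fact p.Prime] (hp : Odd p) : 3 ≤ p := by
  have := (Fact.out : p.Prime).two_le
  obtain ⟨k, rfl⟩ := hp
  omega

lemma mem_truncDisk_of_norm_le [NeZero p] (h3 : 3 ≤ p) {z : ℂ} (hz : ‖z‖ ≤ 2 / 3) :
    z ∈ truncDisk p (1 / (2 * p)) := by
  refine ⟨by linarith, fun m ξ h => ?_⟩
  by_contra! hξ
  have h1 : (1 : ℝ) / (2 * p) ≤ 1 / 6 := by
    have : (3 : ℝ) ≤ p := by exact_mod_cast h3
    exact one_div_le_one_div_of_le (by norm_num) (by linarith)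
  have h2 := (le_abs_self _).trans (abs_im_le_norm ξ)
  have h4 := Real.add_one_le_exp (-ξ.im)
  rw [h, norm_cornerPt] at hz
  linarith

/-- The degrees of a circle-valued function on the complement of some round disks in the quotient
of the polygon: the sum over all holes and over the two vertices of the quotient vanishes. -/
lemma polygon_relation [Fact p.Prime] (hp : Odd p) {H : Quot (EdgeRel p) → Circle} {ι : Type*}
    [Fintype ι] (c : ι → ℂ) (r : ι → ℝ) (hr : ∀ i, 0 < r i)
    (hd : ∀ i j, i ≠ j → r i + r j < ‖c i - c j‖) (hc : ∀ i, ‖c i‖ + r i ≤ 2 / 3)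
    (hH : ContinuousOn (fun z => H (polyMk p z))
      {z ∈ truncDisk p (1 / (2 * p)) | ∀ i, r i ≤ ‖z - c i‖})
    {d : ι → ℤ} (hdeg : ∀ i, CircleDeg (fun z => H (polyMk p z)) (c i) (r i) (d i))
    (hG : ∀ ε, ContinuousOn (fun w => H (vertexMap p ε w)) (ball 0 (vertexRadius p) \ {0}))
    {e₀ e₁ : ℤ} (h₀ : PunctDeg (fun w => H (vertexMap p 0 w)) e₀)
    (h₁ : PunctDeg (fun w => H (vertexMap p 1 w)) e₁) : ∑ i, d i + e₀ + e₁ = 0 := by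
  have h3 := three_le hp
  have h3' : (3 : ℝ) ≤ p := by exact_mod_cast h3
  have hp0 : (0 : ℝ) < p := by linarith
  have hpi := Real.pi_gt_three
  have hq0 : (0 : ℝ) < 1 / (2 * p) := by positivity
  have hq6 : (1 : ℝ) / (2 * p) ≤ 1 / 6 := one_div_le_one_div_of_le (by norm_num) (by linarith)
  have hqp : (1 : ℝ) / (2 * p) < 1 / p := by
    apply one_div_lt_one_div_of_lt <;> linarith
  -- the holes and the points of modulus at most `2 / 3` are away from the half disks of radius
  -- `1 / (2 p)` about the corners, along which the variation is taken
  obtain ⟨Φ, hΦ, hF⟩ := exists_log_outside_holes (isClosed_truncDisk _) (starConvex_truncDisk _)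
    c r hr hd (fun i z hz => mem_truncDisk_of_norm_le h3 (by
      rw [mem_closedBall, dist_eq_norm] at hz
      have := norm_le_norm_sub_add z (c i)
      linarith [hc i])) hH hdeg (R := 2 / 3) (fun i => by linarith [hc i, hr i]) (by norm_num)
  have hrad : (1 / (2 * p) : ℝ) ^ (2 / p : ℝ) < vertexRadius p :=
    Real.rpow_lt_rpow hq0.le hqp (by positivity)
  have hrad0 : 0 < (1 / (2 * p) : ℝ) ^ (2 / p : ℝ) := Real.rpow_pos_of_pos hq0 _
  refine polygon_degree_sum hp hq0 ?_ (R := 2 / 3) ?_ hΦ (fun z hz hR => hF z hz hR fun i => ?_)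
    (fun m s h0 h1 => ?_) (h₀.circleDeg vertexRadius_pos (hG 0) hrad0 hrad)
    (h₁.circleDeg vertexRadius_pos (hG 1) hrad0 hrad)
    (fun m ξ hm hξ him => ?_) (fun m ξ hm hξ him => ?_)
  · rw [mul_one_div, show (2 : ℝ) / (2 * p) = 1 / p by field_simp]
    gcongr
    linarith
  · have := Real.add_one_le_exp (-(1 / (2 * p) : ℝ))
    linarith
  · have := norm_sub_norm_le z (c i)
    linarith [hc i]
  · have := polyMk_edge (p := p) m (s := s) (by linarith) (by linarith)
    rw [ofReal_neg] at this
    exact congrArg H this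
  · exact congrArg H (vertexMap_cornerCoord hp (m := m) (ε := 0) (Int.even_iff.1 hm)
      ⟨him, by linarith⟩).symm
  · exact congrArg H (vertexMap_cornerCoord hp (m := m) (ε := 1) (Int.odd_iff.1 hm)
      ⟨him, by linarith⟩).symm

/-! ### A disk about the origin together with a ring of disks -/

/-- The origin, and the points of modulus `A` whose directions are the `p`-th roots of unity. -/
noncomputable def ringCenter [NeZero p] (u : (ZMod p)ˣ) (A : ℝ) (i : Option (ZMod p)) : ℂ :=
  i.elim 0 fun k => ZMod.toCircle (k * (u : ZMod p)) * A

/-- The radius `ρ` for the origin, and the radius `s` for the points of the ring. -/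
def ringRadius (ρ s : ℝ) (i : Option (ZMod p)) : ℝ := i.elim ρ fun _ => s

lemma norm_ringCenter_some [NeZero p] (u : (ZMod p)ˣ) {A : ℝ} (hA : 0 < A) (k : ZMod p) :
    ‖ringCenter u A (some k)‖ = A := by
  rw [ringCenter, Option.elim_some, norm_mul, Circle.norm_coe, one_mul, norm_real,
    Real.norm_eq_abs, abs_of_pos hA]

lemma norm_ringCenter_le [NeZero p] (u : (ZMod p)ˣ) {A : ℝ} (hA : 0 < A) (i : Option (ZMod p)) :
    ‖ringCenter u A i‖ ≤ A := by
  rcases i with _ | k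
  · simpa [ringCenter] using hA.le
  · exact (norm_ringCenter_some u hA k).le

lemma ring_disjoint [Fact p.Prime] (u : (ZMod p)ˣ) {A ρ s : ℝ} (h1 : ρ + s < A)
    (h2 : p * s < 2 * A) (hA : 0 < A) (i j : Option (ZMod p)) (hij : i ≠ j) :
    ringRadius ρ s i + ringRadius ρ s j < ‖ringCenter u A i - ringCenter u A j‖ := by
  have hp0 : (0 : ℝ) < p := by exact_mod_cast NeZero.pos p
  rcases i with _ | k <;> rcases j with _ | l
  · exact absurd rfl hij
  · rw [← norm_neg, neg_sub, show ringCenter u A none = 0 from rfl, sub_zero,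
      norm_ringCenter_some u hA]
    exact h1
  · rw [show ringCenter u A none = 0 from rfl, sub_zero, norm_ringCenter_some u hA]
    exact (add_comm s ρ).trans_lt h1
  · have hkl : (k - l) * (u : ZMod p) ≠ 0 :=
      mul_ne_zero (sub_ne_zero.2 fun h => hij (congrArg some h)) u.ne_zero
    have h3 := four_div_le_norm_toCircle_sub_one _ hkl
    have h4 : ‖ringCenter u A (some k) - ringCenter u A (some l)‖
        = ‖(ZMod.toCircle ((k - l) * (u : ZMod p)) : ℂ) - 1‖ * A := by
      have h5 : (ringCenter u A (some k) - ringCenter u A (some l))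
          = ZMod.toCircle (l * (u : ZMod p))
            * (((ZMod.toCircle ((k - l) * (u : ZMod p)) : ℂ) - 1) * A) := by
        have h6 : (ZMod.toCircle (k * (u : ZMod p)) : ℂ)
            = ZMod.toCircle (l * (u : ZMod p)) * ZMod.toCircle ((k - l) * (u : ZMod p)) := by
          rw [← Circle.coe_mul, ← AddChar.map_add_eq_mul]
          congr 2
          ring
        simp only [ringCenter, Option.elim_some, h6]
        ring
      rw [h5, norm_mul, Circle.norm_coe, one_mul, norm_mul, norm_real, Real.norm_eq_abs,
        abs_of_pos hA]
    rw [h4]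
    simp only [ringRadius, Option.elim_some]
    have h7 : 4 / (p : ℝ) * A ≤ ‖(ZMod.toCircle ((k - l) * (u : ZMod p)) : ℂ) - 1‖ * A := by gcongr
    refine lt_of_lt_of_le ?_ h7
    rw [div_mul_eq_mul_div, lt_div_iff₀ hp0]
    linarith

/-! ### Charts of the polygon -/

/-- The chart at the centre of the polygon. -/
noncomputable def polyCenterChart [NeZero p] (u : (ZMod p)ˣ) (R : ℝ) (hR : 0 < R) (hR1 : R ≤ 1) :
    RotChart (poly1 p u) (u : ZMod p) where
  radius := R
  radius_pos := hR
  toFun w := polyMk p w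
  isOpenEmbedding := by
    have hlt : ∀ w : ball (0 : ℂ) R, ‖(toDisk w : ℂ)‖ < 1 ∧ (toDisk w : ℂ) = w := fun w => by
      have h1 := (mem_ball_zero_iff.1 w.2).trans_le hR1
      rw [coe_toDisk h1.le]
      exact ⟨h1, rfl⟩
    refine IsOpenEmbedding.of_continuous_injective_isOpenMap ?_ ?_ ?_
    · exact continuous_polyMk.comp continuous_subtype_val
    · intro w w' h
      have h1 := congrArg Subtype.val (edgeRel_mk_eq (hlt w').1 h)
      exact Subtype.ext ((hlt w).2.symm.trans (h1.trans (hlt w').2))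
    · intro U hU
      have hU' : IsOpen (Subtype.val '' U : Set ℂ) := isOpen_ball.isOpenMap_subtype_val U hU
      refine isOpen_coinduced.2 (isOpen_induced_iff.2 ⟨_, hU', ?_⟩)
      ext z
      constructor
      · rintro ⟨w, hw, hz⟩
        exact ⟨w, hw, (congrArg (polyMk p) hz).trans (polyMk_coe z)⟩
      · rintro ⟨w, hw, hz⟩
        have h1 := edgeRel_mk_eq (hlt w).1 hz.symm
        exact ⟨w, hw, (hlt w).2.symm.trans (congrArg Subtype.val h1).symm⟩
  act_toFun w w' h := by
    rw [h]
    exact poly1_act_polyMk u _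

/-- The chart at the common image of the vertices of the same parity as `ε`. -/
noncomputable def polyVertexChart [NeZero p] (hp : Odd p) (u : (ZMod p)ˣ) (ε : ℤ) :
    RotChart (poly1 p u) (-2 * (u : ZMod p)) where
  radius := vertexRadius p
  radius_pos := vertexRadius_pos
  toFun w := vertexMap p ε w
  isOpenEmbedding := by
    have hle : ∀ w : ball (0 : ℂ) (vertexRadius p), ‖(w : ℂ)‖ ≤ vertexRadius p := fun w =>
      (mem_ball_zero_iff.1 w.2).le
    refine IsOpenEmbedding.of_continuous_injective_isOpenMap ?_ ?_ ?_
    · exact ((continuousOn_vertexMap hp ε).mono ball_subset_closedBall).domRestrict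
    · intro w w' h
      exact Subtype.ext (vertexMap_inj hp (hle w) (hle w') h).2
    · intro U hU
      have hU' : IsOpen (Subtype.val '' U : Set ℂ) := isOpen_ball.isOpenMap_subtype_val U hU
      have h1 := isOpen_image_vertexMap hp ε hU' (by
        rintro _ ⟨w, -, rfl⟩
        exact w.2)
      rwa [image_image] at h1
  act_toFun w w' h := by
    rw [h]
    exact poly1_act_vertexMap hp u ε (mem_ball_zero_iff.1 w.2).le

/-! ### Restriction of functions to the pieces of a glued space -/

lemma RotChart.HasDeg.punctDeg [NeZero p] {X : CpSpace p} {u : ZMod p} {c : RotChart X u}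
    {f : X.carrier → Circle} {n : ℤ} (h : c.HasDeg f n) {g : ℂ → Circle}
    (hg : ∀ w : ball (0 : ℂ) c.radius, g w = f (c.toFun w)) : PunctDeg g n := by
  refine PunctDeg.congr h c.radius_pos fun z _ hz => ?_
  exact (hg ⟨z, mem_ball_zero_iff.2 hz⟩).trans (congrArg f (c.ext_coe ⟨z, _⟩).symm)

namespace ConjDisk

variable [NeZero p] {X Y : CpSpace p} (D : ConjDisk X) (E : ConjDisk Y)

/-- The restriction of a function on a glued space to the first piece, extended by `1`. -/
noncomputable def pullInl (f : (D.glue E).carrier → Circle) : X.carrier → Circle :=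
  Function.extend (fun x : D.compl.carrier => x.1) (fun x => f (D.inl E x)) fun _ => 1

/-- The restriction of a function on a glued space to the second piece, extended by `1`. -/
noncomputable def pullInr (f : (D.glue E).carrier → Circle) : Y.carrier → Circle :=
  Function.extend (fun y : E.compl.carrier => y.1) (fun y => f (D.inr E y)) fun _ => 1

variable {f : (D.glue E).carrier → Circle}

lemma pullInl_apply (x : D.compl.carrier) : D.pullInl E f x.1 = f (D.inl E x) :=
  Subtype.val_injective.extend_apply _ _ x

lemma pullInr_apply (y : E.compl.carrier) : D.pullInr E f y.1 = f (D.inr E y) :=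
  Subtype.val_injective.extend_apply _ _ y

lemma continuousOn_pullInl {S : Set (D.glue E).carrier} (hf : ContinuousOn f S)
    {T : Set X.carrier} (hT : ∀ x ∈ T, ∃ z : D.compl.carrier, z.1 = x ∧ D.inl E z ∈ S) :
    ContinuousOn (D.pullInl E f) T := by
  have h1 : ContinuousOn (D.pullInl E f)
      ((fun x : D.compl.carrier => x.1) '' (D.inl E ⁻¹' S)) := by
    refine (IsInducing.subtypeVal.continuousOn_image_iff (s := D.inl E ⁻¹' S)).2 ?_
    refine ContinuousOn.congr (f := fun x => f (D.inl E x)) ?_ fun x _ => D.pullInl_apply E x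
    exact hf.comp (continuous_quot_mk.comp continuous_inl).continuousOn fun x hx => hx
  refine h1.mono fun x hx => ?_
  obtain ⟨z, rfl, hz⟩ := hT x hx
  exact ⟨z, hz, rfl⟩

lemma continuousOn_pullInr {S : Set (D.glue E).carrier} (hf : ContinuousOn f S)
    {T : Set Y.carrier} (hT : ∀ y ∈ T, ∃ z : E.compl.carrier, z.1 = y ∧ D.inr E z ∈ S) :
    ContinuousOn (D.pullInr E f) T := by
  have h1 : ContinuousOn (D.pullInr E f)
      ((fun x : E.compl.carrier => x.1) '' (D.inr E ⁻¹' S)) := by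
    refine (IsInducing.subtypeVal.continuousOn_image_iff (s := D.inr E ⁻¹' S)).2 ?_
    refine ContinuousOn.congr (f := fun x => f (D.inr E x)) ?_ fun x _ => D.pullInr_apply E x
    exact hf.comp (continuous_quot_mk.comp continuous_inr).continuousOn fun x hx => hx
  refine h1.mono fun x hx => ?_
  obtain ⟨z, rfl, hz⟩ := hT x hx
  exact ⟨z, hz, rfl⟩

lemma boundary_mem_compl {w : UnitDisk} (hw : ‖(w : ℂ)‖ = 1) (k l : ℕ) (v : UnitDisk)
    (hv : ‖(v : ℂ)‖ < 1) : X.act^[l] (D.toFun v) ≠ X.act^[k] (D.toFun w) := fun h => by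
  rw [(D.param_unique h).2, hw] at hv
  exact lt_irrefl _ hv

/-- The restrictions to the two pieces agree along the glued circles. -/
lemma pullInl_eq_pullInr {w : UnitDisk} (hw : ‖(w : ℂ)‖ = 1) (k : ℕ) :
    D.pullInl E f (X.act^[k] (D.toFun w)) = D.pullInr E f (Y.act^[k] (E.toFun w)) := by
  refine (D.pullInl_apply E ⟨_, D.boundary_mem_compl hw k⟩).trans
    (Eq.trans (congrArg f ?_) (D.pullInr_apply E ⟨_, E.boundary_mem_compl hw k⟩).symm)
  exact Quot.sound (CpSpace.GlueRel.mk ⟨k, w, hw, rfl, rfl⟩)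

lemma inl_mem_fixedSet_iff {x : D.compl.carrier} :
    D.inl E x ∈ (D.glue E).fixedSet ↔ x.1 ∈ X.fixedSet :=
  (D.inl_injective E).eq_iff.trans Subtype.ext_iff

lemma inr_mem_fixedSet_iff {y : E.compl.carrier} :
    D.inr E y ∈ (D.glue E).fixedSet ↔ y.1 ∈ Y.fixedSet :=
  (D.inr_injective E).eq_iff.trans Subtype.ext_iff

lemma hasDeg_pullInl {a : ZMod p} {c : RotChart X a} {h : ∀ w, c.toFun w ∉ D.conj} {n : ℤ}
    (hf : (D.chartInl E c h).HasDeg f n) : c.HasDeg (D.pullInl E f) n :=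
  hf.of_comp rfl fun w hw => D.pullInl_apply E ⟨c.toFun ⟨w, hw⟩, D.mem_compl_of_notMem_conj (h _)⟩

lemma hasDeg_pullInr {a : ZMod p} {c : RotChart Y a} {h : ∀ w, c.toFun w ∉ E.conj} {n : ℤ}
    (hf : (D.chartInr E c h).HasDeg f n) : c.HasDeg (D.pullInr E f) n :=
  hf.of_comp rfl fun w hw => D.pullInr_apply E ⟨c.toFun ⟨w, hw⟩, E.mem_compl_of_notMem_conj (h _)⟩

end ConjDisk

namespace FixedDisk

variable [NeZero p] {X Y : CpSpace p} {u : (ZMod p)ˣ} (D : FixedDisk X u) (E : FixedDisk Y u)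

/-- The restriction of a function on a glued space to the first piece, extended by `1`. -/
noncomputable def pullInl (f : (D.glue E).carrier → Circle) : X.carrier → Circle :=
  Function.extend (fun x : D.compl.carrier => x.1) (fun x => f (D.inl E x)) fun _ => 1

/-- The restriction of a function on a glued space to the second piece, extended by `1`. -/
noncomputable def pullInr (f : (D.glue E).carrier → Circle) : Y.carrier → Circle :=
  Function.extend (fun y : E.compl.carrier => y.1) (fun y => f (D.inr E y)) fun _ => 1

variable {f : (D.glue E).carrier → Circle}

lemma pullInl_apply (x : D.compl.carrier) : D.pullInl E f x.1 = f (D.inl E x) :=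
  Subtype.val_injective.extend_apply _ _ x

lemma pullInr_apply (y : E.compl.carrier) : D.pullInr E f y.1 = f (D.inr E y) :=
  Subtype.val_injective.extend_apply _ _ y

lemma inl_injective : Function.Injective (D.inl E) :=
  CpSpace.glue_inl_injective fun _ _ _ => D.rel_left_unique E

lemma inr_injective : Function.Injective (D.inr E) :=
  CpSpace.glue_inr_injective fun _ _ _ => D.rel_right_unique E

lemma inl_mem_fixedSet_iff {x : D.compl.carrier} :
    D.inl E x ∈ (D.glue E).fixedSet ↔ x.1 ∈ X.fixedSet :=
  (D.inl_injective E).eq_iff.trans Subtype.ext_iff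

lemma inr_mem_fixedSet_iff {y : E.compl.carrier} :
    D.inr E y ∈ (D.glue E).fixedSet ↔ y.1 ∈ Y.fixedSet :=
  (D.inr_injective E).eq_iff.trans Subtype.ext_iff

lemma continuousOn_pullInl (hf : ContinuousOn f (D.glue E).fixedSetᶜ) :
    ContinuousOn (D.pullInl E f)
      {x | (∀ w : UnitDisk, ‖(w : ℂ)‖ < 1 → D.toFun w ≠ x) ∧ x ∉ X.fixedSet} := by
  have h1 : ContinuousOn (D.pullInl E f)
      ((fun x : D.compl.carrier => x.1) '' (D.inl E ⁻¹' (D.glue E).fixedSetᶜ)) := by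
    refine (IsInducing.subtypeVal.continuousOn_image_iff (s := D.inl E ⁻¹' _)).2 ?_
    refine ContinuousOn.congr (f := fun x => f (D.inl E x)) ?_ fun x _ => D.pullInl_apply E x
    exact hf.comp (continuous_quot_mk.comp continuous_inl).continuousOn fun x hx => hx
  exact h1.mono fun x hx => ⟨⟨x, hx.1⟩, fun h => hx.2 ((D.inl_mem_fixedSet_iff E).1 h), rfl⟩

lemma continuousOn_pullInr (hf : ContinuousOn f (D.glue E).fixedSetᶜ) :
    ContinuousOn (D.pullInr E f)
      {x | (∀ w : UnitDisk, ‖(w : ℂ)‖ < 1 → E.toFun w ≠ x) ∧ x ∉ Y.fixedSet} := by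
  have h1 : ContinuousOn (D.pullInr E f)
      ((fun x : E.compl.carrier => x.1) '' (D.inr E ⁻¹' (D.glue E).fixedSetᶜ)) := by
    refine (IsInducing.subtypeVal.continuousOn_image_iff (s := D.inr E ⁻¹' _)).2 ?_
    refine ContinuousOn.congr (f := fun x => f (D.inr E x)) ?_ fun x _ => D.pullInr_apply E x
    exact hf.comp (continuous_quot_mk.comp continuous_inr).continuousOn fun x hx => hx
  exact h1.mono fun x hx => ⟨⟨x, hx.1⟩, fun h => hx.2 ((D.inr_mem_fixedSet_iff E).1 h), rfl⟩

lemma boundary_mem_compl {w : UnitDisk} (hw : ‖(w : ℂ)‖ = 1) (v : UnitDisk)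
    (hv : ‖(v : ℂ)‖ < 1) : D.toFun v ≠ D.toFun w := fun h => by
  rw [D.injective_toFun h, hw] at hv
  exact lt_irrefl _ hv

/-- The restrictions to the two pieces agree along the glued circle. -/
lemma pullInl_eq_pullInr {w : UnitDisk} (hw : ‖(w : ℂ)‖ = 1) :
    D.pullInl E f (D.toFun w) = D.pullInr E f (E.toFun w) := by
  refine (D.pullInl_apply E ⟨_, D.boundary_mem_compl hw⟩).trans
    (Eq.trans (congrArg f ?_) (D.pullInr_apply E ⟨_, E.boundary_mem_compl hw⟩).symm)
  exact Quot.sound (CpSpace.GlueRel.mk ⟨w, hw, rfl, rfl⟩)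

lemma hasDeg_pullInl {a : ZMod p} {c : RotChart X a} {h : ∀ w, c.toFun w ∉ range D.toFun} {n : ℤ}
    (hf : (D.chartInl E c h).HasDeg f n) : c.HasDeg (D.pullInl E f) n :=
  hf.of_comp rfl fun w hw => D.pullInl_apply E ⟨c.toFun ⟨w, hw⟩, fun v _ hv => h _ ⟨v, hv⟩⟩

lemma hasDeg_pullInr {a : ZMod p} {c : RotChart Y a} {h : ∀ w, c.toFun w ∉ range E.toFun} {n : ℤ}
    (hf : (D.chartInr E c h).HasDeg f n) : c.HasDeg (D.pullInr E f) n :=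
  hf.of_comp rfl fun w hw => D.pullInr_apply E ⟨c.toFun ⟨w, hw⟩, fun v _ hv => h _ ⟨v, hv⟩⟩

end FixedDisk

/-! ### The relation between the degrees on the tower of two polygons -/

lemma le_norm_sub_of_mem_sphere {ι : Type*} {c : ι → ℂ} {r : ι → ℝ}
    (hd : ∀ i j, i ≠ j → r i + r j < ‖c i - c j‖) {i : ι} {z : ℂ} (hz : z ∈ sphere (c i) (r i))
    (j : ι) : r j ≤ ‖z - c j‖ := by
  rw [mem_sphere, dist_eq_norm] at hz
  rcases eq_or_ne i j with rfl | hij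
  · exact hz.ge
  · have h1 := hd i j hij
    have h2 := norm_sub_le_norm_sub_add_norm_sub (c i) z (c j)
    rw [norm_sub_rev (c i) z] at h2
    linarith

/-- Let `hU`, `hS` and `hV` be circle-valued functions on the first polygon, on the plane and on
the second polygon, continuous away from the removed disks and from the fixed points, and with the
same values along glued circles. The sum of their degrees at the fixed points vanishes: this is
the sum of the relations for the two polygons and for the plane, in which the degrees along the
glued circles cancel. -/
lemma degree_sum_of_pieces [Fact p.Prime] (hp : Odd p) (u v : (ZMod p)ˣ)
    {hU hV : Quot (EdgeRel p) → Circle} {hS : ℂ → Circle}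
    (cU : ContinuousOn (fun z => hU (polyMk p z)) {z ∈ truncDisk p (1 / (2 * p)) |
      z ≠ 0 ∧ ∀ k, 1 / (2 * p) ≤ ‖z - ringCenter u (1 / 2) (some k)‖})
    (cU' : ∀ ε, ContinuousOn (fun w => hU (vertexMap p ε w)) (ball 0 (vertexRadius p) \ {0}))
    (cS : ContinuousOn hS {z | 1 / 4 ≤ ‖z‖ ∧ ∀ k, 1 / p ≤ ‖z - ringCenter v 1 (some k)‖})
    (cV : ContinuousOn (fun z => hV (polyMk p z)) {z ∈ truncDisk p (1 / (2 * p)) | 1 / 2 ≤ ‖z‖})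
    (cV' : ∀ ε, ContinuousOn (fun w => hV (vertexMap p ε w)) (ball 0 (vertexRadius p) \ {0}))
    (hUS : ∀ (k : ZMod p) (w : ℂ), ‖w‖ = 1 →
      hU (polyMk p (ZMod.toCircle (k * (u : ZMod p)) * ((1 / 2 : ℝ) + (1 / (2 * p) : ℝ) * w)))
        = hS (ZMod.toCircle (k * (v : ZMod p)) * ((1 : ℝ) + (1 / p : ℝ) * w)))
    (hSV : ∀ w : ℂ, ‖w‖ = 1 → hS ((1 / 4 : ℝ) * w) = hV (polyMk p ((1 / 2 : ℝ) * w)))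
    {n e₀ e₁ m d₀ d₁ : ℤ} (hn : PunctDeg (fun z => hU (polyMk p z)) n)
    (he₀ : PunctDeg (fun w => hU (vertexMap p 0 w)) e₀)
    (he₁ : PunctDeg (fun w => hU (vertexMap p 1 w)) e₁)
    (hm : PunctDeg (fun w => hS (starRingEnd ℂ w)⁻¹) m)
    (hd₀ : PunctDeg (fun w => hV (vertexMap p 0 w)) d₀)
    (hd₁ : PunctDeg (fun w => hV (vertexMap p 1 w)) d₁) :
    n + e₀ + e₁ + m + d₀ + d₁ = 0 := by
  have h3 := three_le hp
  have h3' : (3 : ℝ) ≤ p := by exact_mod_cast h3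
  have hp0 : (0 : ℝ) < p := by linarith
  have hq0 : (0 : ℝ) < 1 / (2 * p) := by positivity
  have hq6 : (1 : ℝ) / (2 * p) ≤ 1 / 6 := one_div_le_one_div_of_le (by norm_num) (by linarith)
  have hs0 : (0 : ℝ) < 1 / p := by positivity
  have hs3 : (1 : ℝ) / p ≤ 1 / 3 := one_div_le_one_div_of_le (by norm_num) h3'
  -- the holes of the first polygon and of the plane: the disks removed in the ribbon surgery, a
  -- disk of radius `1 / 8` about the fixed point at the centre of the polygon, and the disk removed
  -- about the pole `0` of the ribbon
  set cu := ringCenter u (1 / 2) with hcu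
  set ru := ringRadius (p := p) (1 / 8) (1 / (2 * p)) with hru
  set cv := ringCenter v 1 with hcv
  set rv := ringRadius (p := p) (1 / 4) (1 / p) with hrv
  have hru0 : ∀ i, 0 < ru i := by
    rintro (_ | k)
    · norm_num [hru, ringRadius]
    · exact hq0
  have hrv0 : ∀ i, 0 < rv i := by
    rintro (_ | k)
    · norm_num [hrv, ringRadius]
    · exact hs0
  have hdu : ∀ i j, i ≠ j → ru i + ru j < ‖cu i - cu j‖ :=
    ring_disjoint u (by linarith) (by field_simp; norm_num) (by norm_num)
  have hdv : ∀ i j, i ≠ j → rv i + rv j < ‖cv i - cv j‖ :=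
    ring_disjoint v (by linarith) (by field_simp; norm_num) (by norm_num)
  have hcru : ∀ i, ‖cu i‖ + ru i ≤ 2 / 3 := by
    rintro (_ | k)
    · simp only [hcu, hru, ringCenter, ringRadius, Option.elim_none, norm_zero]
      norm_num
    · rw [hcu, norm_ringCenter_some u (by norm_num)]
      simp only [hru, ringRadius, Option.elim_some]
      linarith
  have hrv1 : ∀ i, rv i ≤ 1 := by
    rintro (_ | k)
    · norm_num [hrv, ringRadius]
    · exact hs3.trans (by norm_num)
  have cU₁ : ContinuousOn (fun z => hU (polyMk p z))
      {z ∈ truncDisk p (1 / (2 * p)) | ∀ i, ru i ≤ ‖z - cu i‖} := by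
    refine cU.mono fun z hz => ⟨hz.1, ?_, fun k => hz.2 (some k)⟩
    rintro rfl
    have := hz.2 none
    norm_num [hru, hcu, ringRadius, ringCenter] at this
  have cS₁ : ContinuousOn hS {z ∈ univ | ∀ i, rv i ≤ ‖z - cv i‖} := by
    refine cS.mono fun z hz => ⟨?_, fun k => hz.2 (some k)⟩
    have := hz.2 none
    rwa [show cv none = 0 from rfl, sub_zero] at this
  -- the degrees along the boundaries of the holes
  have hdegU : ∀ i, ∃ d, CircleDeg (fun z => hU (polyMk p z)) (cu i) (ru i) d := fun i =>
    exists_circleDeg (hru0 i) (cU₁.mono fun z hz => ⟨mem_truncDisk_of_norm_le h3 (by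
      have h1 := norm_le_norm_sub_add z (cu i)
      have h2 : ‖z - cu i‖ = ru i := by rwa [mem_sphere, dist_eq_norm] at hz
      linarith [hcru i]), le_norm_sub_of_mem_sphere hdu hz⟩)
  have hdegS : ∀ i, ∃ d, CircleDeg hS (cv i) (rv i) d := fun i =>
    exists_circleDeg (hrv0 i) (cS₁.mono fun z hz =>
      ⟨mem_univ _, le_norm_sub_of_mem_sphere hdv hz⟩)
  choose dU hdU using hdegU
  choose dS hdS using hdegS
  have hsome : ∀ k, dU (some k) = dS (some k) := fun k => by
    have h1 := (circleDeg_affine_iff (hru0 (some k)) (ZMod.toCircle (k * (u : ZMod p)))).2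
      (hdU (some k))
    have h2 := (circleDeg_affine_iff (hrv0 (some k)) (ZMod.toCircle (k * (v : ZMod p)))).2
      (hdS (some k))
    refine h1.unique one_pos (h2.congr fun w hw => ?_)
    have h4 := hUS k w (mem_sphere_zero_iff_norm.1 hw)
    refine Eq.trans (congrArg (fun z => hU (polyMk p z)) ?_) (h4.trans (congrArg hS ?_))
    · simp only [hcu, hru, ringCenter, ringRadius, Option.elim_some]
      ring
    · simp only [hcv, hrv, ringCenter, ringRadius, Option.elim_some]
      ring
  have hnone : dU none = n := by
    refine (hdU none).unique (hru0 none) (hn.circleDeg (R := 1 / 4) (by norm_num) (cU.mono ?_)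
      (hru0 none) (by norm_num [hru, ringRadius]))
    intro z hz
    have hz1 : ‖z‖ < 1 / 4 := mem_ball_zero_iff.1 hz.1
    refine ⟨mem_truncDisk_of_norm_le h3 (by linarith), hz.2, fun k => ?_⟩
    have h1 := norm_sub_norm_le (ringCenter u (1 / 2) (some k)) z
    rw [norm_ringCenter_some u (by norm_num), norm_sub_rev] at h1
    linarith
  have relU := polygon_relation hp cu ru hru0 hdu hcru cU₁ hdU cU' he₀ he₁
  -- on the plane the degrees along the holes add up to the degree at `∞`
  have relS : ∑ i, dS i = m := by
    obtain ⟨φ, hφ, h⟩ := exists_log_outside_holes isClosed_univ (starConvex_univ (0 : ℂ)) cv rv hrv0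
      hdv (fun i => subset_univ _) cS₁ hdS (R := 2) (fun i =>
        (norm_ringCenter_le v one_pos i).trans_lt (by norm_num)) two_pos
    have hbig : ∀ w : ℂ, w ≠ 0 → ‖w‖ < 1 / 2 → 2 ≤ ‖(starRingEnd ℂ w)⁻¹‖ := fun w h0 h1 => by
      rw [norm_inv, RCLike.norm_conj, le_inv_comm₀ two_pos (norm_pos_iff.2 h0)]
      linarith
    have hm' : PunctDeg (fun w => hS (starRingEnd ℂ w)⁻¹) (∑ i, dS i) := by
      refine ⟨1 / 2, by norm_num, fun w => φ (starRingEnd ℂ w)⁻¹, hφ.comp ?_ ?_, fun w h0 h1 => ?_⟩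
      · exact continuous_conj.continuousOn.inv₀ fun w hw => (map_ne_zero _).2 hw.2
      · exact fun w hw => ⟨mem_univ _, hbig w hw.2 (mem_ball_zero_iff.1 hw.1)⟩
      · have h2 := hbig w h0 h1
        have h4 := h _ (mem_univ _) h2 fun i => by
          have h5 := norm_sub_norm_le ((starRingEnd ℂ w)⁻¹) (cv i)
          have h6 := norm_ringCenter_le v one_pos i
          linarith [hrv1 i]
        rw [dir_inv_conj] at h4
        exact h4
    exact hm'.unique hm
  -- the only hole of the second polygon is glued to the one about the pole `0` of the ribbon
  have hsub : sphere (0 : ℂ) (1 / 2) ⊆ {z ∈ truncDisk p (1 / (2 * p)) | 1 / 2 ≤ ‖z‖} :=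
      fun z hz => by
    rw [mem_sphere_zero_iff_norm] at hz
    exact ⟨mem_truncDisk_of_norm_le h3 (by linarith), hz.ge⟩
  obtain ⟨b, hb⟩ := exists_circleDeg (by norm_num) (cV.mono hsub)
  have hbS : b = dS none := by
    have h1 := (circleDeg_affine_iff (by norm_num) 1).2 hb
    have h2 := (circleDeg_affine_iff (hrv0 none) 1).2 (hdS none)
    refine h1.unique one_pos (h2.congr fun w hw => ?_)
    have h4 := hSV w (mem_sphere_zero_iff_norm.1 hw)
    refine Eq.trans (congrArg (fun z => hV (polyMk p z)) ?_) (h4.symm.trans (congrArg hS ?_))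
    · push_cast
      simp
    · simp [hcv, hrv, ringCenter, ringRadius]
  have relV := polygon_relation hp (fun _ : Unit => 0) (fun _ => 1 / 2) (fun _ => by norm_num)
    (fun i j hij => absurd (Subsingleton.elim i j) hij) (fun _ => by norm_num)
    (cV.mono fun z hz => ⟨hz.1, by simpa using hz.2 ()⟩) (fun _ => hb) cV' hd₀ hd₁
  rw [Fintype.sum_option] at relU relS
  simp only [hsome] at relU
  simp only [Finset.univ_unique, Finset.sum_singleton] at relV
  linarith

/-! ### The fixed points of the tower of two polygons -/

/-- The first polygon after ribbon surgery. -/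
noncomputable abbrev polyRibbon (p : ℕ) [Fact p.Prime] (u v : (ZMod p)ˣ) : CpSpace p :=
  (polyConjDisk p u).glue (equatorDisk p v)

/-- The invariant disk about the pole `0` of the ribbon. -/
noncomputable abbrev ribbonPoleDisk (p : ℕ) [Fact p.Prime] (u v : (ZMod p)ˣ) :
    FixedDisk (polyRibbon p u v) v :=
  FixedDisk.survive (polyConjDisk p u) (equatorDisk p v) (poleDisk p v) (equatorDisk_ne_poleDisk v)

lemma polyMk_eq_iff {z z' : ℂ} (hz : ‖z‖ ≤ 1) (hz' : ‖z'‖ < 1) :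
    polyMk p z = polyMk p z' ↔ z = z' := by
  refine ⟨fun h => ?_, fun h => by rw [h]⟩
  have h1 := edgeRel_mk_eq (by rwa [coe_toDisk hz'.le]) h
  rw [← coe_toDisk hz, h1, coe_toDisk hz'.le]

lemma iterate_act_polyConjDisk [Fact p.Prime] (u : (ZMod p)ˣ) (k : ℕ) (w : UnitDisk) :
    (poly1 p u).act^[k] ((polyConjDisk p u).toFun w) = polyMk p
      (ZMod.toCircle ((k : ZMod p) * (u : ZMod p))
        * ((1 / 2 : ℝ) + (1 / (2 * p) : ℝ) * (w : ℂ))) := by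
  refine (poly1_iterate_act u k _).trans ?_
  rw [← polyMk_coe, iterate_rot]

lemma norm_ring_point [Fact p.Prime] (hp : Odd p) (ω : Circle) (w : UnitDisk) :
    1 / 3 ≤ ‖(ω : ℂ) * ((1 / 2 : ℝ) + (1 / (2 * p) : ℝ) * (w : ℂ))‖ ∧
      ‖(ω : ℂ) * ((1 / 2 : ℝ) + (1 / (2 * p) : ℝ) * (w : ℂ))‖ ≤ 2 / 3 := by
  have h3' : (3 : ℝ) ≤ p := by exact_mod_cast three_le hp
  have hq6 : (1 : ℝ) / (2 * p) ≤ 1 / 6 := one_div_le_one_div_of_le (by norm_num) (by linarith)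
  have hq0 : (0 : ℝ) < 1 / (2 * p) := by positivity
  have h1 : ‖((1 / (2 * p) : ℝ) : ℂ) * w‖ ≤ 1 / 6 := by
    rw [norm_mul, norm_real, Real.norm_eq_abs, abs_of_pos hq0]
    nlinarith [norm_nonneg (w : ℂ), w.norm_le]
  have h2 : ‖((1 / 2 : ℝ) : ℂ)‖ = 1 / 2 := by
    rw [norm_real, Real.norm_eq_abs, abs_of_pos (by norm_num)]
  have h4 := norm_sub_le_norm_add ((1 / 2 : ℝ) : ℂ) (((1 / (2 * p) : ℝ) : ℂ) * w)
  have h5 := norm_add_le ((1 / 2 : ℝ) : ℂ) (((1 / (2 * p) : ℝ) : ℂ) * w)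
  rw [norm_mul, Circle.norm_coe, one_mul]
  constructor <;> linarith

lemma vertexMap_ne_polyMk [Fact p.Prime] (hp : Odd p) {ε : ℤ} {w z : ℂ}
    (hw : ‖w‖ ≤ vertexRadius p) (hz : ‖z‖ ≤ 2 / 3) : vertexMap p ε w ≠ polyMk p z := fun h => by
  have h1 := ((mk_eq_vertexMap_iff hp hw (toDisk z)).1 h.symm).lt_norm (three_le hp)
  rw [coe_toDisk (by linarith)] at h1
  linarith

lemma polyMk_notMem_fixedSet [Fact p.Prime] (hp : Odd p) (u : (ZMod p)ˣ) {z : ℂ}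
    (hz : z ∈ truncDisk p (1 / (2 * p))) (h0 : z ≠ 0) :
    (polyMk p z : (poly1 p u).carrier) ∉ (poly1 p u).fixedSet := by
  have hp0 : (0 : ℝ) < p := by exact_mod_cast NeZero.pos p
  have hvert : ∀ ε, polyMk p z ≠ vertexMap p ε 0 := fun ε h => by
    obtain ⟨m, ξ, -, hξ, hzξ, hcoord⟩ := (mk_eq_vertexMap_iff hp
      (by simpa using (vertexRadius_pos (p := p)).le) (toDisk z)).1 h
    rw [coe_toDisk hz.1] at hzξ
    have h1 := hz.2 m ξ hzξ
    have h2 := norm_cornerCoord (p := p) m hξ.1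
    have hq0 : (0 : ℝ) < 1 / (2 * p) := by positivity
    rw [hcoord, norm_zero] at h2
    have h4 := Real.rpow_pos_of_pos (hq0.trans_le h1) (2 / p : ℝ)
    linarith
  rw [poly1_fixedSet hp]
  rintro (h | h | h)
  · exact h0 ((polyMk_eq_iff hz.1 (by simp)).1 h)
  · exact hvert 0 h
  · exact hvert 1 h

lemma vertexMap_notMem_fixedSet [Fact p.Prime] (hp : Odd p) (u : (ZMod p)ˣ) (ε : ℤ) {w : ℂ}
    (hw : ‖w‖ ≤ vertexRadius p) (h0 : w ≠ 0) :
    (vertexMap p ε w : (poly1 p u).carrier) ∉ (poly1 p u).fixedSet := by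
  have hR := (vertexRadius_pos (p := p)).le
  rw [poly1_fixedSet hp]
  rintro (h | h | h)
  · exact vertexMap_ne_polyMk hp hw (by rw [norm_zero]; norm_num) h
  · exact h0 (vertexMap_inj hp hw (by simpa using hR) h).2
  · exact h0 (vertexMap_inj hp hw (by simpa using hR) h).2

lemma encard_poly1_fixedSet [Fact p.Prime] (hp : Odd p) (u : (ZMod p)ˣ) :
    (poly1 p u).fixedSet.encard = 3 := by
  rw [poly1_fixedSet hp]
  exact encard_eq_three.2 ⟨_, _, _, polyMk_zero_ne_vertexMap hp 0, polyMk_zero_ne_vertexMap hp 1,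
    vertexMap_zero_ne hp, rfl⟩

lemma ncard_poly2_fixedSet [Fact p.Prime] (hp : Odd p) (u v : (ZMod p)ˣ) :
    (poly2 p u v).fixedSet.ncard = 6 := by
  have h1 : (polyRibbon p u v).fixedSet.encard = 3 + 2 :=
    (ConjDisk.encard_glue_fixedSet _ _).trans
      (congrArg₂ _ (encard_poly1_fixedSet hp u) (encard_repSphere_fixedSet v))
  have h2 : (ribbonPoleDisk p u v).compl.fixedSet.encard = 4 := by
    have h := (ribbonPoleDisk p u v).encard_compl_fixedSet
    rw [h1, show (3 + 2 : ℕ∞) = 4 + 1 by norm_num] at h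
    exact WithTop.add_right_cancel ENat.one_ne_top h
  have h3 : (polyCenterDisk p v).compl.fixedSet.encard = 2 := by
    have h := (polyCenterDisk p v).encard_compl_fixedSet
    rw [encard_poly1_fixedSet hp, show (3 : ℕ∞) = 2 + 1 by norm_num] at h
    exact WithTop.add_right_cancel ENat.one_ne_top h
  have h4 : (poly2 p u v).fixedSet.encard = 4 + 2 :=
    (FixedDisk.encard_glue_fixedSet _ _).trans (congrArg₂ _ h2 h3)
  rw [Set.ncard, h4]
  rfl

/-! ### Charts of the tower of two polygons -/

section

variable [Fact p.Prime]

lemma polyCenterChart_notMem (hp : Odd p) (u : (ZMod p)ˣ) (w : ball (0 : ℂ) (1 / 4)) :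
    polyMk p w ∉ (polyConjDisk p u).conj := by
  rintro ⟨k, v, h⟩
  have h1 := (iterate_act_polyConjDisk u k v).symm.trans h
  have h2 := norm_ring_point hp (ZMod.toCircle ((k : ZMod p) * (u : ZMod p))) v
  have h3 := mem_ball_zero_iff.1 w.2
  rw [(polyMk_eq_iff (by linarith) (by linarith)).1 h1] at h2
  linarith

lemma polyVertexChart_notMem (hp : Odd p) (u : (ZMod p)ˣ) (ε : ℤ)
    (w : ball (0 : ℂ) (vertexRadius p)) : vertexMap p ε w ∉ (polyConjDisk p u).conj := by
  rintro ⟨k, v, h⟩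
  have h1 := h.symm.trans (iterate_act_polyConjDisk u k v)
  exact vertexMap_ne_polyMk hp (mem_ball_zero_iff.1 w.2).le
    (norm_ring_point hp (ZMod.toCircle ((k : ZMod p) * (u : ZMod p))) v).2 h1

lemma polyVertexChart_notMem_range (hp : Odd p) (v : (ZMod p)ˣ) (ε : ℤ)
    (w : ball (0 : ℂ) (vertexRadius p)) : vertexMap p ε w ∉ range (polyCenterDisk p v).toFun := by
  rintro ⟨w', h⟩
  have h1 : polyMk p ((0 : ℝ) + (1 / 2 : ℝ) * (w' : ℂ)) = vertexMap p ε w :=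
    (polyMk_coe _).trans h
  refine vertexMap_ne_polyMk hp (mem_ball_zero_iff.1 w.2).le ?_ h1.symm
  rw [ofReal_zero, zero_add, norm_mul, norm_real, Real.norm_eq_abs, abs_of_pos (by norm_num)]
  linarith [w'.norm_le]

lemma inl_notMem_range_ribbonPoleDisk (u v : (ZMod p)ˣ) (x : (polyConjDisk p u).compl.carrier) :
    (polyConjDisk p u).inl (equatorDisk p v) x ∉ range (ribbonPoleDisk p u v).toFun := by
  rintro ⟨w, h⟩
  obtain ⟨k, w', -, -, h1⟩ := (polyConjDisk p u).rel_of_inl_eq_inr (equatorDisk p v) h.symm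
  exact equatorDisk_ne_poleDisk v k w' w h1

lemma sphereInv_notMem_conj (v : (ZMod p)ˣ) (w : ball (0 : ℂ) (1 / 4)) :
    sphereInv ((w : ℂ) : OnePoint ℂ) ∉ (equatorDisk p v).conj := by
  rintro ⟨k, w', h⟩
  have h1 := (repSphere_iterate_act v k _).symm.trans h
  rcases eq_or_ne (w : ℂ) 0 with h0 | h0
  · rw [h0, sphereInv_zero] at h1
    exact OnePoint.coe_ne_infty _ h1
  · rw [sphereInv_coe h0] at h1
    have h2 := congrArg norm (OnePoint.coe_injective h1)
    rw [norm_mul, Circle.norm_coe, one_mul, norm_inv, RCLike.norm_conj] at h2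
    have h3 := (equatorDisk_norm_aux (p := p) w').2
    have h4 : (1 / 4 : ℝ)⁻¹ < ‖(w : ℂ)‖⁻¹ :=
      (inv_lt_inv₀ (by norm_num) (norm_pos_iff.2 h0)).2 (mem_ball_zero_iff.1 w.2)
    norm_num at h4
    linarith

lemma sphereInv_ne_poleDisk (v : (ZMod p)ˣ) (w : ball (0 : ℂ) (1 / 4)) (w' : UnitDisk) :
    (poleDisk p v).toFun w' ≠ sphereInv ((w : ℂ) : OnePoint ℂ) := by
  intro h
  rcases eq_or_ne (w : ℂ) 0 with h0 | h0
  · rw [h0, sphereInv_zero] at h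
    exact OnePoint.coe_ne_infty _ h
  · rw [sphereInv_coe h0] at h
    have h2 := congrArg norm (OnePoint.coe_injective h)
    rw [norm_inv, RCLike.norm_conj, ofReal_zero, zero_add, norm_mul, norm_real, Real.norm_eq_abs,
      abs_of_pos (by norm_num)] at h2
    have h4 : (1 / 4 : ℝ)⁻¹ < ‖(w : ℂ)‖⁻¹ :=
      (inv_lt_inv₀ (by norm_num) (norm_pos_iff.2 h0)).2 (mem_ball_zero_iff.1 w.2)
    norm_num at h4
    linarith [w'.norm_le]

/-- A chart of the first polygon, in the tower of two polygons. -/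
noncomputable def poly2ChartInl (u v : (ZMod p)ˣ) {a : ZMod p} (c : RotChart (poly1 p u) a)
    (h : ∀ w, c.toFun w ∉ (polyConjDisk p u).conj) : RotChart (poly2 p u v) a :=
  (ribbonPoleDisk p u v).chartInl (polyCenterDisk p v)
    ((polyConjDisk p u).chartInl (equatorDisk p v) c h)
    fun _ => inl_notMem_range_ribbonPoleDisk u v _

lemma ribbonChartInfty_notMem_range (u v : (ZMod p)ˣ) (w : ball (0 : ℂ) (1 / 4)) :
    ((polyConjDisk p u).chartInr (equatorDisk p v) (repSphereChartInfty v (1 / 4) (by norm_num))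
      (sphereInv_notMem_conj v)).toFun w ∉ range (ribbonPoleDisk p u v).toFun := by
  rintro ⟨w', h⟩
  exact sphereInv_ne_poleDisk v w w' (congrArg Subtype.val
    ((polyConjDisk p u).inr_injective (equatorDisk p v) h))

/-- The chart of the tower of two polygons at the pole `∞` of the ribbon. -/
noncomputable def poly2ChartInfty (u v : (ZMod p)ˣ) : RotChart (poly2 p u v) (v : ZMod p) :=
  (ribbonPoleDisk p u v).chartInl (polyCenterDisk p v)
    ((polyConjDisk p u).chartInr (equatorDisk p v) (repSphereChartInfty v (1 / 4) (by norm_num))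
      (sphereInv_notMem_conj v))
    (ribbonChartInfty_notMem_range u v)

/-- The charts at the six fixed points of the tower of two polygons: the centre and the vertices of
the first polygon, the pole `∞` of the ribbon, and the vertices of the second polygon. The rotation
angles are `u, -2 u, -2 u, v, -2 v, -2 v`. -/
noncomputable def poly2Chart (hp : Odd p) (u v : (ZMod p)ˣ) :
    Fin 6 → Σ a : ZMod p, RotChart (poly2 p u v) a :=
  ![⟨_, poly2ChartInl u v (polyCenterChart u (1 / 4) (by norm_num) (by norm_num))
      (polyCenterChart_notMem hp u)⟩,
    ⟨_, poly2ChartInl u v (polyVertexChart hp u 0) (polyVertexChart_notMem hp u 0)⟩,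
    ⟨_, poly2ChartInl u v (polyVertexChart hp u 1) (polyVertexChart_notMem hp u 1)⟩,
    ⟨_, poly2ChartInfty u v⟩,
    ⟨_, (ribbonPoleDisk p u v).chartInr (polyCenterDisk p v) (polyVertexChart hp v 0)
      (polyVertexChart_notMem_range hp v 0)⟩,
    ⟨_, (ribbonPoleDisk p u v).chartInr (polyCenterDisk p v) (polyVertexChart hp v 1)
      (polyVertexChart_notMem_range hp v 1)⟩]

lemma exists_poly2Chart_center_eq (hp : Odd p) (u v : (ZMod p)ˣ) {x : (poly2 p u v).carrier}
    (hx : x ∈ (poly2 p u v).fixedSet) : ∃ i, (poly2Chart hp u v i).2.center = x := by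
  have h := (ribbonPoleDisk p u v).glue_fixedSet (polyCenterDisk p v)
  replace hx : x ∈ ((ribbonPoleDisk p u v).glue (polyCenterDisk p v)).fixedSet := hx
  rw [h] at hx
  obtain ⟨⟨y, hyc⟩, hy, rfl⟩ | ⟨⟨y, hyc⟩, hy, rfl⟩ := hx
  · replace hy : y ∈ (polyRibbon p u v).fixedSet := congrArg Subtype.val hy
    rw [ConjDisk.glue_fixedSet] at hy
    obtain ⟨⟨z, hzc⟩, hz, rfl⟩ | ⟨⟨z, hzc⟩, hz, rfl⟩ := hy
    · replace hz : z ∈ (poly1 p u).fixedSet := congrArg Subtype.val hz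
      rw [poly1_fixedSet hp] at hz
      obtain rfl | rfl | rfl := hz
      · exact ⟨0, rfl⟩
      · exact ⟨1, rfl⟩
      · exact ⟨2, rfl⟩
    · replace hz : z ∈ (repSphere p v).fixedSet := congrArg Subtype.val hz
      rw [repSphere_fixedSet] at hz
      obtain rfl | rfl := hz
      · refine absurd ?_ (hyc ⟨0, by simp⟩ (by simp))
        refine congrArg ((polyConjDisk p u).inr (equatorDisk p v)) (Subtype.ext ?_)
        refine congrArg (fun z : ℂ => (z : OnePoint ℂ)) ?_
        simp
      · refine ⟨3, ?_⟩
        refine congrArg ((ribbonPoleDisk p u v).inl (polyCenterDisk p v)) (Subtype.ext ?_)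
        exact congrArg ((polyConjDisk p u).inr (equatorDisk p v)) (Subtype.ext sphereInv_zero)
  · replace hy : y ∈ (poly1 p v).fixedSet := congrArg Subtype.val hy
    rw [poly1_fixedSet hp] at hy
    obtain rfl | rfl | rfl := hy
    · refine absurd ?_ (hyc ⟨0, by simp⟩ (by simp))
      refine (polyMk_coe _).symm.trans (congrArg (polyMk p) ?_)
      simp
    · exact ⟨4, rfl⟩
    · exact ⟨5, rfl⟩

end

/-! ### The sum of the degrees at the six fixed points -/

section

variable [Fact p.Prime]

/-- The restriction of a function on the tower of two polygons to the first polygon. -/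
noncomputable def pullPoly (u v : (ZMod p)ˣ) (f : (poly2 p u v).carrier → Circle) :
    (poly1 p u).carrier → Circle :=
  (polyConjDisk p u).pullInl (equatorDisk p v)
    ((ribbonPoleDisk p u v).pullInl (polyCenterDisk p v) f)

/-- The restriction of a function on the tower of two polygons to the ribbon. -/
noncomputable def pullRibbon (u v : (ZMod p)ˣ) (f : (poly2 p u v).carrier → Circle) :
    (repSphere p v).carrier → Circle :=
  (polyConjDisk p u).pullInr (equatorDisk p v)
    ((ribbonPoleDisk p u v).pullInl (polyCenterDisk p v) f)

variable {u v : (ZMod p)ˣ} {f : (poly2 p u v).carrier → Circle}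

lemma continuousOn_pullPoly (hf : ContinuousOn f (poly2 p u v).fixedSetᶜ) :
    ContinuousOn (pullPoly u v f) {x | (∀ (k : ℕ) (w : UnitDisk), ‖(w : ℂ)‖ < 1 →
      (poly1 p u).act^[k] ((polyConjDisk p u).toFun w) ≠ x) ∧ x ∉ (poly1 p u).fixedSet} := by
  refine (polyConjDisk p u).continuousOn_pullInl (equatorDisk p v)
    ((ribbonPoleDisk p u v).continuousOn_pullInl (polyCenterDisk p v) hf) fun x hx => ?_
  refine ⟨⟨x, hx.1⟩, rfl, fun w _ h => ?_, fun h => hx.2 ?_⟩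
  · exact inl_notMem_range_ribbonPoleDisk u v ⟨x, hx.1⟩ ⟨w, h⟩
  · exact ((polyConjDisk p u).inl_mem_fixedSet_iff (equatorDisk p v) (x := ⟨x, hx.1⟩)).1 h

lemma continuousOn_pullRibbon (hf : ContinuousOn f (poly2 p u v).fixedSetᶜ) :
    ContinuousOn (pullRibbon u v f) {y | (∀ (k : ℕ) (w : UnitDisk), ‖(w : ℂ)‖ < 1 →
      (repSphere p v).act^[k] ((equatorDisk p v).toFun w) ≠ y) ∧
      (∀ w : UnitDisk, ‖(w : ℂ)‖ < 1 → (poleDisk p v).toFun w ≠ y) ∧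
      y ∉ (repSphere p v).fixedSet} := by
  refine (polyConjDisk p u).continuousOn_pullInr (equatorDisk p v)
    ((ribbonPoleDisk p u v).continuousOn_pullInl (polyCenterDisk p v) hf) fun y hy => ?_
  refine ⟨⟨y, hy.1⟩, rfl, fun w hw h => hy.2.1 w hw ?_, fun h => hy.2.2 ?_⟩
  · exact congrArg Subtype.val ((polyConjDisk p u).inr_injective (equatorDisk p v) h)
  · exact ((polyConjDisk p u).inr_mem_fixedSet_iff (equatorDisk p v) (y := ⟨y, hy.1⟩)).1 h

lemma pullPoly_eq_pullRibbon (k : ZMod p) {w : ℂ} (hw : ‖w‖ = 1) :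
    pullPoly u v f (polyMk p
      (ZMod.toCircle (k * (u : ZMod p)) * ((1 / 2 : ℝ) + (1 / (2 * p) : ℝ) * w)))
      = pullRibbon u v f ((ZMod.toCircle (k * (v : ZMod p)) * ((1 : ℝ) + (1 / p : ℝ) * w) : ℂ) :
        OnePoint ℂ) := by
  have h1 := iterate_act_polyConjDisk u k.val ⟨w, by simp [hw]⟩
  have h2 : (repSphere p v).act^[k.val] ((equatorDisk p v).toFun ⟨w, by simp [hw]⟩)
    = _ := repSphere_iterate_act v k.val _
  rw [ZMod.natCast_zmod_val] at h1 h2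
  exact (congrArg _ h1.symm).trans
    (((polyConjDisk p u).pullInl_eq_pullInr (equatorDisk p v) hw k.val).trans (congrArg _ h2))

lemma pullRibbon_eq_pullInr {w : ℂ} (hw : ‖w‖ = 1) :
    pullRibbon u v f ((((1 / 4 : ℝ) : ℂ) * w : ℂ) : OnePoint ℂ)
      = (ribbonPoleDisk p u v).pullInr (polyCenterDisk p v) f
        (polyMk p (((1 / 2 : ℝ) : ℂ) * w)) := by
  have hw1 : w ∈ closedBall (0 : ℂ) 1 := by simp [hw]
  have h1 : (poleDisk p v).toFun ⟨w, hw1⟩ = ((((1 / 4 : ℝ) : ℂ) * w : ℂ) : OnePoint ℂ) :=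
    congrArg (fun z : ℂ => (z : OnePoint ℂ)) (by push_cast; ring)
  have h2 : (polyCenterDisk p v).toFun ⟨w, hw1⟩ = polyMk p (((1 / 2 : ℝ) : ℂ) * w) :=
    (polyMk_coe _).symm.trans (congrArg (polyMk p) (by push_cast; ring))
  have h3 := (ribbonPoleDisk p u v).pullInl_eq_pullInr (polyCenterDisk p v) (f := f)
    (w := ⟨w, hw1⟩) hw
  rw [h2] at h3
  refine (congrArg _ h1.symm).trans (Eq.trans ?_ h3)
  exact (polyConjDisk p u).pullInr_apply (equatorDisk p v)
    ⟨(poleDisk p v).toFun ⟨w, hw1⟩, fun k w' _ => equatorDisk_ne_poleDisk v k w' _⟩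

lemma continuousOn_pullPoly_polyMk (hp : Odd p) (hf : ContinuousOn f (poly2 p u v).fixedSetᶜ) :
    ContinuousOn (fun z => pullPoly u v f (polyMk p z)) {z ∈ truncDisk p (1 / (2 * p)) |
      z ≠ 0 ∧ ∀ k, 1 / (2 * p) ≤ ‖z - ringCenter u (1 / 2) (some k)‖} := by
  have hp0 : (0 : ℝ) < p := by exact_mod_cast NeZero.pos p
  have hq0 : (0 : ℝ) < 1 / (2 * p) := by positivity
  refine (continuousOn_pullPoly hf).comp continuous_polyMk.continuousOn fun z hz => ⟨?_,
    polyMk_notMem_fixedSet hp u hz.1 hz.2.1⟩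
  intro k w hw h
  have h1 := (iterate_act_polyConjDisk u k w).symm.trans h
  have h2 := norm_ring_point hp (ZMod.toCircle ((k : ZMod p) * (u : ZMod p))) w
  have h3 := (polyMk_eq_iff hz.1.1 (by linarith)).1 h1.symm
  have h4 := hz.2.2 (k : ZMod p)
  rw [h3, ringCenter, Option.elim_some, mul_add, add_sub_cancel_left, norm_mul, Circle.norm_coe,
    one_mul, norm_mul, norm_real, Real.norm_eq_abs, abs_of_pos hq0] at h4
  nlinarith

lemma continuousOn_pullPoly_vertexMap (hp : Odd p) (hf : ContinuousOn f (poly2 p u v).fixedSetᶜ)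
    (ε : ℤ) : ContinuousOn (fun w => pullPoly u v f (vertexMap p ε w))
      (ball 0 (vertexRadius p) \ {0}) := by
  refine (continuousOn_pullPoly hf).comp ((continuousOn_vertexMap hp ε).mono
    (sdiff_subset.trans ball_subset_closedBall)) fun w hw => ⟨fun k w' _ h => ?_,
    vertexMap_notMem_fixedSet hp u ε (mem_ball_zero_iff.1 hw.1).le hw.2⟩
  exact polyVertexChart_notMem hp u ε ⟨w, hw.1⟩ ⟨k, w', h⟩

lemma continuousOn_pullRibbon_coe (hf : ContinuousOn f (poly2 p u v).fixedSetᶜ) :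
    ContinuousOn (fun z : ℂ => pullRibbon u v f (z : OnePoint ℂ))
      {z | 1 / 4 ≤ ‖z‖ ∧ ∀ k, 1 / p ≤ ‖z - ringCenter v 1 (some k)‖} := by
  have hp0 : (0 : ℝ) < p := by exact_mod_cast NeZero.pos p
  have hq0 : (0 : ℝ) < 1 / p := by positivity
  refine (continuousOn_pullRibbon hf).comp OnePoint.continuous_coe.continuousOn fun z hz =>
    ⟨fun k w hw h => ?_, fun w hw h => ?_, ?_⟩
  · have h1 := OnePoint.coe_injective ((repSphere_iterate_act v k _).symm.trans h)
    have h4 := hz.2 (k : ZMod p)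
    rw [← h1, ringCenter, Option.elim_some, mul_add, add_sub_cancel_left, norm_mul,
      Circle.norm_coe, one_mul, norm_mul, norm_real, Real.norm_eq_abs, abs_of_pos hq0] at h4
    nlinarith
  · have h1 := OnePoint.coe_injective h
    have h4 := hz.1
    rw [← h1, ofReal_zero, zero_add, norm_mul, norm_real, Real.norm_eq_abs,
      abs_of_pos (by norm_num)] at h4
    linarith
  · rw [repSphere_fixedSet]
    rintro (h | h)
    · have h4 := hz.1
      rw [OnePoint.coe_injective h, norm_zero] at h4
      norm_num at h4
    · exact OnePoint.coe_ne_infty z h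

lemma continuousOn_pullInr_polyMk (hp : Odd p) (hf : ContinuousOn f (poly2 p u v).fixedSetᶜ) :
    ContinuousOn (fun z => (ribbonPoleDisk p u v).pullInr (polyCenterDisk p v) f (polyMk p z))
      {z ∈ truncDisk p (1 / (2 * p)) | 1 / 2 ≤ ‖z‖} := by
  refine ((ribbonPoleDisk p u v).continuousOn_pullInr (polyCenterDisk p v) hf).comp
    continuous_polyMk.continuousOn fun z hz => ⟨fun w hw h => ?_,
    polyMk_notMem_fixedSet hp v hz.1 fun h0 => ?_⟩
  · have h1 : polyMk p ((0 : ℝ) + (1 / 2 : ℝ) * (w : ℂ)) = polyMk p z := (polyMk_coe _).trans h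
    have h2 : ‖((0 : ℝ) + (1 / 2 : ℝ) * (w : ℂ) : ℂ)‖ = 1 / 2 * ‖(w : ℂ)‖ := by
      rw [ofReal_zero, zero_add, norm_mul, norm_real, Real.norm_eq_abs, abs_of_pos (by norm_num)]
    have h4 := hz.2
    rw [(polyMk_eq_iff hz.1.1 (by rw [h2]; linarith)).1 h1.symm, h2] at h4
    linarith
  · have h4 := hz.2
    rw [h0, norm_zero] at h4
    norm_num at h4

lemma continuousOn_pullInr_vertexMap (hp : Odd p) (hf : ContinuousOn f (poly2 p u v).fixedSetᶜ)
    (ε : ℤ) : ContinuousOn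
      (fun w => (ribbonPoleDisk p u v).pullInr (polyCenterDisk p v) f (vertexMap p ε w))
      (ball 0 (vertexRadius p) \ {0}) := by
  refine ((ribbonPoleDisk p u v).continuousOn_pullInr (polyCenterDisk p v) hf).comp
    ((continuousOn_vertexMap hp ε).mono (sdiff_subset.trans ball_subset_closedBall))
    fun w hw => ⟨fun w' _ h => ?_,
    vertexMap_notMem_fixedSet hp v ε (mem_ball_zero_iff.1 hw.1).le hw.2⟩
  exact polyVertexChart_notMem_range hp v ε ⟨w, hw.1⟩ ⟨w', h⟩

lemma hasDeg_pullPoly {a : ZMod p} {c : RotChart (poly1 p u) a}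
    {h : ∀ w, c.toFun w ∉ (polyConjDisk p u).conj} {n : ℤ}
    (hn : (poly2ChartInl u v c h).HasDeg f n) : c.HasDeg (pullPoly u v f) n :=
  (polyConjDisk p u).hasDeg_pullInl (equatorDisk p v) (h := h)
    ((ribbonPoleDisk p u v).hasDeg_pullInl (polyCenterDisk p v)
      (h := fun _ => inl_notMem_range_ribbonPoleDisk u v _) hn)

lemma hasDeg_pullRibbon {n : ℤ} (hn : (poly2ChartInfty u v).HasDeg f n) :
    (repSphereChartInfty v (1 / 4) (by norm_num)).HasDeg (pullRibbon u v f) n :=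
  (polyConjDisk p u).hasDeg_pullInr (equatorDisk p v) (h := sphereInv_notMem_conj v)
    ((ribbonPoleDisk p u v).hasDeg_pullInl (polyCenterDisk p v)
      (h := ribbonChartInfty_notMem_range u v) hn)

/-- For every circle-valued function on the tower of two polygons which is continuous away from
the fixed points, the sum of the degrees at the six fixed points vanishes. -/
lemma poly2_degree_sum (hp : Odd p) (hf : ContinuousOn f (poly2 p u v).fixedSetᶜ) {n : Fin 6 → ℤ}
    (hn : ∀ i, (poly2Chart hp u v i).2.HasDeg f (n i)) : ∑ i, n i = 0 := by
  have e₀ := hasDeg_pullPoly (c := polyCenterChart u (1 / 4) (by norm_num) (by norm_num))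
    (h := polyCenterChart_notMem hp u) (hn 0)
  have e₁ := hasDeg_pullPoly (c := polyVertexChart hp u 0) (h := polyVertexChart_notMem hp u 0)
    (hn 1)
  have e₂ := hasDeg_pullPoly (c := polyVertexChart hp u 1) (h := polyVertexChart_notMem hp u 1)
    (hn 2)
  have e₃ := hasDeg_pullRibbon (hn 3)
  have e₄ := (ribbonPoleDisk p u v).hasDeg_pullInr (polyCenterDisk p v)
    (c := polyVertexChart hp v 0) (h := polyVertexChart_notMem_range hp v 0) (hn 4)
  have e₅ := (ribbonPoleDisk p u v).hasDeg_pullInr (polyCenterDisk p v)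
    (c := polyVertexChart hp v 1) (h := polyVertexChart_notMem_range hp v 1) (hn 5)
  have h3 : PunctDeg (fun w : ℂ => pullRibbon u v f (((starRingEnd ℂ w)⁻¹ : ℂ) : OnePoint ℂ))
      (n 3) := by
    refine (e₃.punctDeg (g := fun w : ℂ => pullRibbon u v f (sphereInv (w : OnePoint ℂ)))
      fun w => rfl).congr one_pos fun w h0 _ => ?_
    exact congrArg (pullRibbon u v f) (sphereInv_coe h0).symm
  have h := degree_sum_of_pieces hp u v (continuousOn_pullPoly_polyMk hp hf)
    (continuousOn_pullPoly_vertexMap hp hf) (continuousOn_pullRibbon_coe hf)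
    (continuousOn_pullInr_polyMk hp hf) (continuousOn_pullInr_vertexMap hp hf)
    (fun k w hw => pullPoly_eq_pullRibbon k hw) (fun w hw => pullRibbon_eq_pullInr hw)
    (e₀.punctDeg fun w => rfl) (e₁.punctDeg fun w => rfl) (e₂.punctDeg fun w => rfl) h3
    (e₄.punctDeg fun w => rfl) (e₅.punctDeg fun w => rfl)
  rw [Fin.sum_univ_six]
  exact h

end

/-! ### The two surfaces are not isomorphic -/

section

variable [Fact p.Prime]

lemma two_ne_zero_of_odd (hp : Odd p) : (2 : ZMod p) ≠ 0 := fun h => by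
  have h1 : ((2 : ℕ) : ZMod p) = 0 := by exact_mod_cast h
  rw [ZMod.natCast_eq_zero_iff] at h1
  have := Nat.le_of_dvd two_pos h1
  have := three_le hp
  omega

lemma poly2Chart_weight_ne_zero (hp : Odd p) (u v : (ZMod p)ˣ) (i : Fin 6) :
    (poly2Chart hp u v i).1 ≠ 0 := by
  have h : ∀ w : (ZMod p)ˣ, -2 * (w : ZMod p) ≠ 0 := fun w =>
    mul_ne_zero (neg_ne_zero.2 (two_ne_zero_of_odd hp)) w.ne_zero
  fin_cases i
  · exact u.ne_zero
  · exact h u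
  · exact h u
  · exact v.ne_zero
  · exact h v
  · exact h v

lemma poly2Chart_center_injective (hp : Odd p) (u v : (ZMod p)ˣ) :
    Function.Injective fun i => (poly2Chart hp u v i).2.center := by
  classical
  have h1 : (poly2 p u v).fixedSet
      = ((Finset.univ.image fun i => (poly2Chart hp u v i).2.center :
        Finset (poly2 p u v).carrier) : Set (poly2 p u v).carrier) := by
    ext x
    rw [Finset.coe_image, Finset.coe_univ, image_univ]
    refine ⟨fun hx => exists_poly2Chart_center_eq hp u v hx, ?_⟩
    rintro ⟨i, rfl⟩
    exact (poly2Chart hp u v i).2.act_center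
  have h2 := ncard_poly2_fixedSet hp u v
  rw [h1, ncard_coe_finset] at h2
  have h3 := Finset.card_image_iff.1 (h2.trans (Finset.card_fin 6).symm)
  rwa [Finset.coe_univ, injOn_univ] at h3

lemma RotChart.ext_notMem_fixedSet {X : CpSpace p} {a : ZMod p} (c : RotChart X a) (ha : a ≠ 0)
    {z : ℂ} (hz : ‖z‖ < c.radius) (h0 : z ≠ 0) : c.ext z ∉ X.fixedSet := fun h => by
  have h1 : c.ext (ZMod.toCircle a * z) = c.ext z := (c.act_ext hz).symm.trans h
  have h2 := c.ext_injOn (mem_ball_zero_iff.2 (by rwa [norm_mul, Circle.norm_coe, one_mul]))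
    (mem_ball_zero_iff.2 hz) h1
  exact toCircle_ne_one ha (Circle.ext (mul_right_cancel₀ h0 (h2.trans (one_mul z).symm)))

/-- If `X`, whose fixed points come in pairs of poles, is isomorphic to the tower of two polygons,
then the rotation angles at the fixed points of the latter come in pairs of opposite angles. Indeed,
the function that belongs to a pair of poles has degrees `± p` at two fixed points of the tower and
degree `0` at the others, so that the two signs are opposite. The signs are those of the
homeomorphism at the two points, where the angles for `X` are the same. -/
lemma exists_weight_eq_neg (hp : Odd p) (u v : (ZMod p)ˣ) {X : CpSpace p} {B : Set X.carrier}
    (hX : ∀ x ∈ X.fixedSet, ∃ x' ∈ X.fixedSet, IsPolePair X x x' B)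
    (hiso : X.IsoUpToAut (poly2 p u v)) (i : Fin 6) :
    ∃ j, (poly2Chart hp u v j).1 = -(poly2Chart hp u v i).1 := by
  obtain ⟨a, e, he⟩ := hiso
  have hfix : ∀ x, x ∈ X.fixedSet → e x ∈ (poly2 p u v).fixedSet := fun x hx => by
    have h1 : (poly2 p u v).act^[(a : ZMod p).val] (e x) = e x := by
      rw [← he, show X.act x = x from hx]
    have h2 := Function.iterate_fixed h1 ((a⁻¹ : (ZMod p)ˣ) : ZMod p).val
    rw [← Function.iterate_mul, ← ConjDisk.iterate_act_mod, ← ZMod.val_mul, ← Units.val_mul,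
      mul_inv_cancel, Units.val_one, ZMod.val_one] at h2
    exact h2
  have hfix' : ∀ x, e x ∈ (poly2 p u v).fixedSet → x ∈ X.fixedSet := fun x hx =>
    e.injective ((he x).trans (Function.iterate_fixed hx _))
  obtain ⟨x, hx⟩ := e.surjective (poly2Chart hp u v i).2.center
  have hxf : x ∈ X.fixedSet := hfix' x (by rw [hx]; exact (poly2Chart hp u v i).2.act_center)
  obtain ⟨x', hxf', hne, α, c, c', f, hc, hc', -, -, -, hf, -, hd, hd'⟩ := hX x hxf
  obtain ⟨j, hj⟩ := exists_poly2Chart_center_eq hp u v (hfix x' hxf')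
  have hij : i ≠ j := by
    rintro rfl
    exact hne (e.injective (hx.trans hj))
  -- the function on the tower, and its degrees
  set F : (poly2 p u v).carrier → Circle := fun y => f (e.symm y) with hF
  have hFc : ContinuousOn F {e x, e x'}ᶜ := by
    refine hf.comp e.symm.continuous.continuousOn fun y hy h => hy ?_
    rcases h with h | h
    · exact Or.inl (by rw [← h, e.apply_symm_apply])
    · exact Or.inr (by rw [← mem_singleton_iff.1 h, e.apply_symm_apply, mem_singleton_iff])
  have hsub : (poly2 p u v).fixedSetᶜ ⊆ {e x, e x'}ᶜ := by
    refine compl_subset_compl.2 ?_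
    rintro _ (rfl | rfl)
    · exact hfix x hxf
    · exact hfix x' hxf'
  have hcont : ∀ l, ContinuousOn (fun z => F ((poly2Chart hp u v l).2.ext z))
      (ball 0 (poly2Chart hp u v l).2.radius \ {0}) := fun l =>
    hFc.comp ((poly2Chart hp u v l).2.continuousOn_ext.mono sdiff_subset) fun z hz =>
      hsub ((poly2Chart hp u v l).2.ext_notMem_fixedSet (poly2Chart_weight_ne_zero hp u v l)
        (mem_ball_zero_iff.1 hz.1) hz.2)
  have hdeg : ∀ l, ∃ n, (poly2Chart hp u v l).2.HasDeg F n := fun l => by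
    obtain ⟨n, hn, -⟩ := exists_punctDeg (poly2Chart hp u v l).2.radius_pos (hcont l)
    exact ⟨n, hn⟩
  choose n hn using hdeg
  have hzero : ∀ l, l ≠ i ∧ l ≠ j → n l = 0 := fun l hl => by
    refine (hn l).unique (punctDeg_zero_of_continuousOn (poly2Chart hp u v l).2.radius_pos ?_)
    refine hFc.comp (poly2Chart hp u v l).2.continuousOn_ext fun z hz => ?_
    rcases eq_or_ne z 0 with rfl | h0
    · rw [RotChart.ext_zero]
      rintro (h | h)
      · exact hl.1 (poly2Chart_center_injective hp u v (h.trans hx))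
      · exact hl.2 (poly2Chart_center_injective hp u v (Eq.trans h hj.symm))
    · exact hsub ((poly2Chart hp u v l).2.ext_notMem_fixedSet
        (poly2Chart_weight_ne_zero hp u v l) (mem_ball_zero_iff.1 hz) h0)
  have hsum := poly2_degree_sum hp (hFc.mono hsub) hn
  rw [Fintype.sum_eq_add i j hij hzero] at hsum
  obtain ⟨ε, hε, hεw, hεd⟩ := c.exists_sign (poly2Chart hp u v i).2 (e := e)
    (by rw [hc, hx]) he
  obtain ⟨ε', hε', hεw', hεd'⟩ := c'.exists_sign (poly2Chart hp u v j).2 (e := e)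
    (by rw [hc', hj]) he
  have hFe : (fun x => F (e x)) = f := funext fun x => congrArg f (e.symm_apply_apply x)
  have h1 : ε * n i = p := by
    have := hεd F _ (hn i)
    rw [hFe] at this
    exact PunctDeg.unique this hd
  have h2 : ε' * n j = p := by
    have := hεd' F _ (hn j)
    rw [hFe] at this
    exact PunctDeg.unique this hd'
  have hp0 : (0 : ℤ) < p := by exact_mod_cast NeZero.pos p
  have hsign : ε' = -ε := by
    rcases hε with rfl | rfl <;> rcases hε' with rfl | rfl <;> first | rfl | omega
  refine ⟨j, a.isUnit.mul_left_cancel ?_⟩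
  rw [ZMod.natCast_zmod_val] at hεw hεw'
  rw [mul_neg, ← hεw', ← hεw, hsign]
  push_cast
  ring

end

end

theorem mainTheorem3 (p : ℕ) [Fact p.Prime] (hp : Odd p) (i j k u v : (ZMod p)ˣ)
    (huv : (u : ZMod p) + (v : ZMod p) ≠ 0) :
    (sphSix p i j k).fixedSet.ncard = 6 ∧ (poly2 p u v).fixedSet.ncard = 6 ∧
      ¬ (sphSix p i j k).IsoUpToAut (poly2 p u v) := by
  refine ⟨ncard_sphSix_fixedSet i j k, ncard_poly2_fixedSet hp u v, fun hiso => ?_⟩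
  have hweights : ∀ l, ∃ l', (poly2Chart hp u v l').1 = -(poly2Chart hp u v l).1 :=
    exists_weight_eq_neg hp u v (exists_isPolePair_sphSix i j k) hiso
  have h2 := two_ne_zero_of_odd hp
  have hne : ∀ w : (ZMod p)ˣ, (w : ZMod p) ≠ -w := fun w h => by
    have h3 : 2 * (w : ZMod p) = 0 := by linear_combination h
    exact mul_ne_zero h2 w.ne_zero h3
  have hne' : ∀ w : (ZMod p)ˣ, -2 * (w : ZMod p) ≠ -w := fun w h =>
    w.ne_zero (by linear_combination -h)
  -- the angle opposite to the one at the centre of the first polygon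
  have hu : -2 * (v : ZMod p) = -u := by
    obtain ⟨l, hl⟩ := hweights 0
    replace hl : (poly2Chart hp u v l).1 = -(u : ZMod p) := hl
    fin_cases l
    · exact absurd hl (hne u)
    · exact absurd hl (hne' u)
    · exact absurd hl (hne' u)
    · exact absurd (by rw [show (v : ZMod p) = -u from hl, add_neg_cancel]) huv
    · exact hl
    · exact hl
  -- the angle opposite to the one at the pole `∞` of the ribbon
  have hv : -2 * (u : ZMod p) = -v := by
    obtain ⟨l, hl⟩ := hweights 3
    replace hl : (poly2Chart hp u v l).1 = -(v : ZMod p) := hl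
    fin_cases l
    · exact absurd (by rw [show (u : ZMod p) = -v from hl, neg_add_cancel]) huv
    · exact hl
    · exact hl
    · exact absurd hl (hne v)
    · exact absurd hl (hne' v)
    · exact absurd hl (hne' v)
  -- adding `u = 2 v` and `v = 2 u` gives `u + v = 2 (u + v)`
  exact huv (by linear_combination -hu - hv)
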